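/- Let $d,k\ge 1$ be integers. A hypergraph is given by a vertex set $V$ and a family of hyperedges, each a finite subset of $V$ (parallel hyperedges are allowed). A matching is a set $M$ of pairwise disjoint hyperedges; with activity $\lambda>0$ it has weight $\lambda^{|M|}$, $Z_\lambda(\mathcal H)=\sum_M\lambda^{|M|}$ is the partition function of a finite hypergraph $\mathcal H$, and the Gibbs measure is $\mu(M)=\lambda^{|M|}/Z_\lambda(\mathcal H)$. For a set $\Lambda$ of hyperedges and a matching $\sigma_\Lambda\in\{0,1\}^\Lambda$ partially specified on $\Lambda$, let $p_e^{\sigma_\Lambda}$ be the probability that the hyperedge $e$ belongs to the random matching, conditioned on $\sigma_\Lambda$. The distance between hyperedges is the graph distance when distinct intersecting hyperedges are adjacent. The model exhibits strong spatial mixing with rate $\delta$ on $\mathcal H$ if $|p_e^{\sigma_\Lambda}-p_e^{\tau_\Lambda}|\le\delta(\mathrm{dist}(e,\Delta))$ for all $e$, $\Lambda$, $\sigma_\Lambda$, $\tau_\Lambda$, where $\Delta\subseteq\Lambda$ is the set on which $\sigma_\Lambda$ and $\tau_\Lambda$ differ (with no difference at all if the distance is infinite); on infinite hypergraphs this is required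 for every finite set $\Psi$ of hyperedges containing $e$ and $\Lambda$, with all hyperedges outside $\Psi$ unoccupied. For $0<\varepsilon<1$, $\hat Z$ is an $\varepsilon$-approximation of $Z$ if $(1-\varepsilon)Z\le\hat Z\le(1+\varepsilon)Z$. Put $\lambda_c=\frac{d^d}{k(d-1)^{d+1}}$ ($=\infty$ if $d=1$). Algorithms run on a random access machine over the natural numbers with unit-cost memory access, comparison, addition and subtraction, where multiplication and division are charged by bit length; the input is a finite hypergraph (as a list of hyperedges) and a rational $\varepsilon\in(0,1)$, and the output is a rational number; the real number $\lambda$ is accessed through queries $x\mapsto\lfloor\lambda x\rfloor$, $x\in\mathbb N$, also charged by bit length. Let $n$ be the number of hyperedges. There is an absolute constant $B$ such that for all integers $d,k\ge1$ and all real $\lambda>0$ the following holds for the matchings with activity $\lambda$ on all hypergraphs of maximum edge size at most $d+1$ and maximum degree at most $k+1$. 1. If $\lambda<\lambda_c$, there are $C>0$ and $q\in(0,1)$, depending only on $d,k,\lambda$, such that the model exhibits strong spatial mixing with the exponential rate $\delta(\ell)=Cq^\ell$ on all these hypergraphs. Moreover the positive solution $\hat x$ of $\hat x=k\lambda(1+\hat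 x)^{-d}$ satisfies $\frac{d\hat x}{1+\hat x}<1$, and with $\kappa=\ln\frac{1+\hat x}{d\hat x}>0$ there are a constant $A=A(d,k,\lambda)$ and an algorithm that for every $\varepsilon$ and every finite hypergraph of this class returns an $\varepsilon$-approximation of the partition function within time $A\left(\frac{n+1}{\varepsilon}\right)^{B\left(1+\frac1\kappa\ln(kd)\right)}$; in particular it is an FPTAS. 2. If $\lambda=\lambda_c$, there are $C,\alpha>0$, depending only on $d,k$, such that the model exhibits strong spatial mixing with the polynomial rate $\delta(\ell)=C(\ell+1)^{-\alpha}$ on all these hypergraphs. Moreover there are constants $A,B'$ depending only on $d,k$ and an algorithm that for every $\varepsilon$ and every finite hypergraph of this class returns an $\varepsilon$-approximation of the log-partition function $\ln Z_\lambda$ within time $A\,(n+1)\,(kd)^{B'\left(\frac1\varepsilon\ln\frac1\varepsilon\right)^2}$; in particular it is a PTAS. -/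

import Mathlib

/-! # Hypergraph matchings: Gibbs measure, strong spatial mixing, and approximation algorithms -/

/-- A hypergraph with vertices `V` and hyperedges indexed by `E`; a collection of vertex subsets
is the case of an injective `edge`. Parallel hyperedges are allowed, so that the class is closed
under duality. -/
structure HGraph (V E : Type*) where
  /-- the vertex set of a hyperedge -/
  edge : E → Finset V

namespace HGraph

variable {V E : Type*} (H : HGraph V E)

/-- Every hyperedge has at most `s` vertices. -/
def EdgeSizeLE (s : ℕ) : Prop := ∀ e, (H.edge e).card ≤ s

/-- Every vertex lies in at most `s` hyperedges. -/
def DegreeLE (s : ℕ) : Prop := ∀ v, {e | v ∈ H.edge e}.encard ≤ s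

/-- A matching: a set of pairwise disjoint hyperedges. -/
def IsMatching (M : Finset E) : Prop := (M : Set E).PairwiseDisjoint H.edge

open Classical in
/-- The matchings that only use hyperedges of the finite region `Ψ`. -/
noncomputable def matchings (Ψ : Finset E) : Finset (Finset E) :=
  Ψ.powerset.filter (fun M => H.IsMatching M)

/-- The partition function `∑ lam ^ |M|` over all matchings `M`. -/
noncomputable def partitionFn [Fintype E] (lam : ℝ) : ℝ :=
  ∑ M ∈ H.matchings Finset.univ, lam ^ M.card

open Classical in
/-- The hyperedges of `Λ` that the configuration `σ` declares occupied. -/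
noncomputable def occupied (Λ : Finset E) (σ : E → Bool) : Finset E :=
  Λ.filter (fun e => σ e = true)

open Classical in
/-- The matchings in the region `Ψ` that agree on `Λ` with the configuration `σ`. -/
noncomputable def conditioned (Ψ Λ : Finset E) (σ : E → Bool) : Finset (Finset E) :=
  (H.matchings Ψ).filter (fun M => ∀ f ∈ Λ, (f ∈ M ↔ σ f = true))

open Classical in
/-- The probability that `e` belongs to the random matching of the region `Ψ` (all hyperedges
outside of `Ψ` being unoccupied), conditioned on the configuration `σ` on `Λ`. -/
noncomputable def marginal (lam : ℝ) (Ψ Λ : Finset E) (σ : E → Bool) (e : E) : ℝ :=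
  (∑ M ∈ (H.conditioned Ψ Λ σ).filter (fun M => e ∈ M), lam ^ M.card) /
    ∑ M ∈ H.conditioned Ψ Λ σ, lam ^ M.card

/-- Two distinct hyperedges are adjacent when they intersect (adjacency in the dual). -/
def lineGraph : SimpleGraph E where
  Adj e f := e ≠ f ∧ ¬ Disjoint (H.edge e) (H.edge f)
  symm := ⟨fun _ _ h => ⟨h.1.symm, fun h' => h.2 h'.symm⟩⟩
  loopless := ⟨fun _ h => h.1 rfl⟩

/-- The distance from a hyperedge `e` to a set `D` of hyperedges; `⊤` if `D` is empty or cannot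
be reached from `e`. -/
noncomputable def distTo (e : E) (D : Set E) : ℕ∞ := ⨅ f ∈ D, H.lineGraph.edist e f

/-- Strong spatial mixing of matchings with activity `lam` and rate `δ`, for finite and infinite
hypergraphs. `Ψ` is the finite region (for a finite hypergraph, `Ψ = univ` gives the plain
Gibbs measure), `σ` and `τ` are two matchings partially specified on `Λ ⊆ Ψ`, and the distance is
to the set where they differ; at infinite distance there is no influence. -/
def StrongSpatialMixing (lam : ℝ) (δ : ℕ → ℝ) : Prop :=
  ∀ (Ψ Λ : Finset E), Λ ⊆ Ψ → ∀ e ∈ Ψ, ∀ σ τ : E → Bool,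
    H.IsMatching (occupied Λ σ) → H.IsMatching (occupied Λ τ) →
      (∀ ℓ : ℕ, H.distTo e {f | f ∈ Λ ∧ σ f ≠ τ f} = ℓ →
        |H.marginal lam Ψ Λ σ e - H.marginal lam Ψ Λ τ e| ≤ δ ℓ) ∧
      (H.distTo e {f | f ∈ Λ ∧ σ f ≠ τ f} = ⊤ →
        H.marginal lam Ψ Λ σ e = H.marginal lam Ψ Λ τ e)

end HGraph

/-- The critical activity `d ^ d / (k * (d - 1) ^ (d + 1))`, equal to `⊤` for `d = 1`. -/
noncomputable def lambdaC (d k : ℕ) : ENNReal :=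
  (d : ENNReal) ^ d / ((k : ENNReal) * ((d : ENNReal) - 1) ^ (d + 1))

/-! ## A random access machine

The memory has a cell for every natural number, each holding a natural number. Programs are
structured (assignment with indirect addressing, sequencing, conditional, loop). Every operation
costs one step, except that multiplication, division and a query of the activity
`lam` are charged one plus the bit lengths of their operands. A query returns `⌊lam * x⌋`: this is
how a program reads the real number `lam` to any finite precision. -/

namespace RAM

/-- Expressions. -/
inductive Expr where
  | lit (c : ℕ) : Expr
  | load (a : Expr) : Expr
  | add (a b : Expr) : Expr
  | sub (a b : Expr) : Expr
  | mul (a b : Expr) : Expr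
  | div (a b : Expr) : Expr
  | query (a : Expr) : Expr

/-- Programs. -/
inductive Prog where
  | skip : Prog
  | store (a e : Expr) : Prog
  | seq (p q : Prog) : Prog
  | branch (e : Expr) (p q : Prog) : Prog
  | loop (e : Expr) (p : Prog) : Prog

/-- The value of an expression in a memory (truncated subtraction, rounded down division). -/
noncomputable def Expr.eval (lam : ℝ) (m : ℕ → ℕ) : Expr → ℕ
  | .lit c => c
  | .load a => m (a.eval lam m)
  | .add a b => a.eval lam m + b.eval lam m
  | .sub a b => a.eval lam m - b.eval lam m
  | .mul a b => a.eval lam m * b.eval lam m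
  | .div a b => a.eval lam m / b.eval lam m
  | .query a => ⌊lam * (a.eval lam m : ℝ)⌋₊

/-- The number of steps needed to evaluate an expression. -/
noncomputable def Expr.cost (lam : ℝ) (m : ℕ → ℕ) : Expr → ℕ
  | .lit _ => 1
  | .load a => a.cost lam m + 1
  | .add a b => a.cost lam m + b.cost lam m + 1
  | .sub a b => a.cost lam m + b.cost lam m + 1
  | .mul a b => a.cost lam m + b.cost lam m +
      (1 + Nat.size (a.eval lam m) + Nat.size (b.eval lam m))
  | .div a b => a.cost lam m + b.cost lam m +
      (1 + Nat.size (a.eval lam m) + Nat.size (b.eval lam m))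
  | .query a => a.cost lam m + (1 + Nat.size (a.eval lam m))

/-- `Exec lam p m m' t`: started in memory `m`, the program `p` halts with memory `m'` after
exactly `t` steps. -/
inductive Exec (lam : ℝ) : Prog → (ℕ → ℕ) → (ℕ → ℕ) → ℕ → Prop where
  | skip (m : ℕ → ℕ) : Exec lam .skip m m 1
  | store (a e : Expr) (m : ℕ → ℕ) :
      Exec lam (.store a e) m (Function.update m (a.eval lam m) (e.eval lam m))
        (a.cost lam m + e.cost lam m + 1)
  | seq (p q : Prog) (m m' m'' : ℕ → ℕ) (t t' : ℕ) :
      Exec lam p m m' t → Exec lam q m' m'' t' → Exec lam (.seq p q) m m'' (t + t' + 1)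
  | branch_true (e : Expr) (p q : Prog) (m m' : ℕ → ℕ) (t : ℕ) :
      e.eval lam m ≠ 0 → Exec lam p m m' t →
        Exec lam (.branch e p q) m m' (e.cost lam m + t + 1)
  | branch_false (e : Expr) (p q : Prog) (m m' : ℕ → ℕ) (t : ℕ) :
      e.eval lam m = 0 → Exec lam q m m' t →
        Exec lam (.branch e p q) m m' (e.cost lam m + t + 1)
  | loop_true (e : Expr) (p : Prog) (m m' m'' : ℕ → ℕ) (t t' : ℕ) :
      e.eval lam m ≠ 0 → Exec lam p m m' t → Exec lam (.loop e p) m' m'' t' →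
        Exec lam (.loop e p) m m'' (e.cost lam m + t + t' + 1)
  | loop_false (e : Expr) (p : Prog) (m : ℕ → ℕ) :
      e.eval lam m = 0 → Exec lam (.loop e p) m m (e.cost lam m + 1)

end RAM

/-- The input of an algorithm as a list of natural numbers: the accuracy `a / b`, the numbers of
vertices and of hyperedges, and then for each hyperedge its size followed by the increasing list of
its vertices. -/
def encodeInput {N n : ℕ} (H : HGraph (Fin N) (Fin n)) (a b : ℕ) : List ℕ :=
  [a, b, N, n] ++ (List.finRange n).flatMap
    (fun e => (H.edge e).card :: ((H.edge e).sort (· ≤ ·)).map Fin.val)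

/-- The memory that holds the input in its first cells, followed by zeros. -/
def inputMemory {N n : ℕ} (H : HGraph (Fin N) (Fin n)) (a b : ℕ) : ℕ → ℕ :=
  fun i => (encodeInput H a b).getD i 0

/-- `z` is an `ε`-approximation of `Z`. -/
def IsApprox (ε Z z : ℝ) : Prop := (1 - ε) * Z ≤ z ∧ z ≤ (1 + ε) * Z

/-- The program `P` is an approximation algorithm for the quantity `F`, on all finite hypergraphs
of maximum edge size at most `d + 1` and maximum degree at most `k + 1`, with running time at most
`T n ε`, where `n` is the number of hyperedges: given a hypergraph and a rational accuracy
`0 < ε = a / b < 1`, it halts within `T n ε` steps and leaves numerator and denominator of an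
`ε`-approximation of `F` in the cells `0` and `1`. -/
def Approximates (d k : ℕ) (lam : ℝ) (P : RAM.Prog)
    (F : {N n : ℕ} → HGraph (Fin N) (Fin n) → ℝ) (T : ℕ → ℝ → ℝ) : Prop :=
  ∀ (N n : ℕ) (H : HGraph (Fin N) (Fin n)), H.EdgeSizeLE (d + 1) → H.DegreeLE (k + 1) →
    ∀ a b : ℕ, 0 < a → a < b →
      ∃ (m : ℕ → ℕ) (t : ℕ), RAM.Exec lam P (inputMemory H a b) m t ∧
        (t : ℝ) ≤ T n ((a : ℝ) / b) ∧
        0 < m 1 ∧ IsApprox ((a : ℝ) / b) (F H) ((m 0 : ℝ) / m 1)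

universe u v

/-! ### Contraction of the ratio recursion in the potential `arsinh √(k x)` -/

section

open Real Finset

/-! For a hyperedge f outside a set A of hyperedges, let R = λ Z(members of A disjoint from f) /
Z(A), the odds that f is occupied. Deleting the vertices of f one by one makes this quotient a
telescoping product, and since a matching covers a vertex at most once, each factor has the form 1 /
(1 + ∑ R_g) over the hyperedges g still available at the current vertex (`HGraph.ratio_eq_treeStep`,
`HGraph.weight_away_div`). Iterating gives a tree recursion whose nodes below the root have at most
d branches, the parent vertex being already deleted, with at most k children each.

The recursion contracts in the potential θ = arsinh √(kR). By monotonicity the worst perturbation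
shifts all child potentials by the same amount (`contracts_of_branchPotential`), so only a
derivative along one curve is needed. Cauchy-Schwarz at each vertex, Cauchy-Schwarz and Jensen over
the vertices reduce this derivative to a function of one variable v, with v = 1 at the fixed point x
= kλ(1+x)^(-d) (`deriv_sq_bound`). The elementary inequality `one_sub_mul_pow_ge` then gives the
rate √(dx/(1+x)) as long as dx ≤ 1 + x, which is the condition λ ≤ λ_c. At criticality this rate is
1, but the same inequality leaves a gain quadratic in the distance to the fixed point; integrating
it, an error D at the parent costs at least D + cD³ at the children (`branchPotential_sub_cube_le`),
and such a sequence decays like ℓ^(-1/2).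

For spatial mixing, a boundary condition merely deletes hyperedges. If two of them differ only far
from e, the recursions truncated at a suitable depth coincide, and each true ratio is close to the
common value (`HGraph.strongSpatialMixing_of_contracts`). Hyperedges with fewer than d + 1 vertices
are padded by private vertices.

For the algorithms, hyperedges are inserted one at a time, each multiplying Z by 1 + R. The machine
computes R by a depth-first evaluation of the truncated recursion in integer arithmetic with
denominator D; rounding errors only add up, as no level expands them (`RAM.callSpec`,
`RAM.abs_foldR_sub_ratio_le`). Below λ_c, depth logarithmic in n/ε brings the error per factor down
to order ε/n, and the (kd)^depth nodes give the stated power of n/ε. At λ_c each summand ln(1 + R)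
of ln Z is bounded below, so a relative error ε in every summand is enough, and a depth of order
ε^(-2) not depending on n achieves it. -/

/-- The potential in which the recursion for occupation ratios contracts. -/
noncomputable def potential (k : ℕ) (x : ℝ) : ℝ := arsinh (√(k * x))

/-- The ratio at a hyperedge computed from the ratios at its children. -/
noncomputable def branchRatio {ι κ : Type*} (lam : ℝ) (I : Finset ι) (J : ι → Finset κ)
    (R : ι → κ → ℝ) : ℝ := lam * ∏ i ∈ I, (1 + ∑ j ∈ J i, R i j)⁻¹

/-- With at most `m` branches of at most `k` children each, children at potential distance at most
`a` have parents at potential distance at most `b`. -/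
def Contracts (ι κ : Type*) (m k : ℕ) (lam a b : ℝ) : Prop :=
  ∀ (I : Finset ι) (J : ι → Finset κ) (R R' : ι → κ → ℝ), I.card ≤ m →
    (∀ i ∈ I, (J i).card ≤ k) →
    (∀ i ∈ I, ∀ j ∈ J i, 0 ≤ R i j ∧ 0 ≤ R' i j ∧
      |potential k (R i j) - potential k (R' i j)| ≤ a) →
    |potential k (branchRatio lam I J R) - potential k (branchRatio lam I J R')| ≤ b

/-- Equality holds for d = 1, and passing from d to d + 1 increases the right side by (d + 1) v^d (1
- v)². The square kept on the left is superfluous below λ_c, but it is the source of the polynomial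
decay at λ_c. -/
theorem one_sub_mul_pow_ge {d : ℕ} (hd : 1 ≤ d) {v : ℝ} (hv : 0 ≤ v) :
    (1 - v) ^ 2 ≤ 1 - (d + 1) * v ^ d + d * (v ^ d * v) := by
  induction d, hd using Nat.le_induction with
  | base => norm_num; nlinarith
  | succ d _ ih =>
    have : 0 ≤ (d + 1) * v ^ d * (1 - v) ^ 2 := by positivity
    push_cast
    rw [pow_succ v d] at *
    nlinarith

/-- Jensen for the concave function 1 - exp(-t), proved with the tangent at s. The constant term of
the tangent, 1 - exp(-s)(1 + s), is nonnegative, so `I.card` may be raised to `d`: missing branches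
behave as branches with t = 0. -/
theorem sum_one_sub_exp_neg_le {ι : Type*} (I : Finset ι) (t : ι → ℝ) {d : ℕ} (hd : 1 ≤ d)
    (hI : I.card ≤ d) :
    ∑ i ∈ I, (1 - exp (-t i)) ≤ d * (1 - exp (-((∑ i ∈ I, t i) / d))) := by
  set s := (∑ i ∈ I, t i) / d with hs
  have hd0 : (0 : ℝ) < d := by exact_mod_cast hd
  have hsum : ∑ i ∈ I, t i = d * s := by rw [hs]; field_simp
  have h1 : ∀ i ∈ I, 1 - exp (-t i) ≤ 1 - exp (-s) * (1 + s) + exp (-s) * t i := by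
    intro i _
    have : exp (-t i) = exp (-s) * exp (s - t i) := by rw [← exp_add]; ring_nf
    have h2 := add_one_le_exp (s - t i)
    have h3 := exp_pos (-s)
    rw [this]; nlinarith
  refine (Finset.sum_le_sum h1).trans ?_
  rw [Finset.sum_add_distrib, ← Finset.mul_sum, hsum, Finset.sum_const, nsmul_eq_mul]
  have h4 : exp (-s) * (1 + s) ≤ 1 := by
    have := add_one_le_exp s
    calc exp (-s) * (1 + s) ≤ exp (-s) * exp s := by gcongr; linarith
      _ = 1 := by rw [← exp_add]; simp
  have h5 : (I.card : ℝ) ≤ d := by exact_mod_cast hI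
  nlinarith

section Curve

variable {ι κ : Type*} (I : Finset ι) (J : ι → Finset κ) (θ : ι → κ → ℝ) (k : ℕ)

/-- The sum of the ratios in a branch, with all potentials shifted by `t`. -/
noncomputable def branchSum (i : ι) (t : ℝ) : ℝ := (∑ j ∈ J i, sinh (θ i j + t) ^ 2) / k

/-- The logarithm of the product over the branches. -/
noncomputable def branchLog (t : ℝ) : ℝ := ∑ i ∈ I, log (1 + branchSum J θ k i t)

theorem branchSum_nonneg (i : ι) (t : ℝ) : 0 ≤ branchSum J θ k i t := by
  unfold branchSum; positivity

theorem hasDerivAt_branchSum (i : ι) (t : ℝ) :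
    HasDerivAt (branchSum J θ k i)
      (2 * (∑ j ∈ J i, sinh (θ i j + t) * cosh (θ i j + t)) / k) t := by
  unfold branchSum
  have h : ∀ j ∈ J i, HasDerivAt (fun t => sinh (θ i j + t) ^ 2)
      (2 * (sinh (θ i j + t) * cosh (θ i j + t))) t := by
    intro j _
    have := ((hasDerivAt_id' t).const_add (θ i j)).sinh.fun_pow 2
    exact this.congr_deriv (by norm_num; ring)
  have := (HasDerivAt.fun_sum h).div_const (k : ℝ)
  rwa [← Finset.mul_sum] at this

/-- This is what the potential is chosen for. Cauchy-Schwarz bounds ∑ sinh·cosh by the roots of ∑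
sinh² = kS and of ∑ cosh², and cosh² = 1 + sinh² with at most k terms gives ∑ cosh² ≤ k(1 + S). The
number and the individual values of the children disappear. -/
theorem abs_deriv_branchSum_le (hk : 1 ≤ k) (i : ι) (hi : (J i).card ≤ k) (t : ℝ) :
    |2 * (∑ j ∈ J i, sinh (θ i j + t) * cosh (θ i j + t)) / k / (1 + branchSum J θ k i t)| ≤
      2 * √(branchSum J θ k i t / (1 + branchSum J θ k i t)) := by
  set S := branchSum J θ k i t with hS
  have hS0 : 0 ≤ S := branchSum_nonneg J θ k i t
  have hk0 : (0 : ℝ) < k := by exact_mod_cast hk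
  have hsum : ∑ j ∈ J i, sinh (θ i j + t) ^ 2 = k * S := by
    rw [hS, branchSum]; field_simp
  have hcs := Finset.sum_mul_sq_le_sq_mul_sq (J i) (fun j => sinh (θ i j + t))
    (fun j => cosh (θ i j + t))
  have hcosh : ∑ j ∈ J i, cosh (θ i j + t) ^ 2 ≤ k * (1 + S) := by
    simp only [cosh_sq, Finset.sum_add_distrib, hsum]
    have : ((J i).card : ℝ) ≤ k := by exact_mod_cast hi
    simp; linarith
  rw [hsum] at hcs
  set Q := ∑ j ∈ J i, sinh (θ i j + t) * cosh (θ i j + t)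
  have h1 : Q ^ 2 ≤ k ^ 2 * (S * (1 + S)) := by
    refine hcs.trans ?_
    calc k * S * _ ≤ k * S * (k * (1 + S)) := by gcongr
      _ = _ := by ring
  have h2 : 2 * Q / k / (1 + S) = 2 * (Q / (k * (1 + S))) := by field_simp
  rw [h2, abs_mul, abs_two]
  gcongr
  apply abs_le_sqrt
  rw [div_pow, div_le_div_iff₀ (by positivity) (by positivity)]
  calc Q ^ 2 * (1 + S) ≤ k ^ 2 * (S * (1 + S)) * (1 + S) := by gcongr
    _ = _ := by ring

theorem hasDerivAt_arsinh_sqrt_exp {μ : ℝ} (hμ : 0 < μ) (g : ℝ) :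
    HasDerivAt (fun g => arsinh (√(μ * exp (-g))))
      (-(1 / 2) * √(μ * exp (-g) / (1 + μ * exp (-g)))) g := by
  have hX : 0 < μ * exp (-g) := by positivity
  have h1 : HasDerivAt (fun g => μ * exp (-g)) (-(μ * exp (-g))) g := by
    have := ((hasDerivAt_id' g).fun_neg.exp).const_mul μ
    exact this.congr_deriv (by ring)
  have h2 := (h1.sqrt hX.ne').arsinh
  refine h2.congr_deriv ?_
  rw [sq_sqrt hX.le, sqrt_div hX.le]
  have h3 : √(μ * exp (-g)) * √(μ * exp (-g)) = μ * exp (-g) := mul_self_sqrt hX.le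
  have h4 : 0 < √(μ * exp (-g)) := sqrt_pos.2 hX
  have h5 : 0 < √(1 + μ * exp (-g)) := sqrt_pos.2 (by linarith)
  simp only [smul_eq_mul]
  field_simp
  linarith

/-- The potential of the parent, with all potentials of the children shifted by `t`. -/
noncomputable def branchPotential (μ t : ℝ) : ℝ :=
  arsinh (√(μ * exp (-branchLog I J θ k t)))

/-- Chain rule through the logarithm of the product. The factor 1/2 from the outer derivative
cancels the 2 from the branches. -/
theorem exists_hasDerivAt_branchPotential {μ : ℝ} (hμ : 0 < μ) (hk : 1 ≤ k)
    (hJ : ∀ i ∈ I, (J i).card ≤ k) (t : ℝ) :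
    ∃ y' : ℝ, HasDerivAt (branchPotential I J θ k μ) y' t ∧
      |y'| ≤ √(μ * exp (-branchLog I J θ k t) / (1 + μ * exp (-branchLog I J θ k t))) *
        ∑ i ∈ I, √(branchSum J θ k i t / (1 + branchSum J θ k i t)) := by
  have hG : HasDerivAt (branchLog I J θ k)
      (∑ i ∈ I, 2 * (∑ j ∈ J i, sinh (θ i j + t) * cosh (θ i j + t)) / k /
        (1 + branchSum J θ k i t)) t := by
    unfold branchLog
    apply HasDerivAt.fun_sum
    intro i _
    have h0 : 0 ≤ branchSum J θ k i t := branchSum_nonneg J θ k i t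
    exact ((hasDerivAt_branchSum J θ k i t).const_add 1).log (by linarith)
  refine ⟨_, HasDerivAt.comp (h₂ := fun g => arsinh (√(μ * exp (-g)))) t
    (hasDerivAt_arsinh_sqrt_exp hμ (branchLog I J θ k t)) hG, ?_⟩
  rw [abs_mul, abs_mul, abs_of_nonneg (sqrt_nonneg _)]
  have h1 : |∑ i ∈ I, 2 * (∑ j ∈ J i, sinh (θ i j + t) * cosh (θ i j + t)) / k /
        (1 + branchSum J θ k i t)| ≤
      2 * ∑ i ∈ I, √(branchSum J θ k i t / (1 + branchSum J θ k i t)) := by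
    rw [Finset.mul_sum]
    refine (Finset.abs_sum_le_sum_abs _ _).trans (Finset.sum_le_sum fun i hi => ?_)
    exact abs_deriv_branchSum_le J θ k hk i (hJ i hi) t
  have h2 : |(-(1 / 2) : ℝ)| = 1 / 2 := by norm_num [abs_of_pos]
  rw [h2]
  have h3 := sqrt_nonneg (μ * exp (-branchLog I J θ k t) / (1 + μ * exp (-branchLog I J θ k t)))
  nlinarith

/-- Since S/(1 + S) = 1 - exp(-log(1 + S)), Cauchy-Schwarz followed by Jensen bounds the sum by a
function of the total logarithm alone. -/
theorem sum_sqrt_sq_le {d : ℕ} (hd : 1 ≤ d) (hI : I.card ≤ d) (t : ℝ) :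
    (∑ i ∈ I, √(branchSum J θ k i t / (1 + branchSum J θ k i t))) ^ 2 ≤
      d ^ 2 * (1 - exp (-(branchLog I J θ k t / d))) := by
  have h1 := sq_sum_le_card_mul_sum_sq (s := I)
    (f := fun i => √(branchSum J θ k i t / (1 + branchSum J θ k i t)))
  have h2 : ∀ i ∈ I, √(branchSum J θ k i t / (1 + branchSum J θ k i t)) ^ 2 =
      1 - exp (-log (1 + branchSum J θ k i t)) := by
    intro i _
    have h0 : 0 ≤ branchSum J θ k i t := branchSum_nonneg J θ k i t
    rw [sq_sqrt (by positivity), exp_neg, exp_log (by linarith)]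
    field_simp
    ring
  rw [Finset.sum_congr rfl h2] at h1
  have h3 := sum_one_sub_exp_neg_le I (fun i => log (1 + branchSum J θ k i t)) hd hI
  have h4 : (I.card : ℝ) ≤ d := by exact_mod_cast hI
  have h5 : 0 ≤ ∑ i ∈ I, (1 - exp (-log (1 + branchSum J θ k i t))) := by
    rw [← Finset.sum_congr rfl h2]; positivity
  calc _ ≤ _ := h1
    _ ≤ (d : ℝ) * (d * (1 - exp (-(branchLog I J θ k t / d)))) := by
      unfold branchLog; gcongr
    _ = _ := by ring

/-- The substitution v = (1 + x) exp(-G/d) is normalized so that v = 1 when the parent sits at the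
fixed point. It turns the derivative bound into a polynomial inequality in one variable; v ≤ 1 + x
expresses G ≥ 0. -/
theorem deriv_sq_bound {d : ℕ} (hd : 1 ≤ d) (hI : I.card ≤ d) {μ x : ℝ} (hx : 0 < x)
    (hμ : μ = x * (1 + x) ^ d) (t : ℝ) {y' : ℝ}
    (hy : |y'| ≤ √(μ * exp (-branchLog I J θ k t) / (1 + μ * exp (-branchLog I J θ k t))) *
        ∑ i ∈ I, √(branchSum J θ k i t / (1 + branchSum J θ k i t))) :
    ∃ v : ℝ, 0 ≤ v ∧ v ≤ 1 + x ∧ μ * exp (-branchLog I J θ k t) = x * v ^ d ∧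
      y' ^ 2 * ((1 + x * v ^ d) * (1 + x)) ≤ d ^ 2 * (x * v ^ d) * (1 + x - v) := by
  have hd0 : (d : ℝ) ≠ 0 := by positivity
  have hG0 : 0 ≤ branchLog I J θ k t :=
    Finset.sum_nonneg fun i _ => log_nonneg (by linarith [branchSum_nonneg J θ k i t])
  set G := branchLog I J θ k t with hG
  have hX : μ * exp (-G) = x * ((1 + x) * exp (-(G / d))) ^ d := by
    rw [hμ, mul_pow, ← exp_nat_mul]
    have : (d : ℝ) * -(G / d) = -G := by field_simp
    rw [this]; ring
  refine ⟨(1 + x) * exp (-(G / d)), by positivity, ?_, hX, ?_⟩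
  · have : exp (-(G / d)) ≤ 1 := exp_le_one_iff.2 (by
      have : 0 ≤ G / d := by positivity
      linarith)
    nlinarith
  rw [← hX]
  set X := μ * exp (-G) with hXdef
  have hX0 : 0 < X := by rw [hX]; positivity
  have h1 : y' ^ 2 ≤ X / (1 + X) * (d ^ 2 * (1 - exp (-(G / d)))) := by
    rw [← sq_abs]
    calc |y'| ^ 2 ≤ _ := pow_le_pow_left₀ (abs_nonneg _) hy 2
      _ = X / (1 + X) * (∑ i ∈ I, √(branchSum J θ k i t / (1 + branchSum J θ k i t))) ^ 2 := by
        rw [mul_pow, sq_sqrt (by positivity)]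
      _ ≤ _ := by gcongr; exact sum_sqrt_sq_le I J θ k hd hI t
  calc y' ^ 2 * ((1 + X) * (1 + x)) ≤
      X / (1 + X) * (d ^ 2 * (1 - exp (-(G / d)))) * ((1 + X) * (1 + x)) := by gcongr
    _ = _ := by field_simp

theorem branchPotential_sub_le (hk : 1 ≤ k)
    (hJ : ∀ i ∈ I, (J i).card ≤ k) {μ q : ℝ} (hμ : 0 < μ)
    (hq : ∀ t y', |y'| ≤ √(μ * exp (-branchLog I J θ k t) / (1 + μ * exp (-branchLog I J θ k t))) *
        ∑ i ∈ I, √(branchSum J θ k i t / (1 + branchSum J θ k i t)) → |y'| ≤ q)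
    {a : ℝ} (ha : 0 ≤ a) :
    branchPotential I J θ k μ 0 - branchPotential I J θ k μ a ≤ q * a := by
  choose y' hy hb using fun t => exists_hasDerivAt_branchPotential I J θ k hμ hk hJ t
  have := Convex.norm_image_sub_le_of_norm_hasDerivWithin_le (f := branchPotential I J θ k μ)
    (f' := y') (C := q) (s := Set.univ) (x := a) (y := 0)
    (fun t _ => (hy t).hasDerivWithinAt) (fun t _ => hq t _ (hb t)) convex_univ trivial trivial
  rw [Real.norm_eq_abs, Real.norm_eq_abs, zero_sub, abs_neg, abs_of_nonneg ha] at this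
  exact (le_abs_self _).trans this

theorem sqrt_div_one_add_le_one {x : ℝ} (hx : 0 ≤ x) : √(x / (1 + x)) ≤ 1 := by
  rw [Real.sqrt_le_one, div_le_one (by linarith)]; linarith

/-- All the square roots are at most 1. This crude bound serves the root of the recursion, where d +
1 branches occur and the contraction estimate does not apply; it costs only a constant factor, once.
-/
theorem branchPotential_sub_le_mul {m : ℕ} (hk : 1 ≤ k) (hI : I.card ≤ m)
    (hJ : ∀ i ∈ I, (J i).card ≤ k) {μ : ℝ} (hμ : 0 < μ) {a : ℝ} (ha : 0 ≤ a) :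
    branchPotential I J θ k μ 0 - branchPotential I J θ k μ a ≤ m * a := by
  refine branchPotential_sub_le I J θ k hk hJ hμ (fun t y' h => h.trans ?_) ha
  have h1 : ∑ i ∈ I, √(branchSum J θ k i t / (1 + branchSum J θ k i t)) ≤ m := by
    refine (Finset.sum_le_card_nsmul I _ 1 fun i _ =>
      sqrt_div_one_add_le_one (branchSum_nonneg J θ k i t)).trans ?_
    simpa using hI
  have h2 := sqrt_div_one_add_le_one (x := μ * exp (-branchLog I J θ k t)) (by positivity)
  have h3 : (0:ℝ) ≤ ∑ i ∈ I, √(branchSum J θ k i t / (1 + branchSum J θ k i t)) := by positivity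
  calc _ ≤ 1 * (m : ℝ) := by gcongr
    _ = m := one_mul _

theorem branchPotential_sub_le_sqrt {d : ℕ} (hd : 1 ≤ d) (hk : 1 ≤ k) (hI : I.card ≤ d)
    (hJ : ∀ i ∈ I, (J i).card ≤ k) {μ x : ℝ} (hx : 0 < x) (hμ : μ = x * (1 + x) ^ d)
    (hdx : d * x ≤ 1 + x) {a : ℝ} (ha : 0 ≤ a) :
    branchPotential I J θ k μ 0 - branchPotential I J θ k μ a ≤ √(d * x / (1 + x)) * a := by
  have hμ0 : 0 < μ := by rw [hμ]; positivity
  refine branchPotential_sub_le I J θ k hk hJ hμ0 (fun t y' h => ?_) ha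
  obtain ⟨v, hv0, hv1, -, hv⟩ := deriv_sq_bound I J θ k hd hI hx hμ t h
  apply abs_le_sqrt
  have h1 := one_sub_mul_pow_ge hd hv0
  -- Replacing dx by 1 + x leaves exactly 1 + x v^d minus the right side of `one_sub_mul_pow_ge`.
  have h2 : (d : ℝ) * (v ^ d * (1 + x - v)) ≤ 1 + x * v ^ d := by
    have h3 : v ^ d * (d * x) ≤ v ^ d * (1 + x) := by gcongr
    nlinarith [sq_nonneg (1 - v)]
  have hp : 0 < 1 + x * v ^ d := by positivity
  have h3 : y' ^ 2 * (1 + x) * (1 + x * v ^ d) ≤ d * x * (1 + x * v ^ d) := by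
    calc y' ^ 2 * (1 + x) * (1 + x * v ^ d) ≤ d ^ 2 * (x * v ^ d) * (1 + x - v) := by linarith
      _ = d * x * (d * (v ^ d * (1 + x - v))) := by ring
      _ ≤ _ := by gcongr
  rw [le_div_iff₀ (by linarith)]
  exact le_of_mul_le_mul_right h3 hp

/-- Turns the gain (1 - v)² into a gain in terms of the distance from the fixed point in the
potential. The map is Lipschitz since `arsinh` is 1-Lipschitz, |√u - 1| ≤ |u - 1|, and powers are
Lipschitz on [0, 1 + x]. The summand 1 in the constant only ensures positivity. -/
theorem exists_abs_arsinh_sub_le {d : ℕ} {x : ℝ} (hx : 0 < x) :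
    ∃ C : ℝ, 0 < C ∧ ∀ v : ℝ, 0 ≤ v → v ≤ 1 + x →
      |arsinh (√(x * v ^ d)) - arsinh (√x)| ≤ C * |1 - v| := by
  refine ⟨√x * (d * (1 + x) ^ d) + 1, by positivity, fun v hv0 hv1 => ?_⟩
  have hpow : |v ^ d - 1| ≤ d * (1 + x) ^ d * |1 - v| := by
    have h := abs_pow_sub_pow_le v 1 d
    rw [one_pow] at h
    refine h.trans ?_
    have h2 : max |v| |(1 : ℝ)| ^ (d - 1) ≤ (1 + x) ^ d := by
      have h3 : max |v| |(1 : ℝ)| ≤ 1 + x := by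
        rw [abs_of_nonneg hv0, abs_one]; exact max_le hv1 (by linarith)
      calc _ ≤ (1 + x) ^ (d - 1) := pow_le_pow_left₀ (by positivity) h3 _
        _ ≤ (1 + x) ^ d := pow_le_pow_right₀ (by linarith) (Nat.sub_le _ _)
    rw [abs_sub_comm v 1]
    calc _ ≤ |1 - v| * d * (1 + x) ^ d := by gcongr
      _ = _ := by ring
  have hlip : |arsinh (√(x * v ^ d)) - arsinh (√x)| ≤ |√(x * v ^ d) - √x| := by
    have := Convex.norm_image_sub_le_of_norm_hasDerivWithin_le (f := arsinh)
      (f' := fun t => (√(1 + t ^ 2))⁻¹) (C := 1) (s := Set.univ) (x := √x) (y := √(x * v ^ d))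
      (fun t _ => (hasDerivAt_arsinh t).hasDerivWithinAt) (fun t _ => by
        rw [Real.norm_eq_abs, abs_of_nonneg (by positivity)]
        exact inv_le_one_of_one_le₀ (one_le_sqrt.2 (by nlinarith [sq_nonneg t]))) convex_univ
      trivial trivial
    simpa using this
  have hsq : |√(x * v ^ d) - √x| * √x ≤ √x * √x * |v ^ d - 1| := by
    rw [sqrt_mul hx.le]
    have h1 : √x * √(v ^ d) - √x = √x * (√(v ^ d) - 1) := by ring
    rw [h1, abs_mul, abs_of_nonneg (sqrt_nonneg x)]
    have h2 : |√(v ^ d) - 1| ≤ |v ^ d - 1| := by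
      have h3 : v ^ d - 1 = (√(v ^ d) - 1) * (√(v ^ d) + 1) := by
        have := mul_self_sqrt (pow_nonneg hv0 d); linarith
      rw [h3, abs_mul, abs_of_nonneg (by positivity : 0 ≤ √(v ^ d) + 1)]
      nlinarith [sqrt_nonneg (v ^ d), abs_nonneg (√(v ^ d) - 1)]
    nlinarith [mul_self_sqrt hx.le]
  have hsx : 0 < √x := sqrt_pos.2 hx
  have h4 : |√(x * v ^ d) - √x| ≤ √x * |v ^ d - 1| := by
    refine le_of_mul_le_mul_right ?_ hsx
    linarith
  calc _ ≤ √x * |v ^ d - 1| := hlip.trans h4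
    _ ≤ √x * (d * (1 + x) ^ d * |1 - v|) := by gcongr
    _ ≤ _ := by nlinarith [abs_nonneg (1 - v)]

end Curve

/-- At criticality the derivative satisfies |y'| (1 + b (y - z)²) ≤ 1, with z the potential of the
fixed point. Integrating this differential inequality produces a cubic term, and the worst position
of an interval of length D, centred at z, still leaves a multiple of D³. -/
theorem branchPotential_sub_cube_le {d k : ℕ} (hd : 1 ≤ d) (hk : 1 ≤ k) {μ x : ℝ} (hx : 0 < x)
    (hμ : μ = x * (1 + x) ^ d) (hdx : d * x = 1 + x) :
    ∃ c : ℝ, 0 < c ∧ ∀ (ι κ : Type*) (I : Finset ι) (J : ι → Finset κ)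
        (θ : ι → κ → ℝ), I.card ≤ d →
      (∀ i ∈ I, (J i).card ≤ k) → ∀ a, 0 ≤ a →
      0 ≤ branchPotential I J θ k μ 0 - branchPotential I J θ k μ a →
      (branchPotential I J θ k μ 0 - branchPotential I J θ k μ a) +
        c * (branchPotential I J θ k μ 0 - branchPotential I J θ k μ a) ^ 3 ≤ a := by
  have hμ0 : 0 < μ := by rw [hμ]; positivity
  obtain ⟨C, hC, hlip⟩ := exists_abs_arsinh_sub_le (d := d) hx
  set b : ℝ := 1 / (2 * C ^ 2 * (1 + μ)) with hb
  have hb0 : 0 < b := by positivity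
  refine ⟨b / 12, by positivity, fun ι κ I J θ hI hJ a ha hD => ?_⟩
  choose y' hy hbd using fun t => exists_hasDerivAt_branchPotential I J θ k hμ0 hk hJ t
  set y := branchPotential I J θ k μ with hydef
  set z := arsinh (√x)
  have hkey : ∀ t, |y' t| * (1 + b * (y t - z) ^ 2) ≤ 1 := by
    intro t
    obtain ⟨v, hv0, hv1, hXv, hv⟩ := deriv_sq_bound I J θ k hd hI hx hμ t (hbd t)
    have hXμ : x * v ^ d ≤ μ := by rw [hμ]; gcongr
    have h1 := one_sub_mul_pow_ge hd hv0
    have h2 : y' t ^ 2 * (1 + x * v ^ d) ≤ d * (v ^ d * (1 + x - v)) := by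
      have : y' t ^ 2 * (1 + x * v ^ d) * (1 + x) ≤ d * (v ^ d * (1 + x - v)) * (1 + x) := by
        rw [← hdx] at hv ⊢
        calc _ ≤ (d : ℝ) ^ 2 * (x * v ^ d) * (d * x - v) := by linarith
          _ = _ := by ring
      exact le_of_mul_le_mul_right this (by linarith)
    have h3 : (d : ℝ) * (v ^ d * (1 + x - v)) ≤ 1 + x * v ^ d - (1 - v) ^ 2 := by
      have h4 : (d : ℝ) * (v ^ d * (1 + x - v)) = v ^ d * (d + d * x - d * v) := by ring
      rw [h4, hdx]; linarith
    have h5 : (y t - z) ^ 2 ≤ C ^ 2 * (1 - v) ^ 2 := by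
      have := hlip v hv0 hv1
      rw [← hXv] at this
      calc (y t - z) ^ 2 = |y t - z| ^ 2 := (sq_abs _).symm
        _ ≤ (C * |1 - v|) ^ 2 := pow_le_pow_left₀ (abs_nonneg _) this 2
        _ = _ := by rw [mul_pow, sq_abs]
    have hX0 : 0 ≤ x * v ^ d := by positivity
    have h6 : y' t ^ 2 ≤ 1 - 2 * (b * (y t - z) ^ 2) := by
      have h7 : 2 * (b * (y t - z) ^ 2) * (1 + x * v ^ d) ≤ (1 - v) ^ 2 := by
        calc 2 * (b * (y t - z) ^ 2) * (1 + x * v ^ d)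
            ≤ 2 * (b * (C ^ 2 * (1 - v) ^ 2)) * (1 + μ) := by gcongr
          _ = _ := by rw [hb]; field_simp
      have : y' t ^ 2 * (1 + x * v ^ d) ≤ (1 - 2 * (b * (y t - z) ^ 2)) * (1 + x * v ^ d) := by
        linarith
      exact le_of_mul_le_mul_right this (by linarith)
    have h8 : 0 ≤ b * (y t - z) ^ 2 := by positivity
    set w := b * (y t - z) ^ 2
    have h9 : |y' t| ≤ 1 - w := by
      rw [← sq_abs] at h6
      nlinarith [abs_nonneg (y' t), sq_nonneg (|y' t| - 1)]
    nlinarith [abs_nonneg (y' t)]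
  -- The function y + (b/3)(y - z)³ is an antiderivative of y'(1 + b(y - z)²), which is at least -1.
  have hmono : Monotone fun t => t + y t + b / 3 * (y t - z) ^ 3 := by
    have hder : ∀ t, HasDerivAt (fun t => t + y t + b / 3 * (y t - z) ^ 3)
        (1 + y' t * (1 + b * (y t - z) ^ 2)) t := by
      intro t
      have := ((hasDerivAt_id' t).fun_add (hy t)).fun_add
        ((((hy t).sub_const z).fun_pow 3).const_mul (b / 3))
      exact this.congr_deriv (by norm_num; ring)
    refine monotone_of_deriv_nonneg (fun t => (hder t).differentiableAt) fun t => ?_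
    rw [(hder t).deriv]
    have h1 := hkey t
    have h2 := neg_abs_le (y' t)
    have h3 : 0 ≤ b * (y t - z) ^ 2 := by positivity
    nlinarith
  have hm := hmono ha
  simp only at hm
  -- For p ≥ r one has p³ - r³ ≥ (p - r)³/4, with equality when r = -p; the deficit is a multiple of
  -- (p - r)(p + r)².
  have hcube : (y 0 - y a) ^ 3 / 4 ≤ (y 0 - z) ^ 3 - (y a - z) ^ 3 := by
    have e1 : y 0 - y a = (y 0 - z) - (y a - z) := by ring
    rw [e1] at hD ⊢
    generalize y 0 - z = p at *
    generalize y a - z = r at *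
    nlinarith [mul_nonneg hD (sq_nonneg (p + r))]
  have : b / 12 * (y 0 - y a) ^ 3 ≤ b / 3 * ((y 0 - z) ^ 3 - (y a - z) ^ 3) := by nlinarith
  linarith

theorem potential_nonneg (k : ℕ) (x : ℝ) : 0 ≤ potential k x :=
  arsinh_nonneg_iff.2 (sqrt_nonneg _)

theorem sinh_potential_sq (k : ℕ) {x : ℝ} (hx : 0 ≤ x) : sinh (potential k x) ^ 2 = k * x := by
  rw [potential, sinh_arsinh, sq_sqrt (by positivity)]

theorem potential_branchRatio {ι κ : Type*} {k : ℕ} (hk : 1 ≤ k) (lam : ℝ) (I : Finset ι)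
    (J : ι → Finset κ) (R : ι → κ → ℝ) (hR : ∀ i ∈ I, ∀ j ∈ J i, 0 ≤ R i j) :
    potential k (branchRatio lam I J R) =
      branchPotential I J (fun i j => potential k (R i j)) k (k * lam) 0 := by
  have hk0 : (0 : ℝ) < k := by exact_mod_cast hk
  have h1 : ∀ i ∈ I, branchSum J (fun i j => potential k (R i j)) k i 0 = ∑ j ∈ J i, R i j := by
    intro i hi
    rw [branchSum, Finset.sum_congr rfl fun j hj => by
      rw [add_zero, sinh_potential_sq k (hR i hi j hj)], ← Finset.mul_sum]
    field_simp
  rw [potential, branchPotential, branchRatio, branchLog, ← Finset.sum_neg_distrib, exp_sum]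
  congr 2
  rw [mul_assoc]
  congr 2
  refine Finset.prod_congr rfl fun i hi => ?_
  have : 0 ≤ ∑ j ∈ J i, R i j := Finset.sum_nonneg (hR i hi)
  rw [h1 i hi, exp_neg, exp_log (by linarith)]

/-- Larger children give a smaller parent. The shifted potentials must be nonnegative because sinh²
increases only there. -/
theorem branchPotential_antitone {ι κ : Type*} (I : Finset ι) (J : ι → Finset κ)
    (θ θ' : ι → κ → ℝ) (k : ℕ) {μ s t : ℝ} (hμ : 0 < μ)
    (h : ∀ i ∈ I, ∀ j ∈ J i, 0 ≤ θ i j + s ∧ θ i j + s ≤ θ' i j + t) :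
    branchPotential I J θ' k μ t ≤ branchPotential I J θ k μ s := by
  unfold branchPotential branchLog
  have h0 := branchSum_nonneg J θ k
  gcongr with i hi
  · linarith [h0 i s]
  unfold branchSum
  gcongr with j hj
  · exact sinh_nonneg_iff.2 (h i hi j hj).1
  · exact sinh_le_sinh.2 (h i hi j hj).2

/-- By monotonicity, children within distance a of the given ones are dominated by the given ones
all shifted up by a. Hence a uniform shift bounds both signs of the difference, after exchanging the
two families. -/
theorem contracts_of_branchPotential {ι κ : Type*} {m k : ℕ} (hk : 1 ≤ k) {lam a b : ℝ}
    (hlam : 0 < lam)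
    (h : ∀ (I : Finset ι) (J : ι → Finset κ) (θ : ι → κ → ℝ), I.card ≤ m →
      (∀ i ∈ I, (J i).card ≤ k) →
      branchPotential I J θ k (k * lam) 0 - branchPotential I J θ k (k * lam) a ≤ b) :
    Contracts ι κ m k lam a b := by
  intro I J R R' hI hJ hR
  have hμ : 0 < k * lam := by positivity
  rw [potential_branchRatio hk lam I J R fun i hi j hj => (hR i hi j hj).1,
    potential_branchRatio hk lam I J R' fun i hi j hj => (hR i hi j hj).2.1, abs_sub_le_iff]
  constructor
  · have h1 := h I J (fun i j => potential k (R i j)) hI hJ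
    have h2 := branchPotential_antitone I J (fun i j => potential k (R' i j))
      (fun i j => potential k (R i j)) k (s := 0) (t := a) hμ fun i hi j hj => by
        have := (abs_le.1 (hR i hi j hj).2.2).1
        exact ⟨by linarith [potential_nonneg k (R' i j)], by linarith⟩
    linarith
  · have h1 := h I J (fun i j => potential k (R' i j)) hI hJ
    have h2 := branchPotential_antitone I J (fun i j => potential k (R i j))
      (fun i j => potential k (R' i j)) k (s := 0) (t := a) hμ fun i hi j hj => by
        have := (abs_le.1 (hR i hi j hj).2.2).2
        exact ⟨by linarith [potential_nonneg k (R i j)], by linarith⟩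
    linarith

theorem contracts_mul (ι κ : Type*) (m : ℕ) {k : ℕ} (hk : 1 ≤ k) {lam a : ℝ} (hlam : 0 < lam)
    (ha : 0 ≤ a) : Contracts ι κ m k lam a (m * a) :=
  contracts_of_branchPotential hk hlam fun I J θ hI hJ =>
    branchPotential_sub_le_mul I J θ k hk hI hJ (by positivity) ha

theorem contracts_sqrt_mul (ι κ : Type*) {d k : ℕ} (hd : 1 ≤ d) (hk : 1 ≤ k) {lam a x : ℝ}
    (hlam : 0 < lam) (hx : 0 < x) (hμ : k * lam = x * (1 + x) ^ d) (hdx : d * x ≤ 1 + x)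
    (ha : 0 ≤ a) : Contracts ι κ d k lam a (√(d * x / (1 + x)) * a) :=
  contracts_of_branchPotential hk hlam fun I J θ hI hJ =>
    branchPotential_sub_le_sqrt I J θ k hd hk hI hJ hx hμ hdx ha

/-- The implication in D replaces an explicit inverse of D + cD³. It serves both the decay estimate
and, with b = a, plain nonexpansiveness. -/
theorem exists_contracts_cube {d k : ℕ} (hd : 1 ≤ d) (hk : 1 ≤ k) {lam x : ℝ}
    (hlam : 0 < lam) (hx : 0 < x) (hμ : k * lam = x * (1 + x) ^ d) (hdx : d * x = 1 + x) :
    ∃ c : ℝ, 0 < c ∧ ∀ (ι κ : Type*) (a b : ℝ), 0 ≤ a → 0 ≤ b →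
      (∀ D, 0 ≤ D → D + c * D ^ 3 ≤ a → D ≤ b) →
      Contracts ι κ d k lam a b := by
  obtain ⟨c, hc, h⟩ := branchPotential_sub_cube_le hd hk hx hμ hdx
  refine ⟨c, hc, fun ι κ a b ha hb hab =>
    contracts_of_branchPotential hk hlam fun I J θ hI hJ => ?_⟩
  by_cases hD : 0 ≤ branchPotential I J θ k (k * lam) 0 - branchPotential I J θ k (k * lam) a
  · exact hab _ hD (h ι κ I J θ hI hJ a ha hD)
  · linarith

end

/-! ### Ratios and their tree recursion -/

section

open Real Finset

set_option linter.unusedSectionVars false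

namespace HGraph

section Weight

variable {V E : Type*} [DecidableEq V] [DecidableEq E] (H : HGraph V E) (lam : ℝ)

theorem mem_matchings {A M : Finset E} : M ∈ H.matchings A ↔ M ⊆ A ∧ H.IsMatching M := by
  simp [matchings]

/-- The partition function of the hypergraph with the hyperedges `A`. -/
noncomputable def weight (A : Finset E) : ℝ := ∑ M ∈ H.matchings A, lam ^ M.card

/-- The hyperedges of `A` that avoid the vertices in `K`. -/
def away (A : Finset E) (K : Finset V) : Finset E := A.filter fun f => Disjoint (H.edge f) K

theorem mem_away {A : Finset E} {K : Finset V} {f : E} :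
    f ∈ H.away A K ↔ f ∈ A ∧ Disjoint (H.edge f) K := by simp [away]

theorem away_empty (A : Finset E) : H.away A ∅ = A := by simp [away]

theorem away_away (A : Finset E) (K L : Finset V) :
    H.away (H.away A K) L = H.away A (K ∪ L) := by
  ext f; simp [mem_away, Finset.disjoint_union_right, and_assoc]

variable {lam} in
theorem weight_pos (hlam : 0 < lam) (A : Finset E) : 0 < H.weight lam A := by
  refine Finset.sum_pos (fun M _ => by positivity) ⟨∅, ?_⟩
  simp [mem_matchings, IsMatching]

theorem isMatching_insert {M : Finset E} {f : E} (hf : f ∉ M) :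
    H.IsMatching (insert f M) ↔ H.IsMatching M ∧ ∀ g ∈ M, Disjoint (H.edge g) (H.edge f) := by
  unfold IsMatching
  rw [Finset.coe_insert, Set.pairwiseDisjoint_insert]
  refine and_congr_right fun _ => ?_
  simp only [Finset.mem_coe]
  refine forall₂_congr fun g hg => ?_
  have : f ≠ g := fun h => hf (h ▸ hg)
  simp [this, disjoint_comm]

theorem weight_insert {A : Finset E} {f : E} (hf : f ∉ A) :
    H.weight lam (insert f A) = H.weight lam A + lam * H.weight lam (H.away A (H.edge f)) := by
  have hdec : H.matchings (insert f A) =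
      H.matchings A ∪ (H.matchings (H.away A (H.edge f))).image (insert f) := by
    ext M
    simp only [Finset.mem_union, Finset.mem_image, mem_matchings]
    constructor
    · rintro ⟨hM, hm⟩
      by_cases hfM : f ∈ M
      · right
        refine ⟨M.erase f, ⟨?_, ?_⟩, Finset.insert_erase hfM⟩
        · intro g hg
          rw [← Finset.insert_erase hfM, H.isMatching_insert (by simp)] at hm
          have hg' := Finset.mem_erase.1 hg
          exact H.mem_away.2 ⟨(Finset.mem_insert.1 (hM hg'.2)).resolve_left hg'.1, hm.2 g hg⟩
        · exact hm.subset (by simp)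
      · left
        exact ⟨(Finset.subset_insert_iff_of_notMem hfM).1 hM, hm⟩
    · rintro (⟨hM, hm⟩ | ⟨M', ⟨hM, hm⟩, rfl⟩)
      · exact ⟨hM.trans (Finset.subset_insert _ _), hm⟩
      · have hfM : f ∉ M' := fun h => hf (H.mem_away.1 (hM h)).1
        refine ⟨Finset.insert_subset_insert _ fun g hg => (H.mem_away.1 (hM hg)).1, ?_⟩
        exact (H.isMatching_insert hfM).2 ⟨hm, fun g hg => (H.mem_away.1 (hM hg)).2⟩
  have hnot : ∀ M ∈ H.matchings (H.away A (H.edge f)), f ∉ M := fun M hM h =>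
    hf (H.mem_away.1 ((H.mem_matchings.1 hM).1 h)).1
  rw [weight, hdec, Finset.sum_union, Finset.sum_image]
  · rw [weight, weight, Finset.mul_sum]
    congr 1
    refine Finset.sum_congr rfl fun M hM => ?_
    rw [Finset.card_insert_of_notMem (hnot M hM), pow_succ, mul_comm]
  · intro M hM M' hM' h
    rw [← Finset.erase_insert (hnot M hM), ← Finset.erase_insert (hnot M' hM')]
    exact congrArg (fun s => s.erase f) h
  · rw [Finset.disjoint_left]
    intro M hM hM'
    obtain ⟨M', _, rfl⟩ := Finset.mem_image.1 hM'
    exact hf ((H.mem_matchings.1 hM).1 (Finset.mem_insert_self _ _))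

/-- A matching contains at most one hyperedge at u. The hyperedges at u are inserted one after the
other into those avoiding u. -/
theorem weight_eq_add_sum (A : Finset E) (u : V) :
    H.weight lam A = H.weight lam (H.away A {u}) +
      ∑ g ∈ A.filter (fun g => u ∈ H.edge g), lam * H.weight lam (H.away A (H.edge g)) := by
  have key : ∀ B : Finset E, B ⊆ A.filter (fun g => u ∈ H.edge g) →
      H.weight lam (H.away A {u} ∪ B) = H.weight lam (H.away A {u}) +
        ∑ g ∈ B, lam * H.weight lam (H.away A (H.edge g)) := by
    intro B
    induction B using Finset.induction_on with
    | empty => simp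
    | insert g B hg ih =>
      intro hB
      have hgu := Finset.mem_filter.1 (hB (Finset.mem_insert_self g B))
      have hB' := (Finset.subset_insert g B).trans hB
      have hgn : g ∉ H.away A {u} ∪ B := by
        simp [mem_away, hg, hgu.2]
      rw [Finset.union_insert, weight_insert H lam hgn, ih hB', Finset.sum_insert hg]
      -- All hyperedges at u meet g, so it does not matter which of them have been inserted already.
      have : H.away (H.away A {u} ∪ B) (H.edge g) = H.away A (H.edge g) := by
        ext h
        simp only [mem_away, Finset.mem_union]
        constructor
        · rintro ⟨h1 | h1, h2⟩
          · exact ⟨h1.1, h2⟩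
          · exact ⟨(Finset.mem_filter.1 (hB' h1)).1, h2⟩
        · rintro ⟨h1, h2⟩
          refine ⟨Or.inl ⟨h1, ?_⟩, h2⟩
          rw [Finset.disjoint_singleton_right]
          exact fun h3 => Finset.disjoint_left.1 h2 h3 hgu.2
      rw [this]; ring
  rw [← key _ subset_rfl]
  congr 1
  ext g
  simp only [Finset.mem_union, mem_away, Finset.mem_filter, Finset.disjoint_singleton_right]
  tauto

/-- The ratio `p / (1 - p)` for the occupation probability `p` of a hyperedge `f` added to `A`. -/
noncomputable def ratio (A : Finset E) (f : E) : ℝ :=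
  lam * H.weight lam (H.away A (H.edge f)) / H.weight lam A

variable {lam} in
theorem weight_insert_eq_mul (hlam : 0 < lam) {A : Finset E} {f : E} (hf : f ∉ A) :
    H.weight lam (insert f A) = H.weight lam A * (1 + H.ratio lam A f) := by
  have := H.weight_pos hlam A
  rw [weight_insert H lam hf, ratio]; field_simp

variable {lam} in
theorem ratio_pos (hlam : 0 < lam) (A : Finset E) (f : E) : 0 < H.ratio lam A f :=
  div_pos (mul_pos hlam (H.weight_pos hlam _)) (H.weight_pos hlam _)

variable {lam} in
theorem weight_away_div (hlam : 0 < lam) (A : Finset E) (u : V) :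
    H.weight lam (H.away A {u}) / H.weight lam A =
      (1 + ∑ g ∈ A.filter (fun g => u ∈ H.edge g), H.ratio lam (H.away A {u}) g)⁻¹ := by
  have h0 := H.weight_pos hlam (H.away A {u})
  have h1 : H.weight lam A = H.weight lam (H.away A {u}) *
      (1 + ∑ g ∈ A.filter (fun g => u ∈ H.edge g), H.ratio lam (H.away A {u}) g) := by
    rw [H.weight_eq_add_sum lam A u, mul_add, mul_one, Finset.mul_sum]
    congr 1
    refine Finset.sum_congr rfl fun g hg => ?_
    rw [ratio, away_away]
    have : ({u} : Finset V) ∪ H.edge g = H.edge g := by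
      simpa using (Finset.mem_filter.1 hg).2
    rw [this]; field_simp
  rw [h1, div_mul_eq_div_div, div_self h0.ne', one_div]

end Weight

section Tree

variable {V E : Type*} [DecidableEq V] [DecidableEq E] (H : HGraph V E) {d : ℕ}
  (vert : E → Fin (d + 1) → V) (lam : ℝ) (A : Finset E)

/-- The vertices in `K` and the first `j` vertices of `f`. -/
def visited (K : Finset V) (f : E) (j : ℕ) : Finset V :=
  K ∪ (univ.filter fun i : Fin (d + 1) => i.val < j).image (vert f)

/-- The available hyperedges at the vertex `j` of `f`, when those in `K` are deleted. -/
def children (K : Finset V) (f : E) (j : Fin (d + 1)) : Finset E :=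
  A.filter fun g => vert f j ∈ H.edge g ∧ Disjoint (H.edge g) (visited vert K f j)

/-- One level of the recursion for ratios. -/
noncomputable def treeStep (F : Finset V → E → ℝ) (K : Finset V) (f : E) : ℝ :=
  branchRatio lam univ (H.children vert A K f) fun j g => F (visited vert K f (j + 1)) g

/-- The recursion for ratios, truncated at depth `ℓ`. -/
noncomputable def treeRatio : ℕ → Finset V → E → ℝ
  | 0 => fun _ _ => lam
  | ℓ + 1 => H.treeStep vert lam A (treeRatio ℓ)

theorem visited_succ (K : Finset V) (f : E) (j : Fin (d + 1)) :
    visited vert K f (j + 1) = visited vert K f j ∪ {vert f j} := by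
  ext v
  simp only [visited, Finset.mem_union, Finset.mem_image, Finset.mem_filter, Finset.mem_univ,
    true_and, Finset.mem_singleton, Order.lt_add_one_iff]
  constructor
  · rintro (h | ⟨i, hi, rfl⟩)
    · exact Or.inl (Or.inl h)
    · rcases hi.lt_or_eq with h | h
      · exact Or.inl (Or.inr ⟨i, h, rfl⟩)
      · exact Or.inr (by rw [Fin.ext h])
  · rintro ((h | ⟨i, hi, rfl⟩) | rfl)
    · exact Or.inl h
    · exact Or.inr ⟨i, hi.le, rfl⟩
    · exact Or.inr ⟨j, le_rfl, rfl⟩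

theorem subset_visited (K : Finset V) (f : E) (j : ℕ) : K ⊆ visited vert K f j :=
  Finset.subset_union_left

theorem visited_last (hvert : ∀ f, H.edge f = univ.image (vert f)) (K : Finset V) (f : E) :
    visited vert K f (d + 1) = K ∪ H.edge f := by
  rw [visited, hvert]; simp [Fin.is_le]

theorem prod_div_eq {f : ℕ → ℝ} (hf : ∀ i, f i ≠ 0) (n : ℕ) :
    ∏ i ∈ range n, f (i + 1) / f i = f n / f 0 := by
  induction n with
  | zero => simp [hf 0]
  | succ n ih => rw [Finset.prod_range_succ, ih]; have := hf n; have := hf 0; field_simp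

variable {lam}

/-- The product telescopes over the vertices of f: `visited` grows by one vertex per factor, from K
to K together with all of f. The recursion needs no conditioning on hyperedges, only the growing set
of deleted vertices. -/
theorem ratio_eq_treeStep (hlam : 0 < lam) (hvert : ∀ f, H.edge f = univ.image (vert f)) :
    (fun K f => H.ratio lam (H.away A K) f) =
      H.treeStep vert lam A (fun K f => H.ratio lam (H.away A K) f) := by
  funext K f
  have h1 : ∀ j : Fin (d + 1), (1 + ∑ g ∈ H.children vert A K f j,
      H.ratio lam (H.away A (visited vert K f (j + 1))) g)⁻¹ =
      H.weight lam (H.away A (visited vert K f (j + 1))) /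
        H.weight lam (H.away A (visited vert K f j)) := by
    intro j
    rw [visited_succ, ← away_away, weight_away_div H hlam]
    congr 3
    ext g
    simp only [children, mem_away, Finset.mem_filter]
    tauto
  rw [treeStep, branchRatio, Finset.prod_congr rfl fun j _ => h1 j,
    Fin.prod_univ_eq_prod_range (fun j => H.weight lam (H.away A (visited vert K f (j + 1))) /
      H.weight lam (H.away A (visited vert K f j))),
    prod_div_eq (f := fun j => H.weight lam (H.away A (visited vert K f j)))
      fun i => (H.weight_pos hlam _).ne', visited_last H vert hvert, ratio, away_away]
  simp [visited, mul_div_assoc]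

variable {H vert A}

theorem branchRatio_pos {ι κ : Type*} (hlam : 0 < lam) (I : Finset ι) (J : ι → Finset κ)
    (R : ι → κ → ℝ) (hR : ∀ i ∈ I, ∀ j ∈ J i, 0 ≤ R i j) : 0 < branchRatio lam I J R := by
  refine mul_pos hlam (Finset.prod_pos fun i hi => inv_pos.2 ?_)
  linarith [Finset.sum_nonneg (hR i hi)]

theorem branchRatio_le {ι κ : Type*} (hlam : 0 < lam) (I : Finset ι) (J : ι → Finset κ)
    (R : ι → κ → ℝ) (hR : ∀ i ∈ I, ∀ j ∈ J i, 0 ≤ R i j) : branchRatio lam I J R ≤ lam := by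
  refine mul_le_of_le_one_right hlam.le (Finset.prod_le_one (fun i hi => inv_nonneg.2 ?_)
    fun i hi => inv_le_one_of_one_le₀ ?_)
  all_goals linarith [Finset.sum_nonneg (hR i hi)]

theorem treeStep_pos (hlam : 0 < lam) {F : Finset V → E → ℝ} (hF : ∀ K f, 0 ≤ F K f)
    (K : Finset V) (f : E) : 0 < H.treeStep vert lam A F K f :=
  branchRatio_pos hlam _ _ _ fun _ _ _ _ => hF _ _

theorem treeStep_le (hlam : 0 < lam) {F : Finset V → E → ℝ} (hF : ∀ K f, 0 ≤ F K f)
    (K : Finset V) (f : E) : H.treeStep vert lam A F K f ≤ lam :=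
  branchRatio_le hlam _ _ _ fun _ _ _ _ => hF _ _

theorem treeRatio_nonneg (hlam : 0 < lam) (ℓ : ℕ) (K : Finset V) (f : E) :
    0 ≤ H.treeRatio vert lam A ℓ K f := by
  induction ℓ generalizing K f with
  | zero => exact hlam.le
  | succ ℓ ih => exact (treeStep_pos hlam ih K f).le

theorem ratio_away_le (hlam : 0 < lam) (hvert : ∀ f, H.edge f = univ.image (vert f))
    (K : Finset V) (f : E) : H.ratio lam (H.away A K) f ≤ lam := by
  have := congrFun (congrFun (H.ratio_eq_treeStep vert A hlam hvert) K) f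
  rw [this]
  exact treeStep_le hlam (fun K f => (H.ratio_pos hlam _ _).le) K f

/-- The hyperedge f passes through each of its vertices but is not its own child: at the root
because it lies outside A, below the root because it meets a deleted vertex. This improves k + 1 to
k. -/
theorem card_children_le {k : ℕ} (hdeg : H.DegreeLE (k + 1)) {K : Finset V} {f : E}
    (hvert : ∀ f, H.edge f = univ.image (vert f))
    (hf : f ∉ A ∨ ¬ Disjoint (H.edge f) K) (j : Fin (d + 1)) :
    (H.children vert A K f j).card ≤ k := by
  have hnot : f ∉ H.children vert A K f j := by
    intro h
    obtain ⟨h1, -, h3⟩ := Finset.mem_filter.1 h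
    rcases hf with h4 | h4
    · exact h4 h1
    · exact h4 (h3.mono_right (subset_visited vert K f j))
  have hsub : ((insert f (H.children vert A K f j) : Finset E) : Set E) ⊆
      {e | vert f j ∈ H.edge e} := by
    intro g hg
    rcases Finset.mem_insert.1 (Finset.mem_coe.1 hg) with rfl | h
    · simp [hvert]
    · exact (Finset.mem_filter.1 h).2.1
  have := (Set.encard_le_encard hsub).trans (hdeg (vert f j))
  rw [Set.encard_coe_eq_coe_finsetCard, Finset.card_insert_of_notMem hnot] at this
  have : (H.children vert A K f j).card + 1 ≤ k + 1 := by exact_mod_cast this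
  omega

theorem not_disjoint_visited {K : Finset V} {f g : E} {j : Fin (d + 1)}
    (hg : g ∈ H.children vert A K f j) :
    ¬ Disjoint (H.edge g) (visited vert K f (j + 1)) := by
  rw [visited_succ, Finset.not_disjoint_iff]
  exact ⟨vert f j, (Finset.mem_filter.1 hg).2.1, by simp⟩

theorem abs_potential_treeStep_sub_le_root {k : ℕ} (hdeg : H.DegreeLE (k + 1))
    (hvert : ∀ f, H.edge f = univ.image (vert f)) {a b : ℝ}
    (hc : Contracts (Fin (d + 1)) E (d + 1) k lam a b) {F F' : Finset V → E → ℝ}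
    (hF : ∀ K f, 0 ≤ F K f) (hF' : ∀ K f, 0 ≤ F' K f)
    (h : ∀ K f, ¬ Disjoint (H.edge f) K → |potential k (F K f) - potential k (F' K f)| ≤ a)
    {K : Finset V} {f : E} (hf : f ∉ A) :
    |potential k (H.treeStep vert lam A F K f) - potential k (H.treeStep vert lam A F' K f)|
      ≤ b := by
  refine hc _ _ _ _ (by simp) (fun j _ => card_children_le hdeg hvert (Or.inl hf) j) ?_
  exact fun j _ g hg => ⟨hF _ _, hF' _ _, h _ _ (not_disjoint_visited hg)⟩

theorem abs_potential_treeStep_sub_le {k : ℕ} (hdeg : H.DegreeLE (k + 1))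
    (hvert : ∀ f, H.edge f = univ.image (vert f)) {a b : ℝ}
    (hc : Contracts (Fin (d + 1)) E d k lam a b) {F F' : Finset V → E → ℝ}
    (hF : ∀ K f, 0 ≤ F K f) (hF' : ∀ K f, 0 ≤ F' K f)
    (h : ∀ K f, ¬ Disjoint (H.edge f) K → |potential k (F K f) - potential k (F' K f)| ≤ a)
    {K : Finset V} {f : E} (hf : ¬ Disjoint (H.edge f) K) :
    |potential k (H.treeStep vert lam A F K f) - potential k (H.treeStep vert lam A F' K f)|
      ≤ b := by
  obtain ⟨u, hu, huK⟩ := Finset.not_disjoint_iff.1 hf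
  rw [hvert] at hu
  obtain ⟨i, -, rfl⟩ := Finset.mem_image.1 hu
  -- The vertex shared with the deleted set carries no children, so its factor is 1 and only d
  -- branches remain.
  have hempty : H.children vert A K f i = ∅ := by
    refine Finset.eq_empty_of_forall_notMem fun g hg => ?_
    obtain ⟨-, h2, h3⟩ := Finset.mem_filter.1 hg
    exact Finset.disjoint_left.1 h3 h2 (subset_visited vert K f i huK)
  have herase : ∀ G : Finset V → E → ℝ, H.treeStep vert lam A G K f =
      branchRatio lam (univ.erase i) (H.children vert A K f)
        fun j g => G (visited vert K f (j + 1)) g := by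
    intro G
    rw [treeStep, branchRatio, branchRatio, ← Finset.mul_prod_erase univ _ (Finset.mem_univ i),
      hempty]
    simp
  rw [herase, herase]
  refine hc _ _ _ _ (by simp [Finset.card_erase_of_mem])
    (fun j _ => card_children_le hdeg hvert (Or.inr hf) j) ?_
  exact fun j _ g hg => ⟨hF _ _, hF' _ _, h _ _ (not_disjoint_visited hg)⟩

theorem potential_mono {k : ℕ} {x y : ℝ} (h : x ≤ y) : potential k x ≤ potential k y :=
  arsinh_le_arsinh.2 (sqrt_le_sqrt (by gcongr))

theorem abs_potential_sub_le {k : ℕ} {x y : ℝ} (hx' : x ≤ lam) (hy' : y ≤ lam) :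
    |potential k x - potential k y| ≤ potential k lam := by
  have h1 := potential_nonneg k x
  have h2 := potential_nonneg k y
  have h3 := potential_mono (k := k) hx'
  have h4 := potential_mono (k := k) hy'
  rw [abs_le]; constructor <;> linarith

/-- The exact ratios are a fixed point of the recursion step, and truncation starts it from λ
instead. All ratios lie in [0, λ], so the initial error is at most the potential of λ. -/
theorem abs_potential_ratio_sub_treeRatio_le {k : ℕ} (hlam : 0 < lam) (hdeg : H.DegreeLE (k + 1))
    (hvert : ∀ f, H.edge f = univ.image (vert f)) {err : ℕ → ℝ} (h0 : potential k lam ≤ err 0)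
    (herr : ∀ ℓ, Contracts (Fin (d + 1)) E d k lam (err ℓ) (err (ℓ + 1))) (ℓ : ℕ)
    {K : Finset V} {f : E} (hf : ¬ Disjoint (H.edge f) K) :
    |potential k (H.ratio lam (H.away A K) f) - potential k (H.treeRatio vert lam A ℓ K f)| ≤
      err ℓ := by
  induction ℓ generalizing K f with
  | zero => exact (abs_potential_sub_le (ratio_away_le hlam hvert K f) le_rfl).trans h0
  | succ ℓ ih =>
    have := congrFun (congrFun (H.ratio_eq_treeStep vert A hlam hvert) K) f
    rw [this]
    exact abs_potential_treeStep_sub_le hdeg hvert (herr ℓ)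
      (fun K f => (H.ratio_pos hlam _ _).le) (treeRatio_nonneg hlam ℓ) (fun K f => ih) hf

theorem abs_potential_ratio_sub_treeRatio_le_root {k : ℕ} (hk : 1 ≤ k) (hlam : 0 < lam)
    (hdeg : H.DegreeLE (k + 1))
    (hvert : ∀ f, H.edge f = univ.image (vert f)) {err : ℕ → ℝ} (h0 : potential k lam ≤ err 0)
    (herr0 : ∀ ℓ, 0 ≤ err ℓ)
    (herr : ∀ ℓ, Contracts (Fin (d + 1)) E d k lam (err ℓ) (err (ℓ + 1))) (ℓ : ℕ)
    {K : Finset V} {f : E} (hf : f ∉ A) :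
    |potential k (H.ratio lam (H.away A K) f) -
      potential k (H.treeRatio vert lam A (ℓ + 1) K f)| ≤ (d + 1) * err ℓ := by
  have := congrFun (congrFun (H.ratio_eq_treeStep vert A hlam hvert) K) f
  rw [this]
  have hc := contracts_mul (Fin (d + 1)) E (d + 1) hk hlam (herr0 ℓ)
  push_cast at hc
  exact abs_potential_treeStep_sub_le_root hdeg hvert hc
    (fun K f => (H.ratio_pos hlam _ _).le) (treeRatio_nonneg hlam ℓ)
    (fun K f hf => abs_potential_ratio_sub_treeRatio_le hlam hdeg hvert h0 herr ℓ hf) hf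

/-- One level of the recursion moves to intersecting hyperedges, so depth ℓ only looks at A within
line-graph distance ℓ. -/
theorem treeRatio_congr (hvert : ∀ f, H.edge f = univ.image (vert f)) {B : Finset E} (ℓ : ℕ)
    {K : Finset V} {f : E} (h : ∀ g, H.lineGraph.edist f g ≤ ℓ → (g ∈ A ↔ g ∈ B)) :
    H.treeRatio vert lam A ℓ K f = H.treeRatio vert lam B ℓ K f := by
  induction ℓ generalizing K f with
  | zero => rfl
  | succ ℓ ih =>
    have hnear : ∀ (j : Fin (d + 1)) (g : E), vert f j ∈ H.edge g →
        H.lineGraph.edist f g ≤ 1 := by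
      intro j g hg
      by_cases hfg : f = g
      · simp [hfg]
      · refine le_of_eq (SimpleGraph.edist_eq_one_iff_adj.2 ⟨hfg, ?_⟩)
        exact Finset.not_disjoint_iff.2 ⟨vert f j, by simp [hvert], hg⟩
    have hch : H.children vert A K f = H.children vert B K f := by
      funext j
      ext g
      simp only [children, Finset.mem_filter]
      refine and_congr_left fun hg => h g ((hnear j g hg.1).trans ?_)
      exact_mod_cast Nat.le_add_left 1 ℓ
    rw [treeRatio, treeRatio, treeStep, treeStep, branchRatio, branchRatio, hch]
    congr 1
    refine Finset.prod_congr rfl fun j _ => ?_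
    congr 2
    refine Finset.sum_congr rfl fun g hg => ?_
    apply ih
    intro g' hg'
    apply h
    have h1 := hnear j g (Finset.mem_filter.1 hg).2.1
    calc H.lineGraph.edist f g' ≤ H.lineGraph.edist f g + H.lineGraph.edist g g' :=
          SimpleGraph.edist_triangle
      _ ≤ 1 + ℓ := by gcongr
      _ = _ := by push_cast; ring

end Tree

end HGraph

end

/-! ### Conditional marginals and strong spatial mixing -/

section

open Real Finset

set_option linter.unusedSectionVars false

namespace HGraph

section Marginal

variable {V E : Type*} [DecidableEq V] [DecidableEq E] (H : HGraph V E) {lam : ℝ}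
  {Ψ Λ : Finset E} {σ τ : E → Bool} {e : E}

theorem mem_occupied {f : E} : f ∈ occupied Λ σ ↔ f ∈ Λ ∧ σ f = true := by simp [occupied]

/-- The hyperedges that the boundary condition `σ` leaves undetermined. -/
noncomputable def free (Ψ Λ : Finset E) (σ : E → Bool) : Finset E :=
  (Ψ \ Λ).filter fun f => ∀ g ∈ occupied Λ σ, Disjoint (H.edge f) (H.edge g)

theorem mem_free {f : E} : f ∈ H.free Ψ Λ σ ↔
    (f ∈ Ψ ∧ f ∉ Λ) ∧ ∀ g ∈ occupied Λ σ, Disjoint (H.edge f) (H.edge g) := by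
  simp [free]

theorem mem_conditioned {M : Finset E} : M ∈ H.conditioned Ψ Λ σ ↔
    (M ⊆ Ψ ∧ H.IsMatching M) ∧ ∀ f ∈ Λ, (f ∈ M ↔ σ f = true) := by
  simp [conditioned, mem_matchings]

/-- Conditioning on a partial matching amounts to deleting the hyperedges in Λ and those touching an
occupied one. The remaining choice is an arbitrary matching of the free hyperedges. -/
theorem conditioned_eq_image (hΛ : Λ ⊆ Ψ) (hσ : H.IsMatching (occupied Λ σ)) :
    H.conditioned Ψ Λ σ = (H.matchings (H.free Ψ Λ σ)).image (occupied Λ σ ∪ ·) := by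
  ext M
  simp only [mem_conditioned, Finset.mem_image, mem_matchings]
  constructor
  · rintro ⟨⟨hM, hm⟩, hag⟩
    have hocc : occupied Λ σ ⊆ M := fun f hf =>
      (hag f (mem_occupied.1 hf).1).2 (mem_occupied.1 hf).2
    refine ⟨M \ Λ, ⟨fun f hf => ?_, hm.subset (by simp)⟩, ?_⟩
    · obtain ⟨h1, h2⟩ := Finset.mem_sdiff.1 hf
      refine H.mem_free.2 ⟨⟨hM h1, h2⟩, fun g hg => hm h1 (hocc hg) ?_⟩
      rintro rfl
      exact h2 (mem_occupied.1 hg).1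
    · ext f
      simp only [Finset.mem_union, mem_occupied, Finset.mem_sdiff]
      by_cases hf : f ∈ Λ
      · simp [hf, hag f hf]
      · simp [hf]
  · rintro ⟨M', ⟨hM', hm'⟩, rfl⟩
    have hfree : ∀ f ∈ M', f ∉ Λ := fun f hf => (H.mem_free.1 (hM' hf)).1.2
    refine ⟨⟨Finset.union_subset (fun f hf => hΛ (mem_occupied.1 hf).1) fun f hf =>
      (H.mem_free.1 (hM' hf)).1.1, ?_⟩, fun f hf => ?_⟩
    · unfold IsMatching
      rw [Finset.coe_union, Set.pairwiseDisjoint_union]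
      exact ⟨hσ, hm', fun g hg f hf _ => ((H.mem_free.1 (hM' hf)).2 g hg).symm⟩
    · simp only [Finset.mem_union, mem_occupied, hf, true_and, or_iff_left_iff_imp]
      exact fun h => absurd hf (hfree f h)

theorem disjoint_occupied_of_mem_matchings {M : Finset E}
    (hM : M ∈ H.matchings (H.free Ψ Λ σ)) : Disjoint (occupied Λ σ) M := by
  rw [Finset.disjoint_left]
  exact fun f hf hfM => (H.mem_free.1 ((H.mem_matchings.1 hM).1 hfM)).1.2 (mem_occupied.1 hf).1

theorem union_occupied_injOn :
    Set.InjOn (occupied Λ σ ∪ ·) (H.matchings (H.free Ψ Λ σ) : Set (Finset E)) := by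
  intro M hM M' hM' h
  have h1 := H.disjoint_occupied_of_mem_matchings (Finset.mem_coe.1 hM)
  have h2 := H.disjoint_occupied_of_mem_matchings (Finset.mem_coe.1 hM')
  rw [← Finset.union_sdiff_cancel_left h1, ← Finset.union_sdiff_cancel_left h2]
  exact congrArg (· \ occupied Λ σ) h

theorem sum_conditioned (hΛ : Λ ⊆ Ψ) (hσ : H.IsMatching (occupied Λ σ)) :
    ∑ M ∈ H.conditioned Ψ Λ σ, lam ^ M.card =
      lam ^ (occupied Λ σ).card * H.weight lam (H.free Ψ Λ σ) := by
  rw [H.conditioned_eq_image hΛ hσ, Finset.sum_image H.union_occupied_injOn, weight,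
    Finset.mul_sum]
  refine Finset.sum_congr rfl fun M hM => ?_
  rw [Finset.card_union_of_disjoint (H.disjoint_occupied_of_mem_matchings hM), pow_add]

theorem sum_conditioned_filter_not_mem (hΛ : Λ ⊆ Ψ) (hσ : H.IsMatching (occupied Λ σ))
    (he : e ∉ Λ) :
    ∑ M ∈ (H.conditioned Ψ Λ σ).filter (fun M => e ∉ M), lam ^ M.card =
      lam ^ (occupied Λ σ).card * H.weight lam ((H.free Ψ Λ σ).erase e) := by
  have h1 : (H.conditioned Ψ Λ σ).filter (fun M => e ∉ M) =
      (H.matchings ((H.free Ψ Λ σ).erase e)).image (occupied Λ σ ∪ ·) := by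
    have heo : e ∉ occupied Λ σ := fun h => he (mem_occupied.1 h).1
    rw [H.conditioned_eq_image hΛ hσ]
    ext M
    simp only [Finset.mem_filter, Finset.mem_image, mem_matchings]
    constructor
    · rintro ⟨⟨M', ⟨h1, h2⟩, rfl⟩, h3⟩
      refine ⟨M', ⟨Finset.subset_erase.2 ⟨h1, fun h => h3 (Finset.mem_union_right _ h)⟩, h2⟩, rfl⟩
    · rintro ⟨M', ⟨h1, h2⟩, rfl⟩
      obtain ⟨h4, h5⟩ := Finset.subset_erase.1 h1
      exact ⟨⟨M', ⟨h4, h2⟩, rfl⟩, by simp [heo, h5]⟩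
  have hsub : H.matchings ((H.free Ψ Λ σ).erase e) ⊆ H.matchings (H.free Ψ Λ σ) := fun M hM =>
    H.mem_matchings.2 ⟨(H.mem_matchings.1 hM).1.trans (Finset.erase_subset _ _),
      (H.mem_matchings.1 hM).2⟩
  rw [h1, Finset.sum_image (H.union_occupied_injOn.mono (Finset.coe_subset.2 hsub)), weight,
    Finset.mul_sum]
  refine Finset.sum_congr rfl fun M hM => ?_
  rw [Finset.card_union_of_disjoint (H.disjoint_occupied_of_mem_matchings (hsub hM)), pow_add]

theorem marginal_eq_one_sub (hlam : 0 < lam) (hΛ : Λ ⊆ Ψ) (hσ : H.IsMatching (occupied Λ σ)) :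
    H.marginal lam Ψ Λ σ e = 1 -
      (∑ M ∈ (H.conditioned Ψ Λ σ).filter (fun M => e ∉ M), lam ^ M.card) /
        ∑ M ∈ H.conditioned Ψ Λ σ, lam ^ M.card := by
  have hpos : 0 < ∑ M ∈ H.conditioned Ψ Λ σ, lam ^ M.card := by
    rw [H.sum_conditioned hΛ hσ]
    exact mul_pos (by positivity) (H.weight_pos hlam _)
  have := Finset.sum_filter_add_sum_filter_not (H.conditioned Ψ Λ σ) (fun M => e ∈ M)
    (fun M => lam ^ M.card)
  rw [eq_sub_iff_add_eq, marginal, ← add_div, div_eq_one_iff_eq hpos.ne', ← this]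
  congr!

theorem marginal_of_notMem (hlam : 0 < lam) (hΛ : Λ ⊆ Ψ) (hσ : H.IsMatching (occupied Λ σ))
    (he : e ∉ Λ) : H.marginal lam Ψ Λ σ e =
      if e ∈ H.free Ψ Λ σ then H.ratio lam ((H.free Ψ Λ σ).erase e) e /
        (1 + H.ratio lam ((H.free Ψ Λ σ).erase e) e) else 0 := by
  have h1 := H.weight_pos hlam ((H.free Ψ Λ σ).erase e)
  rw [H.marginal_eq_one_sub hlam hΛ hσ, H.sum_conditioned_filter_not_mem hΛ hσ he,
    H.sum_conditioned hΛ hσ, mul_div_mul_left _ _ (by positivity)]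
  split_ifs with h
  · have h2 := H.weight_insert_eq_mul hlam (Finset.notMem_erase e (H.free Ψ Λ σ))
    rw [Finset.insert_erase h] at h2
    have h3 := H.ratio_pos hlam ((H.free Ψ Λ σ).erase e) e
    rw [h2]
    field_simp
    ring
  · rw [Finset.erase_eq_of_notMem h] at h1 ⊢
    rw [div_self h1.ne', sub_self]

theorem marginal_of_mem (hlam : 0 < lam) (hΛ : Λ ⊆ Ψ) (hσ : H.IsMatching (occupied Λ σ))
    (he : e ∈ Λ) : H.marginal lam Ψ Λ σ e = if σ e = true then 1 else 0 := by
  have hpos : 0 < ∑ M ∈ H.conditioned Ψ Λ σ, lam ^ M.card := by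
    rw [H.sum_conditioned hΛ hσ]
    exact mul_pos (by positivity) (H.weight_pos hlam _)
  have hm : H.marginal lam Ψ Λ σ e =
      (∑ M ∈ (H.conditioned Ψ Λ σ).filter (fun M => e ∈ M), lam ^ M.card) /
        ∑ M ∈ H.conditioned Ψ Λ σ, lam ^ M.card := by unfold marginal; congr!
  rw [hm]
  split_ifs with h
  · rw [Finset.filter_true_of_mem fun M hM => ((H.mem_conditioned.1 hM).2 e he).2 h,
      div_self hpos.ne']
  · rw [Finset.filter_false_of_mem fun M hM hM' => h (((H.mem_conditioned.1 hM).2 e he).1 hM')]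
    simp

theorem marginal_mem_Icc (hlam : 0 < lam) (hΛ : Λ ⊆ Ψ) (hσ : H.IsMatching (occupied Λ σ)) :
    0 ≤ H.marginal lam Ψ Λ σ e ∧ H.marginal lam Ψ Λ σ e ≤ 1 := by
  constructor
  · exact div_nonneg (Finset.sum_nonneg fun _ _ => by positivity)
      (Finset.sum_nonneg fun _ _ => by positivity)
  · rw [H.marginal_eq_one_sub hlam hΛ hσ]
    have : 0 ≤ (∑ M ∈ (H.conditioned Ψ Λ σ).filter (fun M => e ∉ M), lam ^ M.card) /
        ∑ M ∈ H.conditioned Ψ Λ σ, lam ^ M.card :=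
      div_nonneg (Finset.sum_nonneg fun _ _ => by positivity)
        (Finset.sum_nonneg fun _ _ => by positivity)
    linarith

/-- A boundary hyperedge influences its neighbours by blocking them. If g at distance at most L were
blocked under one condition only, a disagreement would occur at distance at most L + 1, hence the
bound L + 2. -/
theorem mem_free_iff_of_edist {L : ℕ} (hL : (L + 2 : ℕ) ≤ H.distTo e {f | f ∈ Λ ∧ σ f ≠ τ f})
    {g : E} (hg : H.lineGraph.edist e g ≤ L) : g ∈ H.free Ψ Λ σ ↔ g ∈ H.free Ψ Λ τ := by
  have key : ∀ σ' τ' : E → Bool,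
      (L + 2 : ℕ) ≤ H.distTo e {f | f ∈ Λ ∧ σ' f ≠ τ' f} →
      g ∈ H.free Ψ Λ σ' → g ∈ H.free Ψ Λ τ' := by
    intro σ' τ' hd hgf
    obtain ⟨h1, h2⟩ := H.mem_free.1 hgf
    refine H.mem_free.2 ⟨h1, fun f hf => ?_⟩
    obtain ⟨hfΛ, hfτ⟩ := mem_occupied.1 hf
    by_cases hfσ : σ' f = true
    · exact h2 f (mem_occupied.2 ⟨hfΛ, hfσ⟩)
    by_contra hdis
    have hne : g ≠ f := fun h => h1.2 (h ▸ hfΛ)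
    have hadj : H.lineGraph.edist g f = 1 :=
      SimpleGraph.edist_eq_one_iff_adj.2 ⟨hne, hdis⟩
    have hle : H.distTo e {f | f ∈ Λ ∧ σ' f ≠ τ' f} ≤ H.lineGraph.edist e f :=
      iInf₂_le f ⟨hfΛ, by rw [hfτ]; exact hfσ⟩
    have h3 : ((L + 2 : ℕ) : ℕ∞) ≤ ((L + 1 : ℕ) : ℕ∞) :=
      calc ((L + 2 : ℕ) : ℕ∞) ≤ H.lineGraph.edist e f := hd.trans hle
        _ ≤ H.lineGraph.edist e g + H.lineGraph.edist g f := SimpleGraph.edist_triangle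
        _ ≤ L + 1 := by rw [hadj]; gcongr
        _ = _ := by push_cast; ring
    have : L + 2 ≤ L + 1 := by exact_mod_cast h3
    omega
  refine ⟨key σ τ hL, key τ σ ?_⟩
  simpa only [ne_comm] using hL

end Marginal

/-- The inverse of the potential, sinh²(t)/k, has bounded derivative on the potentials of ratios in
[0, λ]. -/
theorem exists_abs_sub_le_potential {k : ℕ} (hk : 1 ≤ k) (lam : ℝ) :
    ∃ C : ℝ, 0 < C ∧ ∀ x y : ℝ, 0 ≤ x → x ≤ lam → 0 ≤ y → y ≤ lam →
      |x - y| ≤ C * |potential k x - potential k y| := by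
  have hk0 : (0 : ℝ) < k := by exact_mod_cast hk
  set m := potential k lam
  have hm : 0 ≤ m := potential_nonneg k lam
  refine ⟨2 * sinh m * cosh m / k + 1, by positivity, fun x y hx hx' hy hy' => ?_⟩
  have key := Convex.norm_image_sub_le_of_norm_hasDerivWithin_le (f := fun t => sinh t ^ 2 / k)
      (f' := fun t => 2 * sinh t * cosh t / k) (C := 2 * sinh m * cosh m / k) (s := Set.Icc 0 m)
      (x := potential k y) (y := potential k x)
      (fun t _ => by
        have := (((hasDerivAt_id' t).sinh.fun_pow 2).div_const (k : ℝ)).hasDerivWithinAt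
          (s := Set.Icc 0 m)
        exact this.congr_deriv (by norm_num))
      (fun t ht => by
        have h1 : 0 ≤ sinh t := sinh_nonneg_iff.2 ht.1
        have h2 : sinh t ≤ sinh m := sinh_le_sinh.2 ht.2
        have h3 : cosh t ≤ cosh m := by
          rw [cosh_le_cosh, abs_of_nonneg ht.1, abs_of_nonneg hm]; exact ht.2
        have h4 := cosh_pos t
        rw [Real.norm_eq_abs, abs_of_nonneg (by positivity)]
        gcongr) (convex_Icc 0 m)
      ⟨potential_nonneg k y, potential_mono hy'⟩ ⟨potential_nonneg k x, potential_mono hx'⟩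
  simp only [sinh_potential_sq k hx, sinh_potential_sq k hy, Real.norm_eq_abs] at key
  rw [mul_div_cancel_left₀ _ hk0.ne', mul_div_cancel_left₀ _ hk0.ne'] at key
  exact key.trans (by gcongr; linarith)

theorem abs_div_one_add_sub_le {x y : ℝ} (hx : 0 ≤ x) (hy : 0 ≤ y) :
    |x / (1 + x) - y / (1 + y)| ≤ |x - y| := by
  have : x / (1 + x) - y / (1 + y) = (x - y) / ((1 + x) * (1 + y)) := by field_simp; ring
  rw [this, abs_div]
  exact div_le_self (abs_nonneg _) (by rw [abs_of_nonneg (by positivity)]; nlinarith)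

/-- Both marginals are compared with one truncated recursion, which does not see the disagreement.
Radii below 3 are covered by the trivial bound 1, and infinite distance by letting the depth tend to
infinity. -/
theorem strongSpatialMixing_of_contracts {V E : Type*} [DecidableEq V] [DecidableEq E]
    {H : HGraph V E} {d k : ℕ} {vert : E → Fin (d + 1) → V} {lam : ℝ} (hk : 1 ≤ k)
    (hlam : 0 < lam) (hdeg : H.DegreeLE (k + 1)) (hvert : ∀ f, H.edge f = univ.image (vert f))
    {err : ℕ → ℝ} (h0 : potential k lam ≤ err 0) (herr0 : ∀ ℓ, 0 ≤ err ℓ)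
    (herr : ∀ ℓ, Contracts (Fin (d + 1)) E d k lam (err ℓ) (err (ℓ + 1)))
    (hlim : Filter.Tendsto err Filter.atTop (nhds 0)) {C : ℝ} (hC0 : 0 < C)
    (hC : ∀ x y : ℝ, 0 ≤ x → x ≤ lam → 0 ≤ y → y ≤ lam →
      |x - y| ≤ C * |potential k x - potential k y|) {δ : ℕ → ℝ}
    (hδ : ∀ ℓ, ℓ < 3 → 1 ≤ δ ℓ) (hδ' : ∀ ℓ, 2 * C * (d + 1) * err ℓ ≤ δ (ℓ + 3)) :
    H.StrongSpatialMixing lam δ := by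
  intro Ψ Λ hΛ e he σ τ hσ hτ
  -- The shift by 3 consists of the root level, which does not contract, and the 2 needed for the
  -- free sets to agree out to distance ℓ + 1.
  have key : ∀ ℓ : ℕ, ((ℓ + 3 : ℕ) : ℕ∞) ≤ H.distTo e {f | f ∈ Λ ∧ σ f ≠ τ f} →
      |H.marginal lam Ψ Λ σ e - H.marginal lam Ψ Λ τ e| ≤ 2 * C * (d + 1) * err ℓ := by
    intro ℓ hℓ
    have hpos : 0 ≤ 2 * C * (d + 1) * err ℓ := by have := herr0 ℓ; positivity
    by_cases heΛ : e ∈ Λ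
    · have hστ : σ e = τ e := by
        by_contra hne
        have h1 : H.distTo e {f | f ∈ Λ ∧ σ f ≠ τ f} ≤ H.lineGraph.edist e e :=
          iInf₂_le e ⟨heΛ, hne⟩
        have h2 := hℓ.trans h1
        rw [SimpleGraph.edist_self] at h2
        simp at h2
      rw [H.marginal_of_mem hlam hΛ hσ heΛ, H.marginal_of_mem hlam hΛ hτ heΛ, hστ]
      simpa using hpos
    · rw [H.marginal_of_notMem hlam hΛ hσ heΛ, H.marginal_of_notMem hlam hΛ hτ heΛ]
      have hmem : e ∈ H.free Ψ Λ σ ↔ e ∈ H.free Ψ Λ τ :=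
        H.mem_free_iff_of_edist (L := ℓ + 1) hℓ (by simp)
      by_cases hef : e ∈ H.free Ψ Λ σ
      · rw [if_pos hef, if_pos (hmem.1 hef)]
        refine (abs_div_one_add_sub_le (H.ratio_pos hlam _ _).le
          (H.ratio_pos hlam _ _).le).trans ?_
        set A := (H.free Ψ Λ σ).erase e with hA
        set B := (H.free Ψ Λ τ).erase e with hB
        have hAB : H.treeRatio vert lam A (ℓ + 1) ∅ e = H.treeRatio vert lam B (ℓ + 1) ∅ e := by
          refine treeRatio_congr hvert (ℓ + 1) fun g hg => ?_
          rw [hA, hB, Finset.mem_erase, Finset.mem_erase,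
            H.mem_free_iff_of_edist (L := ℓ + 1) hℓ hg]
        have h1 := abs_potential_ratio_sub_treeRatio_le_root (K := ∅) (A := A) (f := e) hk hlam
          hdeg hvert h0 herr0 herr ℓ (by simp [hA])
        have h2 := abs_potential_ratio_sub_treeRatio_le_root (K := ∅) (A := B) (f := e) hk hlam
          hdeg hvert h0 herr0 herr ℓ (by simp [hB])
        have h3 := ratio_away_le (A := A) hlam hvert ∅ e
        have h4 := ratio_away_le (A := B) hlam hvert ∅ e
        rw [away_empty] at h1 h2 h3 h4
        rw [hAB] at h1
        refine (hC _ _ (H.ratio_pos hlam _ _).le h3 (H.ratio_pos hlam _ _).le h4).trans ?_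
        have h5 := abs_sub_le (potential k (H.ratio lam A e))
          (potential k (H.treeRatio vert lam B (ℓ + 1) ∅ e)) (potential k (H.ratio lam B e))
        rw [abs_sub_comm (potential k (H.treeRatio vert lam B (ℓ + 1) ∅ e))] at h5
        calc _ ≤ C * ((d + 1) * err ℓ + (d + 1) * err ℓ) := by gcongr; linarith
          _ = _ := by ring
      · rw [if_neg hef, if_neg fun h => hef (hmem.2 h)]
        simpa using hpos
  refine ⟨fun ℓ hℓ => ?_, fun htop => ?_⟩
  · by_cases h3 : ℓ < 3
    · refine le_trans ?_ (hδ ℓ h3)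
      have h1 := H.marginal_mem_Icc (e := e) hlam hΛ hσ
      have h2 := H.marginal_mem_Icc (e := e) hlam hΛ hτ
      rw [abs_le]; constructor <;> linarith [h1.1, h1.2, h2.1, h2.2]
    · obtain ⟨m, rfl⟩ := Nat.exists_eq_add_of_le' (not_lt.1 h3)
      exact (key m hℓ.ge).trans (hδ' m)
  · have h1 : |H.marginal lam Ψ Λ σ e - H.marginal lam Ψ Λ τ e| ≤ 0 := by
      refine ge_of_tendsto' (f := fun ℓ => 2 * C * (d + 1) * err ℓ) (x := Filter.atTop) ?_
        fun ℓ => key ℓ (by rw [htop]; exact le_top)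
      simpa using hlim.const_mul (2 * C * (d + 1))
    exact sub_eq_zero.1 (abs_nonpos_iff.1 h1)

section Pad

variable {V E : Type*} (H : HGraph V E) {d k : ℕ}

/-- Each hyperedge is filled up with vertices (f, j) belonging to it alone. These create no new
intersections and have degree at most 1, while every hyperedge becomes the image of `Fin (d + 1)`.
-/
theorem exists_enum (hs : H.EdgeSizeLE (d + 1)) : ∃ vert : E → Fin (d + 1) → V ⊕ E × Fin (d + 1),
    ∀ f, (∀ v, Sum.inl v ∈ Set.range (vert f) ↔ v ∈ H.edge f) ∧
      ∀ p, Sum.inr p ∈ Set.range (vert f) → p.1 = f := by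
  classical
  refine ⟨fun f j => if h : j.val < (H.edge f).card then
    Sum.inl ((H.edge f).equivFin.symm ⟨j, h⟩).val else Sum.inr (f, j), fun f => ⟨fun v => ?_, ?_⟩⟩
  · constructor
    · rintro ⟨j, hj⟩
      dsimp only at hj
      split_ifs at hj with h
      rw [← Sum.inl_injective hj]
      exact Subtype.prop _
    · intro hv
      have h1 := ((H.edge f).equivFin ⟨v, hv⟩).isLt
      refine ⟨⟨(H.edge f).equivFin ⟨v, hv⟩, h1.trans_le (hs f)⟩, ?_⟩
      simp
  · rintro p ⟨j, hj⟩
    dsimp only at hj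
    split_ifs at hj with h
    rw [← Sum.inr_injective hj]

open Classical in
/-- Strong spatial mixing passes from a hypergraph with padded hyperedges to the original. -/
theorem strongSpatialMixing_of_padded {lam : ℝ} {δ : ℕ → ℝ} (hs : H.EdgeSizeLE (d + 1))
    (hdeg : H.DegreeLE (k + 1))
    (h : ∀ (H' : HGraph (V ⊕ E × Fin (d + 1)) E) (vert : E → Fin (d + 1) → V ⊕ E × Fin (d + 1)),
      H'.DegreeLE (k + 1) → (∀ f, H'.edge f = univ.image (vert f)) →
      H'.StrongSpatialMixing lam δ) : H.StrongSpatialMixing lam δ := by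
  obtain ⟨vert, hv⟩ := H.exists_enum hs
  set H' : HGraph (V ⊕ E × Fin (d + 1)) E := ⟨fun f => univ.image (vert f)⟩ with hH'
  have hmem : ∀ f x, x ∈ H'.edge f ↔ x ∈ Set.range (vert f) := by
    intro f x; simp [hH']
  have hdisj : ∀ e f, e ≠ f → (Disjoint (H'.edge e) (H'.edge f) ↔
      Disjoint (H.edge e) (H.edge f)) := by
    intro e f hef
    simp only [Finset.disjoint_left, hmem]
    constructor
    · intro h1 v he hf
      exact h1 (((hv e).1 v).2 he) (((hv f).1 v).2 hf)
    · rintro h1 (v | p) he hf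
      · exact h1 (((hv e).1 v).1 he) (((hv f).1 v).1 hf)
      · exact hef (((hv e).2 p he).symm.trans ((hv f).2 p hf))
  have hdeg' : H'.DegreeLE (k + 1) := by
    rintro (v | p)
    · refine le_trans (le_of_eq ?_) (hdeg v)
      congr 1
      ext f
      simp only [Set.mem_ofPred_eq, hmem, (hv f).1 v]
    · have hsub : {e | Sum.inr p ∈ H'.edge e} ⊆ {p.1} := fun e he =>
        ((hv e).2 p ((hmem _ _).1 he)).symm
      refine (Set.encard_le_encard hsub).trans ?_
      rw [Set.encard_singleton]
      exact_mod_cast Nat.le_add_left 1 k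
  have hmatch : H'.IsMatching = H.IsMatching := by
    funext M
    refine propext ⟨fun hM e he f hf hef => (hdisj e f hef).1 (hM he hf hef),
      fun hM e he f hf hef => (hdisj e f hef).2 (hM he hf hef)⟩
  have hline : H'.lineGraph = H.lineGraph := by
    ext e f
    exact and_congr_right fun hef => not_congr (hdisj e f hef)
  have := h H' vert hdeg' fun f => rfl
  simpa only [StrongSpatialMixing, distTo, marginal, conditioned, matchings, hmatch, hline]
    using this

end Pad

end HGraph

end

/-! ### Fixed point, critical activity, and the two mixing rates -/

section

open Real Finset


section Critical

theorem exists_fixedPoint {d : ℕ} {μ : ℝ} (hμ : 0 < μ) : ∃ x : ℝ, 0 < x ∧ x * (1 + x) ^ d = μ := by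
  have hcont : Continuous fun x : ℝ => x * (1 + x) ^ d := by fun_prop
  have h1 : μ ≤ μ * (1 + μ) ^ d := le_mul_of_one_le_right hμ.le (one_le_pow₀ (by linarith))
  obtain ⟨x, hx, hxμ⟩ := intermediate_value_Icc hμ.le hcont.continuousOn
    (show μ ∈ Set.Icc (0 * (1 + 0) ^ d : ℝ) (μ * (1 + μ) ^ d) from ⟨by simpa using hμ.le, h1⟩)
  refine ⟨x, lt_of_le_of_ne hx.1 ?_, hxμ⟩
  rintro rfl
  simp at hxμ
  exact hμ.ne hxμ

theorem lambdaC_eq_ofReal {d k : ℕ} (hd : 2 ≤ d) (hk : 1 ≤ k) :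
    lambdaC d k = ENNReal.ofReal ((d : ℝ) ^ d / (k * ((d : ℝ) - 1) ^ (d + 1))) := by
  have h1 : (1 : ℝ) < d := by exact_mod_cast hd
  have h2 : (0 : ℝ) < (d : ℝ) - 1 := by linarith
  have hk0 : (0 : ℝ) < k := by exact_mod_cast hk
  rw [lambdaC, ENNReal.ofReal_div_of_pos (by positivity), ENNReal.ofReal_pow (by positivity),
    ENNReal.ofReal_mul (by positivity), ENNReal.ofReal_pow h2.le, ENNReal.ofReal_natCast,
    ENNReal.ofReal_natCast, ENNReal.ofReal_sub _ zero_le_one, ENNReal.ofReal_natCast,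
    ENNReal.ofReal_one]

theorem lambdaC_one (k : ℕ) : lambdaC 1 k = ⊤ := by simp [lambdaC]

/-- The value x = 1/(d - 1) is where dx = 1 + x, and there x(1 + x)^d = k λ_c. The function x(1 +
x)^d is increasing, so a larger fixed point would force λ ≥ λ_c. For d = 1 the inequality is
trivial. -/
theorem mul_lt_of_lt_lambdaC {d k : ℕ} (hd : 1 ≤ d) (hk : 1 ≤ k) {lam x : ℝ}
    (hlam : ENNReal.ofReal lam < lambdaC d k) (hx : 0 < x) (hμ : x * (1 + x) ^ d = k * lam) :
    d * x < 1 + x := by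
  rcases hd.eq_or_lt with rfl | hd2
  · simp
  by_contra hcon
  have hk0 : (0 : ℝ) < k := by exact_mod_cast hk
  have h1 : (1 : ℝ) < d := by exact_mod_cast hd2
  have h2 : (0 : ℝ) < (d : ℝ) - 1 := by linarith
  have h3 : 1 / ((d : ℝ) - 1) ≤ x := by
    rw [div_le_iff₀ h2]; nlinarith
  have h4 : (d : ℝ) / (d - 1) ≤ 1 + x := by
    have : (d : ℝ) / (d - 1) = 1 + 1 / (d - 1) := by field_simp; ring
    rw [this]; linarith
  rw [lambdaC_eq_ofReal hd2 hk, ENNReal.ofReal_lt_ofReal_iff (by positivity),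
    lt_div_iff₀ (by positivity)] at hlam
  have h5 : 1 / ((d : ℝ) - 1) * ((d : ℝ) / (d - 1)) ^ d ≤ x * (1 + x) ^ d := by gcongr
  have h6 : 1 / ((d : ℝ) - 1) * ((d : ℝ) / (d - 1)) ^ d * (d - 1) ^ (d + 1) = d ^ d := by
    rw [div_pow]; field_simp; ring
  have h7 : 1 / ((d : ℝ) - 1) * ((d : ℝ) / (d - 1)) ^ d * (d - 1) ^ (d + 1) ≤
      k * lam * (d - 1) ^ (d + 1) := by rw [← hμ]; gcongr
  rw [h6] at h7
  linarith

/-- A real activity can be critical only if d ≥ 2, as λ_c is infinite for d = 1. -/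
theorem fixedPoint_of_eq_lambdaC {d k : ℕ} (hd : 1 ≤ d) (hk : 1 ≤ k) {lam : ℝ} (hlam0 : 0 < lam)
    (hlam : ENNReal.ofReal lam = lambdaC d k) :
    2 ≤ d ∧ ∃ x : ℝ, 0 < x ∧ k * lam = x * (1 + x) ^ d ∧ d * x = 1 + x := by
  rcases hd.eq_or_lt with rfl | hd2
  · simp [lambdaC_one] at hlam
  refine ⟨hd2, 1 / ((d : ℝ) - 1), ?_⟩
  have hk0 : (0 : ℝ) < k := by exact_mod_cast hk
  have h1 : (1 : ℝ) < d := by exact_mod_cast hd2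
  have h2 : (0 : ℝ) < (d : ℝ) - 1 := by linarith
  rw [lambdaC_eq_ofReal hd2 hk, ENNReal.ofReal_eq_ofReal_iff hlam0.le (by positivity)] at hlam
  have h3 : 1 + 1 / ((d : ℝ) - 1) = d / (d - 1) := by field_simp; ring
  refine ⟨by positivity, ?_, ?_⟩
  · rw [h3, hlam, div_pow]; field_simp; ring
  · rw [h3]; field_simp

/-- A recursion with cubic decrease decays like an inverse square root. -/
theorem exists_cubic_decay {c a : ℝ} (hc : 0 < c) (ha : 0 ≤ a) : ∃ K : ℝ, 0 < K ∧ a ≤ K ∧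
    ∀ ℓ : ℕ, ∀ D, 0 ≤ D → D + c * D ^ 3 ≤ K / √(ℓ + 1) → D ≤ K / √((ℓ + 1 : ℕ) + 1) := by
  -- Two requirements on K: it dominates the initial value a, and cK² ≥ 1 makes the cubic term
  -- outweigh the decrease of K/√(ℓ + 1).
  refine ⟨a + 1 / √c, by positivity, by linarith [show 0 < 1 / √c by positivity],
    fun ℓ D hD h => ?_⟩
  set K := a + 1 / √c with hK
  have hK0 : 0 < K := by positivity
  have hcK : 1 ≤ c * K ^ 2 := by
    have h1 : 1 / √c ≤ K := by rw [hK]; linarith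
    calc (1 : ℝ) = c * (1 / √c) ^ 2 := by rw [div_pow, sq_sqrt hc.le]; field_simp
      _ ≤ _ := by gcongr
  by_contra! hlt
  set s := √((ℓ + 1 : ℕ) + 1 : ℝ) with hs
  set t := √(ℓ + 1 : ℝ) with ht
  have hs2 : s ^ 2 = ℓ + 2 := by rw [hs, sq_sqrt (by positivity)]; push_cast; ring
  have ht2 : t ^ 2 = ℓ + 1 := by rw [ht, sq_sqrt (by positivity)]
  have hs0 : 0 < s := by rw [hs]; positivity
  have ht0 : 0 < t := by rw [ht]; positivity
  have h2 : K / s + c * (K / s) ^ 3 < D + c * D ^ 3 := by gcongr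
  have h3 : K / s * (1 + 1 / s ^ 2) ≤ K / s + c * (K / s) ^ 3 := by
    have : K / s + c * (K / s) ^ 3 = K / s * (1 + c * K ^ 2 / s ^ 2) := by field_simp
    rw [this]; gcongr
  -- Squared and cleared of denominators, this is (ℓ + 2)³ ≤ (ℓ + 1)(ℓ + 3)².
  have h4 : 1 / t ≤ 1 / s * (1 + 1 / s ^ 2) := by
    have h5 : s ^ 3 ≤ t * (s ^ 2 + 1) := by
      refine le_of_sq_le_sq ?_ (by positivity)
      have h6 : (s ^ 3) ^ 2 = (ℓ + 2 : ℝ) ^ 3 := by rw [← hs2]; ring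
      rw [h6, mul_pow, ht2, hs2]
      have : (0 : ℝ) ≤ ℓ := by positivity
      nlinarith
    have h7 : 1 / s * (1 + 1 / s ^ 2) = (s ^ 2 + 1) / s ^ 3 := by field_simp
    rw [h7, div_le_div_iff₀ ht0 (by positivity)]; linarith
  have h8 : K / t ≤ K / s * (1 + 1 / s ^ 2) := by
    calc K / t = K * (1 / t) := by ring
      _ ≤ K * (1 / s * (1 + 1 / s ^ 2)) := by gcongr
      _ = _ := by ring
  linarith

end Critical

namespace HGraph

theorem exists_ssm_exp {d k : ℕ} (hd : 1 ≤ d) (hk : 1 ≤ k) {lam x : ℝ} (hlam : 0 < lam)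
    (hx : 0 < x) (hμ : k * lam = x * (1 + x) ^ d) (hdx : d * x < 1 + x) :
    ∃ C q : ℝ, 0 < C ∧ 0 < q ∧ q < 1 ∧ ∀ (V : Type u) (E : Type v) (H : HGraph V E),
      H.EdgeSizeLE (d + 1) → H.DegreeLE (k + 1) →
        H.StrongSpatialMixing lam (fun ℓ => C * q ^ ℓ) := by
  classical
  obtain ⟨C, hC0, hC⟩ := exists_abs_sub_le_potential hk lam
  have hd0 : (0 : ℝ) < d := by exact_mod_cast hd
  set q := √(d * x / (1 + x)) with hq
  have hq0 : 0 < q := by rw [hq]; positivity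
  have hq1 : q < 1 := by
    rw [hq, sqrt_lt' one_pos, one_pow, div_lt_one (by linarith)]; exact hdx
  set m := potential k lam with hm
  have hm0 : 0 ≤ m := potential_nonneg k lam
  -- Dividing by q³ undoes the shift of the distance by 3; the summand 1 makes the rate at least 1
  -- for the first three distances.
  refine ⟨(1 + 2 * C * (d + 1) * m) / q ^ 3, q, by positivity, hq0, hq1, fun V E H hs hdeg =>
    H.strongSpatialMixing_of_padded hs hdeg fun H' vert hdeg' hvert => ?_⟩
  refine strongSpatialMixing_of_contracts (err := fun ℓ => q ^ ℓ * m) hk hlam hdeg' hvert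
    (by simp [hm])
    (fun ℓ => by positivity) (fun ℓ => ?_) ?_ hC0 hC (fun ℓ hℓ => ?_) fun ℓ => ?_
  · rw [pow_succ', mul_assoc]
    exact contracts_sqrt_mul _ _ hd hk hlam hx hμ hdx.le (by positivity)
  · simpa using (tendsto_pow_atTop_nhds_zero_of_lt_one hq0.le hq1).mul_const m
  · have h1 : q ^ 3 ≤ q ^ ℓ := pow_le_pow_of_le_one hq0.le hq1.le hℓ.le
    have h2 : 0 ≤ 2 * C * (d + 1) * m := by positivity
    rw [div_mul_eq_mul_div, le_div_iff₀ (by positivity), one_mul]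
    nlinarith [pow_pos hq0 ℓ]
  · have : (1 + 2 * C * (d + 1) * m) / q ^ 3 * q ^ (ℓ + 3) = (1 + 2 * C * (d + 1) * m) * q ^ ℓ := by
      rw [pow_add]; field_simp
    rw [this]
    nlinarith [pow_pos hq0 ℓ]

theorem exists_ssm_poly {d k : ℕ} (hd : 1 ≤ d) (hk : 1 ≤ k) {lam x : ℝ} (hlam : 0 < lam)
    (hx : 0 < x) (hμ : k * lam = x * (1 + x) ^ d) (hdx : d * x = 1 + x) :
    ∃ C α : ℝ, 0 < C ∧ 0 < α ∧ ∀ (V : Type u) (E : Type v) (H : HGraph V E),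
      H.EdgeSizeLE (d + 1) → H.DegreeLE (k + 1) →
        H.StrongSpatialMixing lam (fun ℓ => C * ((ℓ : ℝ) + 1) ^ (-α)) := by
  classical
  obtain ⟨C, hC0, hC⟩ := exists_abs_sub_le_potential hk lam
  obtain ⟨c, hc, hcube⟩ := exists_contracts_cube hd hk hlam hx hμ hdx
  obtain ⟨K, hK0, hK, hdecay⟩ := exists_cubic_decay hc (potential_nonneg k lam)
  have hrate : ∀ ℓ : ℕ, ((ℓ : ℝ) + 1) ^ (-(1 / 2 : ℝ)) = 1 / √(ℓ + 1) := by
    intro ℓ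
    rw [rpow_neg (by positivity), ← sqrt_eq_rpow, one_div]
  refine ⟨2 + 4 * C * (d + 1) * K, 1 / 2, by positivity, by norm_num, fun V E H hs hdeg =>
    H.strongSpatialMixing_of_padded hs hdeg fun H' vert hdeg' hvert => ?_⟩
  have hpos : 0 ≤ 2 * C * (d + 1) * K := by positivity
  refine strongSpatialMixing_of_contracts (err := fun ℓ => K / √(ℓ + 1)) hk hlam hdeg' hvert
    (by simpa using hK) (fun ℓ => by positivity) (fun ℓ => ?_) ?_ hC0 hC (fun ℓ hℓ => ?_)
    fun ℓ => ?_
  · exact hcube _ _ _ _ (by positivity) (by positivity) (hdecay ℓ)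
  · have h1 : Filter.Tendsto (fun ℓ : ℕ => √((ℓ : ℝ) + 1)) Filter.atTop Filter.atTop :=
      tendsto_sqrt_atTop.comp
        (Filter.tendsto_atTop_add_const_right _ _ tendsto_natCast_atTop_atTop)
    exact h1.const_div_atTop K
  · rw [hrate, mul_one_div, le_div_iff₀ (by positivity), one_mul]
    have h2 : √((ℓ : ℝ) + 1) ≤ 2 := by
      rw [sqrt_le_left (by norm_num)]
      have : (ℓ : ℝ) < 3 := by exact_mod_cast hℓ
      linarith
    linarith
  · rw [hrate, mul_one_div]
    -- For the polynomial rate the shift by 3 costs only a factor 2, as ℓ + 4 ≤ 4(ℓ + 1).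
    have h3 : √(((ℓ + 3 : ℕ) : ℝ) + 1) ≤ 2 * √((ℓ : ℝ) + 1) := by
      rw [sqrt_le_left (by positivity), mul_pow, sq_sqrt (by positivity)]
      push_cast; linarith [show (0 : ℝ) ≤ ℓ by positivity]
    rw [← mul_div_assoc, div_le_div_iff₀ (by positivity) (by positivity)]
    calc 2 * C * (d + 1) * K * √(((ℓ + 3 : ℕ) : ℝ) + 1)
        ≤ 2 * C * (d + 1) * K * (2 * √((ℓ : ℝ) + 1)) := by gcongr
      _ ≤ _ := by nlinarith [sqrt_nonneg ((ℓ : ℝ) + 1)]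

end HGraph

end

/-! ### Semantics and cost of loop-free programs; memory layout -/

section

open Finset

namespace RAM

/-- The number of nodes of an expression. -/
def Expr.wt : Expr → ℕ
  | .lit _ => 1
  | .load a => a.wt + 1
  | .add a b => a.wt + b.wt + 1
  | .sub a b => a.wt + b.wt + 1
  | .mul a b => a.wt + b.wt + 1
  | .div a b => a.wt + b.wt + 1
  | .query a => a.wt + 1

/-- The bit lengths charged for the multiplications, divisions and queries in an expression. -/
noncomputable def Expr.bits (lam : ℝ) (m : ℕ → ℕ) : Expr → ℕ
  | .lit _ => 0
  | .load a => a.bits lam m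
  | .add a b => a.bits lam m + b.bits lam m
  | .sub a b => a.bits lam m + b.bits lam m
  | .mul a b => a.bits lam m + b.bits lam m +
      (Nat.size (a.eval lam m) + Nat.size (b.eval lam m))
  | .div a b => a.bits lam m + b.bits lam m +
      (Nat.size (a.eval lam m) + Nat.size (b.eval lam m))
  | .query a => a.bits lam m + Nat.size (a.eval lam m)

/-- Splits the cost into a constant of the program text and the bit lengths, which depend on the
data. Running times then reduce to counting rounds of loops and bounding operands. -/
theorem Expr.cost_eq (lam : ℝ) (m : ℕ → ℕ) (e : Expr) :
    e.cost lam m = e.wt + e.bits lam m := by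
  induction e with
  | lit => rfl
  | _ => simp only [cost, wt, bits, *]; omega

/-- The effect of a program without loops. -/
noncomputable def Prog.sem (lam : ℝ) : Prog → (ℕ → ℕ) → (ℕ → ℕ)
  | .skip, m => m
  | .store a e, m => Function.update m (a.eval lam m) (e.eval lam m)
  | .seq p q, m => q.sem lam (p.sem lam m)
  | .branch e p q, m => if e.eval lam m = 0 then q.sem lam m else p.sem lam m
  | .loop _ _, m => m

/-- The bit lengths charged in the run of a program without loops. -/
noncomputable def Prog.bits (lam : ℝ) : Prog → (ℕ → ℕ) → ℕ
  | .skip, _ => 0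
  | .store a e, m => a.bits lam m + e.bits lam m
  | .seq p q, m => p.bits lam m + q.bits lam (p.sem lam m)
  | .branch e p q, m =>
      e.bits lam m + if e.eval lam m = 0 then q.bits lam m else p.bits lam m
  | .loop _ _, _ => 0

/-- The number of nodes of a program without loops. -/
def Prog.wt : Prog → ℕ
  | .skip => 1
  | .store a e => a.wt + e.wt + 1
  | .seq p q => p.wt + q.wt + 1
  | .branch e p q => e.wt + p.wt + q.wt + 1
  | .loop _ _ => 0

/-- A program has no loops. -/
def Prog.LoopFree : Prog → Prop
  | .skip => True
  | .store _ _ => True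
  | .seq p q => p.LoopFree ∧ q.LoopFree
  | .branch _ p q => p.LoopFree ∧ q.LoopFree
  | .loop _ _ => False

/-- The program halts in memory `m'` within `t` steps. -/
def Runs (lam : ℝ) (p : Prog) (m m' : ℕ → ℕ) (t : ℕ) : Prop := ∃ t' ≤ t, Exec lam p m m' t'

variable {lam : ℝ}

theorem Runs.mono {p : Prog} {m m' : ℕ → ℕ} {t u : ℕ} (h : Runs lam p m m' t) (htu : t ≤ u) :
    Runs lam p m m' u := let ⟨t', h1, h2⟩ := h; ⟨t', h1.trans htu, h2⟩

theorem Runs.seq {p q : Prog} {m m' m'' : ℕ → ℕ} {t u : ℕ} (h : Runs lam p m m' t)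
    (h' : Runs lam q m' m'' u) : Runs lam (.seq p q) m m'' (t + u + 1) := by
  obtain ⟨t', h1, h2⟩ := h
  obtain ⟨u', h3, h4⟩ := h'
  exact ⟨t' + u' + 1, by omega, .seq _ _ _ _ _ _ _ h2 h4⟩

theorem runs_sem {p : Prog} (hp : p.LoopFree) (m : ℕ → ℕ) :
    Runs lam p m (p.sem lam m) (p.wt + p.bits lam m) := by
  induction p generalizing m with
  | skip => exact ⟨1, by simp [Prog.wt], .skip m⟩
  | store a e =>
    exact ⟨_, by simp only [Prog.wt, Prog.bits, Expr.cost_eq]; omega, .store a e m⟩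
  | seq p q ihp ihq =>
    refine ((ihp hp.1 m).seq (ihq hp.2 _)).mono ?_
    simp only [Prog.wt, Prog.bits]; omega
  | branch e p q ihp ihq =>
    by_cases h : e.eval lam m = 0
    · obtain ⟨t, h1, h2⟩ := ihq hp.2 m
      refine ⟨_, ?_, by simpa only [Prog.sem, h, if_true] using .branch_false e p q m _ t h h2⟩
      simp only [Prog.wt, Prog.bits, Expr.cost_eq, h, if_true]; omega
    · obtain ⟨t, h1, h2⟩ := ihp hp.1 m
      refine ⟨_, ?_, by simpa only [Prog.sem, h, if_false] using .branch_true e p q m _ t h h2⟩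
      simp only [Prog.wt, Prog.bits, Expr.cost_eq, h, if_false]; omega
  | loop => exact hp.elim

theorem runs_of_sem {p : Prog} (hp : p.LoopFree) {m m' : ℕ → ℕ} {β : ℕ} (h : p.sem lam m = m')
    (hβ : p.bits lam m ≤ β) : Runs lam p m m' (p.wt + β) :=
  h ▸ (runs_sem hp m).mono (by omega)

/-- A number of rounds of a loop with guard `g` and body `p`, each round within `β` steps. -/
inductive Path (lam : ℝ) (g : Expr) (p : Prog) (β : ℕ) : ℕ → (ℕ → ℕ) → (ℕ → ℕ) → Prop
  | nil (m : ℕ → ℕ) : Path lam g p β 0 m m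
  | cons {n : ℕ} {m m' m'' : ℕ → ℕ} : g.eval lam m ≠ 0 → Runs lam p m m' β →
      Path lam g p β n m' m'' → Path lam g p β (n + 1) m m''

variable {g : Expr} {p : Prog} {β : ℕ}

theorem Path.single {m m' : ℕ → ℕ} (hg : g.eval lam m ≠ 0) (h : Runs lam p m m' β) :
    Path lam g p β 1 m m' := .cons hg h (.nil _)

theorem Path.trans {a b : ℕ} {m m' m'' : ℕ → ℕ} (h : Path lam g p β a m m')
    (h' : Path lam g p β b m' m'') : Path lam g p β (a + b) m m'' := by
  induction h with
  | nil => simpa using h'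
  | cons hg hr _ ih => rw [Nat.add_right_comm]; exact .cons hg hr (ih h')

/-- The summand 1 in n + 1 pays for the final test of the guard. Guards use no multiplication,
division or query, so each test costs a constant. -/
theorem Path.runs {n : ℕ} {m m' : ℕ → ℕ} (h : Path lam g p β n m m')
    (hg : ∀ m, g.bits lam m = 0) (hm' : g.eval lam m' = 0) :
    Runs lam (.loop g p) m m' ((n + 1) * (g.wt + β + 1)) := by
  induction h with
  | nil m =>
    refine ⟨_, ?_, .loop_false g p m hm'⟩
    rw [Expr.cost_eq, hg]; omega
  | @cons n m m₁ m₂ h1 h2 _ ih =>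
    obtain ⟨t, ht, hr⟩ := h2
    obtain ⟨t', ht', hr'⟩ := ih hm'
    refine ⟨_, ?_, .loop_true g p _ _ _ _ _ h1 hr hr'⟩
    rw [Expr.cost_eq, hg, Nat.succ_mul]; omega

theorem Path.of_forall {m : ℕ → ℕ → ℕ} (n : ℕ)
    (h : ∀ i < n, g.eval lam (m i) ≠ 0 ∧ Runs lam p (m i) (m (i + 1)) β) :
    Path lam g p β n (m 0) (m n) := by
  induction n with
  | zero => exact .nil _
  | succ n ih => exact (ih fun i hi => h i (by omega)).trans (.single (h n n.lt_succ_self).1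
      (h n n.lt_succ_self).2)

/-! ### Memory as arrays -/

/-- The low part of the memory, which holds its own length in cell `0`. -/
structure Base where
  /-- the contents -/
  low : ℕ → ℕ
  pos : 0 < low 0

/-- The memory with the low part `B` followed by eleven interleaved arrays. -/
def mem (B : Base) (s : ℕ → ℕ → ℕ) : ℕ → ℕ := fun x =>
  if x < B.low 0 then B.low x else s ((x - B.low 0) % 11) ((x - B.low 0) / 11)

/-- The arrays with one entry changed. -/
def upd (s : ℕ → ℕ → ℕ) (c i x : ℕ) : ℕ → ℕ → ℕ := fun c' i' =>
  if c' = c ∧ i' = i then x else s c' i'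

/-- A multiple of an expression, by repeated addition. -/
def scale : ℕ → Expr → Expr
  | 0, _ => .lit 0
  | n + 1, a => .add (scale n a) a

/-- The address of an array entry. -/
def addr (c : ℕ) (a : Expr) : Expr := .add (.add (.load (.lit 0)) (.lit c)) (scale 11 a)

/-- Reading an array entry. -/
def rd (c : ℕ) (a : Expr) : Expr := .load (addr c a)

/-- Writing an array entry. -/
def wr (c : ℕ) (a e : Expr) : Prog := .store (addr c a) e

variable {B : Base} {s : ℕ → ℕ → ℕ} {c : ℕ} {a e : Expr}

@[simp] theorem eval_scale (lam : ℝ) (m : ℕ → ℕ) (n : ℕ) (a : Expr) :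
    (scale n a).eval lam m = n * a.eval lam m := by
  induction n with
  | zero => simp [scale, Expr.eval]
  | succ n ih => simp [scale, Expr.eval, ih, Nat.succ_mul]

@[simp] theorem bits_scale (lam : ℝ) (m : ℕ → ℕ) (n : ℕ) (a : Expr) :
    (scale n a).bits lam m = n * a.bits lam m := by
  induction n with
  | zero => simp [scale, Expr.bits]
  | succ n ih => simp [scale, Expr.bits, ih, Nat.succ_mul]

theorem mem_zero : mem B s 0 = B.low 0 := by simp [mem, B.pos]

theorem mem_low {x : ℕ} (hx : x < B.low 0) : mem B s x = B.low x := by simp [mem, hx]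

theorem eval_addr : (addr c a).eval lam (mem B s) = B.low 0 + c + 11 * a.eval lam (mem B s) := by
  simp [addr, Expr.eval, mem_zero]

theorem eval_rd (hc : c < 11) :
    (rd c a).eval lam (mem B s) = s c (a.eval lam (mem B s)) := by
  rw [rd, Expr.eval, eval_addr]
  generalize a.eval lam (mem B s) = i
  have h1 : B.low 0 + c + 11 * i - B.low 0 = c + 11 * i := by omega
  have h2 : (c + 11 * i) % 11 = c := by omega
  have h3 : (c + 11 * i) / 11 = i := by omega
  rw [mem, if_neg (by omega), h1, h2, h3]

theorem sem_wr (hc : c < 11) : (wr c a e).sem lam (mem B s) =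
    mem B (upd s c (a.eval lam (mem B s)) (e.eval lam (mem B s))) := by
  rw [wr, Prog.sem, eval_addr]
  generalize a.eval lam (mem B s) = i
  generalize e.eval lam (mem B s) = x
  funext y
  rw [Function.update_apply]
  unfold mem upd
  by_cases hy : y < B.low 0
  · rw [if_neg (by omega), if_pos hy, if_pos hy]
  · rw [if_neg hy, if_neg hy]
    by_cases h : y = B.low 0 + c + 11 * i
    · rw [if_pos h, if_pos (by omega)]
    · rw [if_neg h, if_neg (by omega)]

theorem bits_rd {m : ℕ → ℕ} (h : a.bits lam m = 0) : (rd c a).bits lam m = 0 := by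
  simp [rd, addr, Expr.bits, h]

theorem bits_wr {m : ℕ → ℕ} :
    (wr c a e).bits lam m = 11 * a.bits lam m + e.bits lam m := by
  simp [wr, addr, Prog.bits, Expr.bits]

@[simp] theorem loopFree_wr : (wr c a e).LoopFree := trivial

theorem upd_self (s : ℕ → ℕ → ℕ) (c i x : ℕ) : upd s c i x c i = x := by simp [upd]

/-- The programs `p 0`, …, `p (n - 1)` one after the other. -/
def forN : ℕ → (ℕ → Prog) → Prog
  | 0, _ => .skip
  | n + 1, p => .seq (forN n p) (p n)

theorem loopFree_forN {n : ℕ} {p : ℕ → Prog} (h : ∀ i < n, (p i).LoopFree) :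
    (forN n p).LoopFree := by
  induction n with
  | zero => trivial
  | succ n ih => exact ⟨ih fun i hi => h i (by omega), h n n.lt_succ_self⟩

theorem sem_forN {n : ℕ} {p : ℕ → Prog} {m : ℕ → ℕ → ℕ}
    (h : ∀ i < n, (p i).sem lam (m i) = m (i + 1) ∧ (p i).bits lam (m i) = 0) :
    (forN n p).sem lam (m 0) = m n ∧ (forN n p).bits lam (m 0) = 0 := by
  induction n with
  | zero => exact ⟨rfl, rfl⟩
  | succ n ih =>
    have h1 := ih fun i hi => h i (by omega)
    have h2 := h n n.lt_succ_self
    exact ⟨by rw [forN, Prog.sem, h1.1, h2.1], by rw [forN, Prog.bits, h1.1, h1.2, h2.2]⟩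

end RAM

end

/-! ### Effect of a single evaluation step in each of its cases -/

section

open Finset

namespace RAM

variable {lam : ℝ} {B : Base} {s : ℕ → ℕ → ℕ}

theorem upd_apply (s : ℕ → ℕ → ℕ) (c i x c' i' : ℕ) :
    upd s c i x c' i' = if c' = c ∧ i' = i then x else s c' i' := rfl

/-- The sum of the expressions `e 0`, …, `e (n - 1)`. -/
def sumE : ℕ → (ℕ → Expr) → Expr
  | 0, _ => .lit 0
  | n + 1, e => .add (sumE n e) (e n)

theorem eval_sumE (lam : ℝ) (m : ℕ → ℕ) (n : ℕ) (e : ℕ → Expr) :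
    (sumE n e).eval lam m = ∑ i ∈ range n, (e i).eval lam m := by
  induction n with
  | zero => rfl
  | succ n ih => rw [sumE, Expr.eval, ih, Finset.sum_range_succ]

theorem bits_sumE {m : ℕ → ℕ} {n : ℕ} {e : ℕ → Expr} (h : ∀ i, (e i).bits lam m = 0) :
    (sumE n e).bits lam m = 0 := by
  induction n with
  | zero => rfl
  | succ n ih => rw [sumE, Expr.bits, ih, h]

/-! ### One step of the depth-first evaluation of the recursion

Array `0` holds registers: stack pointer, depth bound, denominator, initial ratio, and others.
Array `1` lists the vertices of the hyperedges, which are referred to by the index of their first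
vertex; arrays `2` and `3` hold the number and the list of the hyperedges at a vertex, array `4` the
marks of the deleted vertices. Arrays `5` to `10` hold the stack frames: hyperedge, parent vertex,
position in the hyperedge, position in the list of its current vertex, sum, and product. -/

/-- The stack pointer. -/
def sp : Expr := rd 0 (.lit 0)

/-- A field of the current stack frame. -/
def fld (c : ℕ) : Expr := rd c sp

/-- Increment a field of the current stack frame. -/
def incF (c : ℕ) : Prog := wr c sp (.add (fld c) (.lit 1))

/-- The current vertex. -/
def curV : Expr := rd 1 (.add (fld 5) (fld 7))

/-- The current hyperedge at the current vertex. -/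
def curE (k : ℕ) : Expr := rd 3 (.add (scale (k + 1) curV) (fld 8))

/-- The number of marked vertices of a hyperedge. -/
def marks (d : ℕ) (g : Expr) : Expr := sumE (d + 1) fun c => rd 4 (rd 1 (.add g (.lit c)))

/-- Start a stack frame for the current hyperedge at the current vertex. -/
def pushP (k : ℕ) : Prog :=
  .seq (wr 5 (.add sp (.lit 1)) (curE k)) (.seq (wr 6 (.add sp (.lit 1)) curV)
    (.seq (wr 7 (.add sp (.lit 1)) (.lit 0)) (.seq (wr 8 (.add sp (.lit 1)) (.lit 0))
      (.seq (wr 9 (.add sp (.lit 1)) (.lit 0)) (.seq (wr 10 (.add sp (.lit 1)) (rd 0 (.lit 3)))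
        (wr 0 (.lit 0) (.add sp (.lit 1))))))))

/-- Multiply the factor of the current vertex to the product. -/
def finishV : Prog :=
  .seq (wr 10 sp (.div (.mul (fld 10) (rd 0 (.lit 2))) (.add (rd 0 (.lit 2)) (fld 9))))
    (.seq (wr 9 sp (.lit 0)) (.seq (wr 8 sp (.lit 0)) (incF 7)))

/-- Remove the marks of the vertices of the current hyperedge. -/
def unmark (d : ℕ) : Prog := forN (d + 1) fun c => wr 4 (rd 1 (.add (fld 5) (.lit c))) (.lit 0)

/-- Remove the current stack frame, adding its product to the sum of the previous frame. -/
def popP (d : ℕ) : Prog :=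
  .seq (unmark d) (.seq (wr 4 (fld 6) (.lit 1))
    (.seq (wr 9 (.sub sp (.lit 1)) (.add (rd 9 (.sub sp (.lit 1))) (fld 10)))
      (.seq (wr 8 (.sub sp (.lit 1)) (.add (rd 8 (.sub sp (.lit 1))) (.lit 1)))
        (wr 0 (.lit 0) (.sub sp (.lit 1))))))

/-- One step of the evaluation. -/
def step (d k : ℕ) : Prog :=
  .branch (.sub (.lit (d + 1)) (fld 7))
    (.branch (.add (.sub curV (fld 6)) (.sub (fld 6) curV))
      (.seq (wr 4 curV (.lit 1))
        (.branch (.sub (rd 2 curV) (fld 8))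
          (.branch (.sub (rd 0 (.lit 1)) sp)
            (.branch (.sub (.lit 2) (marks d (curE k))) (pushP k) (incF 8))
            (incF 8))
          finishV))
      (incF 7))
    (popP d)

theorem loopFree_step (d k : ℕ) : (step d k).LoopFree := by
  have : (unmark d).LoopFree := loopFree_forN fun _ _ => trivial
  simp [step, popP, pushP, incF, finishV, Prog.LoopFree, this]

@[simp] theorem eval_sp : sp.eval lam (mem B s) = s 0 0 := by simp [sp, eval_rd, Expr.eval]

@[simp] theorem eval_fld {c : ℕ} (hc : c < 11) : (fld c).eval lam (mem B s) = s c (s 0 0) := by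
  simp [fld, eval_rd, hc]

@[simp] theorem eval_curV :
    curV.eval lam (mem B s) = s 1 (s 5 (s 0 0) + s 7 (s 0 0)) := by
  simp [curV, eval_rd, Expr.eval]

@[simp] theorem eval_curE (k : ℕ) : (curE k).eval lam (mem B s) =
    s 3 ((k + 1) * s 1 (s 5 (s 0 0) + s 7 (s 0 0)) + s 8 (s 0 0)) := by
  simp [curE, eval_rd, Expr.eval]

@[simp] theorem eval_marks (d : ℕ) (g : Expr) : (marks d g).eval lam (mem B s) =
    ∑ c ∈ range (d + 1), s 4 (s 1 (g.eval lam (mem B s) + c)) := by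
  simp [marks, eval_sumE, eval_rd, Expr.eval]

@[simp] theorem bits_sp {m : ℕ → ℕ} : sp.bits lam m = 0 := bits_rd rfl

@[simp] theorem bits_fld {c : ℕ} {m : ℕ → ℕ} : (fld c).bits lam m = 0 := bits_rd bits_sp

@[simp] theorem bits_curV {m : ℕ → ℕ} : curV.bits lam m = 0 := bits_rd (by simp [Expr.bits])

@[simp] theorem bits_curE {k : ℕ} {m : ℕ → ℕ} : (curE k).bits lam m = 0 :=
  bits_rd (by simp [Expr.bits])

@[simp] theorem bits_marks {d : ℕ} {g : Expr} {m : ℕ → ℕ} (h : g.bits lam m = 0) :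
    (marks d g).bits lam m = 0 :=
  bits_sumE fun _ => bits_rd (bits_rd (by simp [Expr.bits, h]))

@[simp] theorem bits_rd_lit {c i : ℕ} {m : ℕ → ℕ} : (rd c (.lit i)).bits lam m = 0 := bits_rd rfl

theorem incF_sem {c : ℕ} (hc : c < 11) : (incF c).sem lam (mem B s) =
    mem B (upd s c (s 0 0) (s c (s 0 0) + 1)) := by
  simp [incF, sem_wr, hc, Expr.eval]

@[simp] theorem bits_incF {c : ℕ} {m : ℕ → ℕ} : (incF c).bits lam m = 0 := by
  simp [incF, bits_wr, Expr.bits]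

/-- The state after a new stack frame has been started. -/
def pushState (s : ℕ → ℕ → ℕ) (g u : ℕ) : ℕ → ℕ → ℕ :=
  upd (upd (upd (upd (upd (upd (upd s 5 (s 0 0 + 1) g) 6 (s 0 0 + 1) u) 7 (s 0 0 + 1) 0)
    8 (s 0 0 + 1) 0) 9 (s 0 0 + 1) 0) 10 (s 0 0 + 1) (s 0 3)) 0 0 (s 0 0 + 1)

theorem pushP_sem (k : ℕ) : (pushP k).sem lam (mem B s) =
    mem B (pushState s (s 3 ((k + 1) * s 1 (s 5 (s 0 0) + s 7 (s 0 0)) + s 8 (s 0 0)))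
      (s 1 (s 5 (s 0 0) + s 7 (s 0 0)))) := by
  simp [pushP, pushState, Prog.sem, sem_wr, eval_rd, Expr.eval, upd_apply]

theorem bits_pushP (k : ℕ) {m : ℕ → ℕ} : (pushP k).bits lam m = 0 := by
  simp [pushP, Prog.bits, bits_wr, Expr.bits]

theorem finishV_sem : finishV.sem lam (mem B s) =
    mem B (upd (upd (upd (upd s 10 (s 0 0) (s 10 (s 0 0) * s 0 2 / (s 0 2 + s 9 (s 0 0))))
      9 (s 0 0) 0) 8 (s 0 0) 0) 7 (s 0 0) (s 7 (s 0 0) + 1)) := by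
  simp [finishV, Prog.sem, sem_wr, eval_rd, Expr.eval, upd_apply, incF_sem]

theorem bits_finishV : finishV.bits lam (mem B s) =
    Nat.size (s 10 (s 0 0)) + Nat.size (s 0 2) +
      (Nat.size (s 10 (s 0 0) * s 0 2) + Nat.size (s 0 2 + s 9 (s 0 0))) := by
  simp [finishV, Prog.bits, bits_wr, Expr.bits, eval_rd, Expr.eval]

/-- The arrays with the marks of the first `n` vertices of the hyperedge `f` removed. -/
def unmarkState (s : ℕ → ℕ → ℕ) (f n : ℕ) : ℕ → ℕ → ℕ := fun c i =>
  if c = 4 ∧ ∃ j < n, s 1 (f + j) = i then 0 else s c i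

theorem unmark_sem (d : ℕ) :
    (unmark d).sem lam (mem B s) = mem B (unmarkState s (s 5 (s 0 0)) (d + 1)) ∧
      (unmark d).bits lam (mem B s) = 0 := by
  have h0 : unmarkState s (s 5 (s 0 0)) 0 = s := by funext c i; simp [unmarkState]
  have := sem_forN (lam := lam) (n := d + 1)
    (p := fun c => wr 4 (rd 1 (.add (fld 5) (.lit c))) (.lit 0))
    (m := fun n => mem B (unmarkState s (s 5 (s 0 0)) n)) fun i _ => by
      refine ⟨?_, by simp [bits_wr, bits_rd, Expr.bits]⟩
      simp only [sem_wr (show 4 < 11 by norm_num), eval_rd (show 1 < 11 by norm_num), Expr.eval,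
        eval_fld (show 5 < 11 by norm_num)]
      congr 1
      funext c x
      simp only [upd_apply, unmarkState]
      simp only [show (0 : ℕ) ≠ 4 by norm_num, show (1 : ℕ) ≠ 4 by norm_num,
        show (5 : ℕ) ≠ 4 by norm_num, false_and, if_false]
      by_cases hc : c = 4
      · by_cases hx : x = s 1 (s 5 (s 0 0) + i)
        · rw [if_pos ⟨hc, hx⟩, if_pos ⟨hc, i, i.lt_succ_self, hx.symm⟩]
        · rw [if_neg fun h => hx h.2]
          refine if_congr (and_congr_right fun _ => ?_) rfl rfl
          have : (∃ j < i, s 1 (s 5 (s 0 0) + j) = x) ↔ ∃ j < i + 1, s 1 (s 5 (s 0 0) + j) = x := by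
            constructor
            · rintro ⟨j, hj, h⟩; exact ⟨j, by omega, h⟩
            · rintro ⟨j, hj, h⟩
              refine ⟨j, ?_, h⟩
              rcases Nat.lt_succ_iff_lt_or_eq.1 hj with h1 | rfl
              · exact h1
              · exact absurd h.symm hx
          exact this
      · simp [hc]
  rwa [h0] at this

/-- The state after the current stack frame has been removed. -/
def popState (d : ℕ) (s : ℕ → ℕ → ℕ) : ℕ → ℕ → ℕ :=
  upd (upd (upd (upd (unmarkState s (s 5 (s 0 0)) (d + 1)) 4 (s 6 (s 0 0)) 1) 9 (s 0 0 - 1)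
    (s 9 (s 0 0 - 1) + s 10 (s 0 0))) 8 (s 0 0 - 1) (s 8 (s 0 0 - 1) + 1)) 0 0 (s 0 0 - 1)

theorem unmarkState_of_ne {c : ℕ} (hc : c ≠ 4) (s : ℕ → ℕ → ℕ) (f n i : ℕ) :
    unmarkState s f n c i = s c i := by simp [unmarkState, hc]

theorem popP_sem (d : ℕ) : (popP d).sem lam (mem B s) = mem B (popState d s) := by
  simp [popP, Prog.sem, (unmark_sem d).1, sem_wr, eval_rd, Expr.eval, upd_apply, popState,
    unmarkState_of_ne]

theorem bits_popP (d : ℕ) : (popP d).bits lam (mem B s) = 0 := by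
  have h : ∀ m : ℕ → ℕ, (rd 9 (.sub sp (.lit 1))).bits lam m = 0 := fun m =>
    bits_rd (by simp [Expr.bits])
  have h' : ∀ m : ℕ → ℕ, (rd 8 (.sub sp (.lit 1))).bits lam m = 0 := fun m =>
    bits_rd (by simp [Expr.bits])
  simp [popP, Prog.bits, (unmark_sem d).2, bits_wr, Expr.bits, h, h']

theorem step_pop {d k : ℕ} (h : s 7 (s 0 0) = d + 1) :
    (step d k).sem lam (mem B s) = mem B (popState d s) ∧
      (step d k).bits lam (mem B s) = 0 := by
  constructor
  · simp [step, Prog.sem, Expr.eval, h, popP_sem]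
  · simp [step, Prog.bits, Expr.bits, Expr.eval, h, bits_popP]

theorem step_skip {d k : ℕ} (h : s 7 (s 0 0) < d + 1)
    (hu : s 1 (s 5 (s 0 0) + s 7 (s 0 0)) = s 6 (s 0 0)) :
    (step d k).sem lam (mem B s) = mem B (upd s 7 (s 0 0) (s 7 (s 0 0) + 1)) ∧
      (step d k).bits lam (mem B s) = 0 := by
  have h1 : d + 1 - s 7 (s 0 0) ≠ 0 := by omega
  constructor
  · simp [step, Prog.sem, Expr.eval, h1, hu, incF_sem]
  · simp [step, Prog.bits, Expr.bits, Expr.eval, h1, hu]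

/-- At a vertex other than the parent, every step first marks this vertex, again and again while its
hyperedges are listed. This common beginning is separated from the three cases that follow it. -/
theorem step_of_ne {d k : ℕ} (h : s 7 (s 0 0) < d + 1)
    (hu : s 1 (s 5 (s 0 0) + s 7 (s 0 0)) ≠ s 6 (s 0 0)) {s' : ℕ → ℕ → ℕ}
    (hs' : s' = upd s 4 (s 1 (s 5 (s 0 0) + s 7 (s 0 0))) 1) {p : Prog}
    (hp : p = .branch (.sub (rd 2 curV) (fld 8))
          (.branch (.sub (rd 0 (.lit 1)) sp)
            (.branch (.sub (.lit 2) (marks d (curE k))) (pushP k) (incF 8))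
            (incF 8))
          finishV) :
    (step d k).sem lam (mem B s) = p.sem lam (mem B s') ∧
      (step d k).bits lam (mem B s) = p.bits lam (mem B s') := by
  have h1 : d + 1 - s 7 (s 0 0) ≠ 0 := by omega
  have h2 : s 1 (s 5 (s 0 0) + s 7 (s 0 0)) - s 6 (s 0 0) +
    (s 6 (s 0 0) - s 1 (s 5 (s 0 0) + s 7 (s 0 0))) ≠ 0 := by omega
  subst hs' hp
  have e1 : (Expr.add (.sub curV (fld 6)) (.sub (fld 6) curV)).eval lam (mem B s) ≠ 0 := by
    simpa only [Expr.eval, eval_curV, eval_fld (show 6 < 11 by norm_num)] using h2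
  constructor
  · rw [step, Prog.sem, if_neg (by simpa [Expr.eval] using h1), Prog.sem, if_neg e1, Prog.sem,
      sem_wr (by norm_num), eval_curV, Expr.eval]
  · rw [step, Prog.bits, if_neg (by simpa [Expr.eval] using h1), Prog.bits, if_neg e1, Prog.bits,
      sem_wr (by norm_num), eval_curV, Expr.eval]
    simp [Expr.bits, bits_wr]

theorem step_finish {d k : ℕ} (h : s 7 (s 0 0) < d + 1)
    (hu : s 1 (s 5 (s 0 0) + s 7 (s 0 0)) ≠ s 6 (s 0 0)) {s' : ℕ → ℕ → ℕ}
    (hs' : s' = upd s 4 (s 1 (s 5 (s 0 0) + s 7 (s 0 0))) 1)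
    (hdeg : s 2 (s 1 (s 5 (s 0 0) + s 7 (s 0 0))) ≤ s 8 (s 0 0)) :
    (step d k).sem lam (mem B s) =
      mem B (upd (upd (upd (upd s' 10 (s 0 0) (s 10 (s 0 0) * s 0 2 / (s 0 2 + s 9 (s 0 0))))
      9 (s 0 0) 0) 8 (s 0 0) 0) 7 (s 0 0) (s 7 (s 0 0) + 1)) ∧
      (step d k).bits lam (mem B s) = Nat.size (s 10 (s 0 0)) + Nat.size (s 0 2) +
      (Nat.size (s 10 (s 0 0) * s 0 2) + Nat.size (s 0 2 + s 9 (s 0 0))) := by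
  obtain ⟨h1, h2⟩ := step_of_ne (lam := lam) (B := B) (k := k) h hu hs' rfl
  have hd : s 2 (s 1 (s 5 (s 0 0) + s 7 (s 0 0))) - s 8 (s 0 0) = 0 := by omega
  have e1 : (Expr.sub (rd 2 curV) (fld 8)).eval lam (mem B s') = 0 := by
    subst hs'
    simpa [Expr.eval, eval_rd, upd_apply] using hd
  rw [h1, h2, Prog.sem, if_pos e1, Prog.bits, if_pos e1, finishV_sem, bits_finishV]
  subst hs'
  simp [upd_apply, Expr.bits, bits_rd]

theorem step_push {d k : ℕ} (h : s 7 (s 0 0) < d + 1)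
    (hu : s 1 (s 5 (s 0 0) + s 7 (s 0 0)) ≠ s 6 (s 0 0)) {s' : ℕ → ℕ → ℕ}
    (hs' : s' = upd s 4 (s 1 (s 5 (s 0 0) + s 7 (s 0 0))) 1)
    (hdeg : s 8 (s 0 0) < s 2 (s 1 (s 5 (s 0 0) + s 7 (s 0 0)))) {g : ℕ}
    (hg : g = s 3 ((k + 1) * s 1 (s 5 (s 0 0) + s 7 (s 0 0)) + s 8 (s 0 0)))
    (hl : s 0 0 < s 0 1) (hav : ∑ c ∈ range (d + 1), s' 4 (s 1 (g + c)) < 2) :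
    (step d k).sem lam (mem B s) =
      mem B (pushState s' g (s 1 (s 5 (s 0 0) + s 7 (s 0 0)))) ∧
      (step d k).bits lam (mem B s) = 0 := by
  obtain ⟨h1, h2⟩ := step_of_ne (lam := lam) (B := B) (k := k) h hu hs' rfl
  have hne : ∀ c i, c ≠ 4 → s' c i = s c i := by
    intro c i hc; rw [hs', upd_apply, if_neg fun h => hc h.1]
  have e1 : (Expr.sub (rd 2 curV) (fld 8)).eval lam (mem B s') ≠ 0 := by
    simp [Expr.eval, eval_rd, hne]; omega
  have e2 : (Expr.sub (rd 0 (.lit 1)) sp).eval lam (mem B s') ≠ 0 := by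
    simp [Expr.eval, eval_rd, hne]; omega
  have e3 : (Expr.sub (.lit 2) (marks d (curE k))).eval lam (mem B s') ≠ 0 := by
    simp only [Expr.eval, eval_marks, eval_curE]
    simp only [hne _ _ (show (0 : ℕ) ≠ 4 by norm_num), hne _ _ (show (1 : ℕ) ≠ 4 by norm_num),
      hne _ _ (show (3 : ℕ) ≠ 4 by norm_num), hne _ _ (show (5 : ℕ) ≠ 4 by norm_num),
      hne _ _ (show (7 : ℕ) ≠ 4 by norm_num), hne _ _ (show (8 : ℕ) ≠ 4 by norm_num), ← hg]
    omega
  rw [h1, h2]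
  constructor
  · rw [Prog.sem, if_neg e1, Prog.sem, if_neg e2, Prog.sem, if_neg e3, pushP_sem]
    simp only [hne _ _ (show (0 : ℕ) ≠ 4 by norm_num), hne _ _ (show (1 : ℕ) ≠ 4 by norm_num),
      hne _ _ (show (3 : ℕ) ≠ 4 by norm_num), hne _ _ (show (5 : ℕ) ≠ 4 by norm_num),
      hne _ _ (show (7 : ℕ) ≠ 4 by norm_num), hne _ _ (show (8 : ℕ) ≠ 4 by norm_num), ← hg]
  · rw [Prog.bits, if_neg e1, Prog.bits, if_neg e2, Prog.bits, if_neg e3, bits_pushP]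
    simp [Expr.bits, bits_rd]

theorem step_next {d k : ℕ} (h : s 7 (s 0 0) < d + 1)
    (hu : s 1 (s 5 (s 0 0) + s 7 (s 0 0)) ≠ s 6 (s 0 0)) {s' : ℕ → ℕ → ℕ}
    (hs' : s' = upd s 4 (s 1 (s 5 (s 0 0) + s 7 (s 0 0))) 1)
    (hdeg : s 8 (s 0 0) < s 2 (s 1 (s 5 (s 0 0) + s 7 (s 0 0)))) {g : ℕ}
    (hg : g = s 3 ((k + 1) * s 1 (s 5 (s 0 0) + s 7 (s 0 0)) + s 8 (s 0 0)))
    (hl : s 0 1 ≤ s 0 0 ∨ 2 ≤ ∑ c ∈ range (d + 1), s' 4 (s 1 (g + c))) :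
    (step d k).sem lam (mem B s) = mem B (upd s' 8 (s 0 0) (s 8 (s 0 0) + 1)) ∧
      (step d k).bits lam (mem B s) = 0 := by
  obtain ⟨h1, h2⟩ := step_of_ne (lam := lam) (B := B) (k := k) h hu hs' rfl
  have hne : ∀ c i, c ≠ 4 → s' c i = s c i := by
    intro c i hc; rw [hs', upd_apply, if_neg fun h => hc h.1]
  have e1 : (Expr.sub (rd 2 curV) (fld 8)).eval lam (mem B s') ≠ 0 := by
    simp [Expr.eval, eval_rd, hne]; omega
  have e4 : (incF 8).sem lam (mem B s') = mem B (upd s' 8 (s 0 0) (s 8 (s 0 0) + 1)) := by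
    rw [incF_sem (by norm_num), hne _ _ (by norm_num), hne _ _ (by norm_num)]
  rw [h1, h2, Prog.sem, if_neg e1, Prog.bits, if_neg e1, Prog.sem, Prog.bits]
  by_cases e2 : (Expr.sub (rd 0 (.lit 1)) sp).eval lam (mem B s') = 0
  · rw [if_pos e2, if_pos e2]
    exact ⟨e4, by simp [Expr.bits, bits_rd]⟩
  · rw [if_neg e2, if_neg e2]
    have e3 : (Expr.sub (.lit 2) (marks d (curE k))).eval lam (mem B s') = 0 := by
      simp [Expr.eval, eval_rd, hne] at e2
      simp only [Expr.eval, eval_marks, eval_curE]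
      simp only [hne _ _ (show (0 : ℕ) ≠ 4 by norm_num), hne _ _ (show (1 : ℕ) ≠ 4 by norm_num),
        hne _ _ (show (3 : ℕ) ≠ 4 by norm_num), hne _ _ (show (5 : ℕ) ≠ 4 by norm_num),
        hne _ _ (show (7 : ℕ) ≠ 4 by norm_num), hne _ _ (show (8 : ℕ) ≠ 4 by norm_num), ← hg]
      omega
    rw [Prog.sem, if_pos e3, Prog.bits, if_pos e3]
    exact ⟨e4, by simp [Expr.bits, bits_rd]⟩

end RAM

end

/-! ### Correctness and step count of the depth-first evaluation -/

section

open Finset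

namespace RAM

section Functions

variable (VT DEG INC : ℕ → ℕ) (Λ D d k : ℕ)

/-- The vertices in `K` and the first `j` vertices of the hyperedge `f`. -/
def seen (K : Finset ℕ) (f j : ℕ) : Finset ℕ := K ∪ (range j).image fun i => VT (f + i)

/-- The number of vertices of the hyperedge `g` that lie in `K`. -/
def markCount (K : Finset ℕ) (g : ℕ) : ℕ := ∑ c ∈ range (d + 1), if VT (g + c) ∈ K then 1 else 0

/-- The product of the rounded factors of the first `j` vertices of `f`, except for the parent
vertex `p`, where `cs` gives the sum at a vertex. -/
def foldR (cs : Finset ℕ → ℕ → ℕ) (K : Finset ℕ) (p f : ℕ) : ℕ → ℕ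
  | 0 => Λ
  | j + 1 => if VT (f + j) = p then foldR cs K p f j else
      foldR cs K p f j * D / (D + cs (seen VT K f (j + 1)) (VT (f + j)))

/-- The sum of the rounded ratios at the vertex `u`, computed to depth `ℓ`. -/
def csum : ℕ → Finset ℕ → ℕ → ℕ
  | 0 => fun _ _ => 0
  | ℓ + 1 => fun K u => ∑ i ∈ range (DEG u),
      if markCount VT d K (INC ((k + 1) * u + i)) < 2 then
        foldR VT Λ D (csum ℓ) K u (INC ((k + 1) * u + i)) (d + 1) else 0

/-- The number of steps for the first `n` vertices of `f`, where `ts` gives the number of steps at a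
vertex. -/
def foldT (ts : Finset ℕ → ℕ → ℕ) (K : Finset ℕ) (p f n : ℕ) : ℕ :=
  ∑ j ∈ range n, if VT (f + j) = p then 1 else 1 + ts (seen VT K f (j + 1)) (VT (f + j))

/-- The number of steps for the hyperedges at the vertex `u`. -/
def tsum : ℕ → Finset ℕ → ℕ → ℕ
  | 0 => fun _ u => DEG u
  | ℓ + 1 => fun K u => ∑ i ∈ range (DEG u),
      (1 + if markCount VT d K (INC ((k + 1) * u + i)) < 2 then
        1 + foldT VT (tsum ℓ) K u (INC ((k + 1) * u + i)) (d + 1) else 0)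

/-- The contribution of one hyperedge to the sum at a vertex. -/
def childVal (ℓ : ℕ) (K : Finset ℕ) (u i : ℕ) : ℕ :=
  match ℓ with
  | 0 => 0
  | ℓ + 1 => if markCount VT d K (INC ((k + 1) * u + i)) < 2 then
        foldR VT Λ D (csum VT DEG INC Λ D d k ℓ) K u (INC ((k + 1) * u + i)) (d + 1) else 0

/-- The number of steps for one hyperedge at a vertex. -/
def childTime (ℓ : ℕ) (K : Finset ℕ) (u i : ℕ) : ℕ :=
  match ℓ with
  | 0 => 1
  | ℓ + 1 => 1 + if markCount VT d K (INC ((k + 1) * u + i)) < 2 then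
        1 + foldT VT (tsum VT DEG INC d k ℓ) K u (INC ((k + 1) * u + i)) (d + 1) else 0

theorem csum_eq (ℓ : ℕ) (K : Finset ℕ) (u : ℕ) : csum VT DEG INC Λ D d k ℓ K u =
    ∑ i ∈ range (DEG u), childVal VT DEG INC Λ D d k ℓ K u i := by
  cases ℓ <;> simp [csum, childVal]

theorem tsum_eq (ℓ : ℕ) (K : Finset ℕ) (u : ℕ) : tsum VT DEG INC d k ℓ K u =
    ∑ i ∈ range (DEG u), childTime VT DEG INC d k ℓ K u i := by
  cases ℓ <;> simp [tsum, childTime]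

theorem foldR_le (cs : Finset ℕ → ℕ → ℕ) (K : Finset ℕ) (p f j : ℕ) :
    foldR VT Λ D cs K p f j ≤ Λ := by
  induction j with
  | zero => exact le_rfl
  | succ j ih =>
    rw [foldR]
    split_ifs
    · exact ih
    · refine (Nat.div_le_of_le_mul ?_).trans ih
      rw [mul_comm]; gcongr; omega

/-- A size bound for the operands, so that the bit lengths charged per step are bounded
independently of the depth. -/
theorem csum_le {u : ℕ} (hdeg : DEG u ≤ k + 1) (ℓ : ℕ) (K : Finset ℕ) :
    csum VT DEG INC Λ D d k ℓ K u ≤ (k + 1) * Λ := by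
  rw [csum_eq]
  refine (Finset.sum_le_card_nsmul _ _ Λ fun i _ => ?_).trans ?_
  · cases ℓ with
    | zero => simp [childVal]
    | succ ℓ =>
      rw [childVal]
      split_ifs
      · exact foldR_le ..
      · exact Nat.zero_le _
  · rw [card_range, smul_eq_mul]; gcongr

theorem seen_succ (K : Finset ℕ) (f j : ℕ) :
    seen VT K f (j + 1) = insert (VT (f + j)) (seen VT K f j) := by
  simp [seen, range_add_one, image_insert]

/-- The vertex u lies on g and is itself marked, so fewer than two marks means that u is the only
one. This is how the test in `step` recognizes an available hyperedge, and it provides the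
hypothesis on the parent vertex for the nested call. -/
theorem eq_of_markCount_lt {K : Finset ℕ} {g u : ℕ} (h : markCount VT d K g < 2) (hu : u ∈ K)
    (hg : ∃ c ≤ d, VT (g + c) = u) {j : ℕ} (hj : j ≤ d) (hjK : VT (g + j) ∈ K) :
    VT (g + j) = u := by
  obtain ⟨c, hc, hcu⟩ := hg
  by_contra hne
  have hcj : c ≠ j := fun h => hne (h ▸ hcu)
  have hsub : ({c, j} : Finset ℕ) ⊆ range (d + 1) := by
    intro x hx
    rcases Finset.mem_insert.1 hx with rfl | hx
    · simp; omega
    · rw [Finset.mem_singleton.1 hx]; simp; omega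
  have := Finset.sum_le_sum_of_subset (f := fun c => if VT (g + c) ∈ K then 1 else 0) hsub
  rw [Finset.sum_pair hcj, hcu, if_pos hu, if_pos hjK] at this
  exact absurd h (not_lt.2 this)

end Functions

variable {lam : ℝ} {B : Base} {VT DEG INC : ℕ → ℕ} {Λ D d k β : ℕ}

/-- The arrays and registers that are constant during the evaluation. -/
def Static (VT DEG INC : ℕ → ℕ) (Λ D : ℕ) (s : ℕ → ℕ → ℕ) : Prop :=
  s 1 = VT ∧ s 2 = DEG ∧ s 3 = INC ∧ s 0 2 = D ∧ s 0 3 = Λ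

/-- The marked vertices are those in `K`. -/
def Marked (K : Finset ℕ) (s : ℕ → ℕ → ℕ) : Prop := ∀ v, s 4 v = if v ∈ K then 1 else 0

/-- The contents of the stack frame `l`. -/
def Frame (s : ℕ → ℕ → ℕ) (l f p j i S P : ℕ) : Prop :=
  s 5 l = f ∧ s 6 l = p ∧ s 7 l = j ∧ s 8 l = i ∧ s 9 l = S ∧ s 10 l = P

/-- Everything except for the marks and the stack from frame `l` on agrees. -/
def AgreeBelow (l : ℕ) (s s' : ℕ → ℕ → ℕ) : Prop :=
  ∀ c x, c ≠ 4 → (5 ≤ c → x < l) → s' c x = s c x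

/-- The evaluation of a stack frame with depth `ℓ` left computes `foldR` in `foldT` steps. -/
def CallSpec (lam : ℝ) (B : Base) (VT DEG INC : ℕ → ℕ) (Λ D d k β ℓ : ℕ) : Prop :=
  ∀ (s : ℕ → ℕ → ℕ) (l : ℕ) (K : Finset ℕ) (p f : ℕ), s 0 0 = l → 1 ≤ l → l + ℓ = s 0 1 →
    Static VT DEG INC Λ D s → Marked K s → p ∈ K →
    (∀ j ≤ d, VT (f + j) ∈ K → VT (f + j) = p) → Frame s l f p 0 0 0 Λ →
    ∃ s', Path lam sp (step d k) β
      (1 + foldT VT (tsum VT DEG INC d k ℓ) K p f (d + 1)) (mem B s) (mem B s') ∧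
      ∀ c x, (5 ≤ c → x < l) → s' c x = upd (upd (upd s 0 0 (l - 1)) 8 (l - 1)
        (s 8 (l - 1) + 1)) 9 (l - 1)
        (s 9 (l - 1) + foldR VT Λ D (csum VT DEG INC Λ D d k ℓ) K p f (d + 1)) c x

theorem static_of_agreeBelow {l : ℕ} {s s' : ℕ → ℕ → ℕ} (h : AgreeBelow l s s')
    (hs : Static VT DEG INC Λ D s) : Static VT DEG INC Λ D s' := by
  obtain ⟨h1, h2, h3, h4, h5⟩ := hs
  refine ⟨?_, ?_, ?_, ?_, ?_⟩
  · rw [← h1]; funext x; exact h 1 x (by norm_num) (by norm_num)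
  · rw [← h2]; funext x; exact h 2 x (by norm_num) (by norm_num)
  · rw [← h3]; funext x; exact h 3 x (by norm_num) (by norm_num)
  · rw [← h4]; exact h 0 2 (by norm_num) (by norm_num)
  · rw [← h5]; exact h 0 3 (by norm_num) (by norm_num)

theorem size_le_self (n : ℕ) : Nat.size n ≤ n := Nat.size_le.2 Nat.lt_two_pow_self

theorem path_step {s s' : ℕ → ℕ → ℕ} (h0 : s 0 0 ≠ 0)
    (h : (step d k).sem lam (mem B s) = mem B s' ∧ (step d k).bits lam (mem B s) = 0) :
    Path lam sp (step d k) ((step d k).wt + β) 1 (mem B s) (mem B s') :=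
  .single (by rwa [eval_sp]) (runs_of_sem (loopFree_step d k) h.1 (h.2.trans_le (Nat.zero_le _)))

theorem upd_of_not {s : ℕ → ℕ → ℕ} {c i x c' i' : ℕ} (h : ¬ (c' = c ∧ i' = i)) :
    upd s c i x c' i' = s c' i' := if_neg h

theorem pushState_of_lt {s : ℕ → ℕ → ℕ} {g u c x : ℕ} (h5 : 5 ≤ c → x < s 0 0 + 1)
    (h0 : c = 0 → x ≠ 0) : pushState s g u c x = s c x := by
  rw [pushState, upd_of_not (by omega), upd_of_not (by omega), upd_of_not (by omega),
    upd_of_not (by omega), upd_of_not (by omega), upd_of_not (by omega), upd_of_not (by omega)]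

theorem AgreeBelow.upd {l c i x : ℕ} {s s' : ℕ → ℕ → ℕ} (h : AgreeBelow l s s')
    (hc : c ≠ 4 → 5 ≤ c ∧ l ≤ i) : AgreeBelow l s (upd s' c i x) := by
  intro c' i' hc' hi'
  rw [upd_of_not (by omega)]
  exact h c' i' hc' hi'

theorem Marked.upd {K : Finset ℕ} {c i x : ℕ} {s : ℕ → ℕ → ℕ} (h : Marked K s)
    (hc : c ≠ 4) : Marked K (upd s c i x) := fun v => by
  rw [upd_of_not (by omega)]; exact h v

theorem frame_upd_iff {c i x l f p j n S P : ℕ} {s : ℕ → ℕ → ℕ} (hc : c < 5) :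
    Frame (upd s c i x) l f p j n S P ↔ Frame s l f p j n S P := by
  simp only [Frame]
  rw [upd_of_not (by omega), upd_of_not (by omega), upd_of_not (by omega), upd_of_not (by omega),
    upd_of_not (by omega), upd_of_not (by omega)]

theorem push_path {ℓ : ℕ} (hcall : CallSpec lam B VT DEG INC Λ D d k β ℓ)
    {s1 : ℕ → ℕ → ℕ} {l f p j u g i S P : ℕ} {K : Finset ℕ} (h0 : s1 0 0 = l)
    (hl : 1 ≤ l) (hlℓ : l + (ℓ + 1) = s1 0 1) (hst : Static VT DEG INC Λ D s1) (huK : u ∈ K)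
    (hfr : Frame s1 l f p j i S P) (hmk : Marked K s1)
    (hg : ∀ j ≤ d, VT (g + j) ∈ K → VT (g + j) = u) :
    ∃ s2, Path lam sp (step d k) β (1 + foldT VT (tsum VT DEG INC d k ℓ) K u g (d + 1))
        (mem B (pushState s1 g u)) (mem B s2) ∧
      AgreeBelow l s1 s2 ∧ Marked K s2 ∧ Frame s2 l f p j (i + 1)
        (S + foldR VT Λ D (csum VT DEG INC Λ D d k ℓ) K u g (d + 1)) P := by
  obtain ⟨t1, t2, t3, t4, t5⟩ := hst
  obtain ⟨f5, f6, f7, f8, f9, f10⟩ := hfr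
  obtain ⟨s2, p2, hs2⟩ := hcall (pushState s1 g u) (l + 1) K u g
    (by simp [pushState, upd_apply, h0]) (by omega)
    (by rw [pushState_of_lt (by omega) (by omega)]; omega)
    (by
      refine ⟨?_, ?_, ?_, ?_, ?_⟩
      · rw [← t1]; funext x; rw [pushState_of_lt (by omega) (by omega)]
      · rw [← t2]; funext x; rw [pushState_of_lt (by omega) (by omega)]
      · rw [← t3]; funext x; rw [pushState_of_lt (by omega) (by omega)]
      · rw [← t4, pushState_of_lt (by omega) (by omega)]
      · rw [← t5, pushState_of_lt (by omega) (by omega)])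
    (fun v => by rw [pushState_of_lt (by omega) (by omega)]; exact hmk v) huK hg
    (by simp [Frame, pushState, upd_apply, h0, t5])
  rw [Nat.add_sub_cancel, pushState_of_lt (by omega) (by omega),
    pushState_of_lt (by omega) (by omega)] at hs2
  refine ⟨s2, p2, ?_, ?_, ?_, ?_, ?_, ?_, ?_, ?_⟩
  · intro c x hc hx
    rw [hs2 c x (by omega), upd_of_not (by omega), upd_of_not (by omega)]
    by_cases h00 : c = 0 ∧ x = 0
    · obtain ⟨rfl, rfl⟩ := h00
      rw [upd_self, h0]
    · rw [upd_of_not h00, pushState_of_lt (by omega) (by omega)]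
  · intro v
    rw [hs2 4 v (by omega), upd_of_not (by omega), upd_of_not (by omega), upd_of_not (by omega),
      pushState_of_lt (by omega) (by omega)]
    exact hmk v
  · rw [hs2 5 l (by omega), upd_of_not (by omega), upd_of_not (by omega), upd_of_not (by omega),
      pushState_of_lt (by omega) (by omega), f5]
  · rw [hs2 6 l (by omega), upd_of_not (by omega), upd_of_not (by omega), upd_of_not (by omega),
      pushState_of_lt (by omega) (by omega), f6]
  · rw [hs2 7 l (by omega), upd_of_not (by omega), upd_of_not (by omega), upd_of_not (by omega),
      pushState_of_lt (by omega) (by omega), f7]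
  · rw [hs2 8 l (by omega), upd_of_not (by omega), upd_self, f8]
  · rw [hs2 9 l (by omega), upd_self, f9]
  · rw [hs2 10 l (by omega), upd_of_not (by omega), upd_of_not (by omega), upd_of_not (by omega),
      pushState_of_lt (by omega) (by omega), f10]

/-- The marks are those of K only after u has been marked: before the first hyperedge at u its mark
may still be missing, and the step itself sets it. The nested call is assumed only at the
predecessor depth; at depth 0 every hyperedge is skipped. -/
theorem child_path {ℓ : ℕ} (hinc : ∀ u i, i < DEG u → ∃ c ≤ d, VT (INC ((k + 1) * u + i) + c) = u)
    (hcall : ∀ ℓ', ℓ = ℓ' + 1 →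
      CallSpec lam B VT DEG INC Λ D d k ((step d k).wt + β) ℓ')
    {s : ℕ → ℕ → ℕ} {l f p j u i S P : ℕ} {K : Finset ℕ} (h0 : s 0 0 = l) (hl : 1 ≤ l)
    (hlℓ : l + ℓ = s 0 1) (hst : Static VT DEG INC Λ D s) (hj : j < d + 1)
    (hu : u = VT (f + j)) (hup : u ≠ p) (huK : u ∈ K) (hi : i < DEG u)
    (hfr : Frame s l f p j i S P) (hmk : Marked K (upd s 4 u 1)) :
    ∃ s', Path lam sp (step d k) ((step d k).wt + β)
      (childTime VT DEG INC d k ℓ K u i) (mem B s) (mem B s') ∧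
      AgreeBelow l s s' ∧ Marked K s' ∧
      Frame s' l f p j (i + 1) (S + childVal VT DEG INC Λ D d k ℓ K u i) P := by
  have hfr' := hfr
  obtain ⟨f5, f6, f7, f8, f9, f10⟩ := hfr
  have hst' := hst
  obtain ⟨t1, t2, t3, t4, t5⟩ := hst
  have hcur : s 1 (s 5 (s 0 0) + s 7 (s 0 0)) = u := by rw [h0, f5, f7, t1, hu]
  have hcount : ∑ c ∈ range (d + 1), (upd s 4 u 1) 4 (s 1 (INC ((k + 1) * u + i) + c)) =
      markCount VT d K (INC ((k + 1) * u + i)) := by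
    rw [markCount]
    exact Finset.sum_congr rfl fun c _ => by rw [hmk, t1]
  have hag : AgreeBelow l s (upd s 4 u 1) :=
    AgreeBelow.upd (fun _ _ _ _ => rfl) (fun h => absurd rfl h)
  by_cases hpush : l < s 0 1 ∧ markCount VT d K (INC ((k + 1) * u + i)) < 2
  · obtain ⟨ℓ', rfl⟩ : ∃ ℓ', ℓ = ℓ' + 1 := ⟨ℓ - 1, by omega⟩
    have e1 := step_push (lam := lam) (B := B) (d := d) (k := k) (s := s)
      (by rw [h0, f7]; exact hj) (by rw [hcur, h0, f6]; exact hup) rfl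
      (by rw [hcur, h0, f8, t2]; exact hi) rfl (by rw [h0]; exact hpush.1)
      (by rw [hcur, h0, f8, t3, hcount]; exact hpush.2)
    rw [hcur, h0, f8, t3] at e1
    obtain ⟨s2, p2, h1, h2, h3⟩ := push_path (hcall ℓ' rfl) (s1 := upd s 4 u 1)
      (by rw [upd_of_not (by omega), h0]) hl (by rw [upd_of_not (by omega), hlℓ])
      (static_of_agreeBelow hag hst') huK ((frame_upd_iff (by norm_num)).2 hfr') hmk
      (fun x hx hxK => eq_of_markCount_lt VT d hpush.2 huK (hinc u i hi) hx hxK)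
    refine ⟨s2, ?_, fun c x hc hx => (h1 c x hc hx).trans (hag c x hc hx), h2, ?_⟩
    · rw [childTime, if_pos hpush.2]
      exact (path_step (by omega) e1).trans p2
    · rwa [childVal, if_pos hpush.2]
  · have hchild : childVal VT DEG INC Λ D d k ℓ K u i = 0 ∧
        childTime VT DEG INC d k ℓ K u i = 1 := by
      cases ℓ with
      | zero => exact ⟨rfl, rfl⟩
      | succ ℓ =>
        have : ¬ markCount VT d K (INC ((k + 1) * u + i)) < 2 := fun h => hpush ⟨by omega, h⟩
        rw [childVal, childTime, if_neg this, if_neg this]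
        exact ⟨rfl, rfl⟩
    have e1 := step_next (lam := lam) (B := B) (d := d) (k := k) (s := s)
      (by rw [h0, f7]; exact hj) (by rw [hcur, h0, f6]; exact hup) rfl
      (by rw [hcur, h0, f8, t2]; exact hi) rfl
      (by rw [hcur, h0, f8, t3, hcount]; omega)
    rw [hcur, h0, f8] at e1
    rw [hchild.1, hchild.2]
    refine ⟨_, path_step (by omega) e1, hag.upd (by omega), hmk.upd (by omega), ?_⟩
    simp [Frame, upd_apply, f5, f6, f7, f9, f10]

theorem finish_path (hβ : Λ + D + (Λ * D + (D + (k + 1) * Λ)) ≤ β)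
    {s : ℕ → ℕ → ℕ} {l f p j u S P : ℕ} {K : Finset ℕ} (h0 : s 0 0 = l) (hl : 1 ≤ l)
    (hst : Static VT DEG INC Λ D s) (hj : j < d + 1)
    (hu : u = VT (f + j)) (hup : u ≠ p) 
    (hfr : Frame s l f p j (DEG u) S P) (hmk : Marked K (upd s 4 u 1)) (hP : P ≤ Λ)
    (hS : S ≤ (k + 1) * Λ) :
    ∃ s', Path lam sp (step d k) ((step d k).wt + β) 1 (mem B s) (mem B s') ∧
      AgreeBelow l s s' ∧ Marked K s' ∧ Frame s' l f p (j + 1) 0 0 (P * D / (D + S)) := by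
  obtain ⟨f5, f6, f7, f8, f9, f10⟩ := hfr
  obtain ⟨t1, t2, t3, t4, t5⟩ := hst
  have hcur : s 1 (s 5 (s 0 0) + s 7 (s 0 0)) = u := by rw [h0, f5, f7, t1, hu]
  obtain ⟨e1, e2⟩ := step_finish (lam := lam) (B := B) (d := d) (k := k) (s := s)
    (by rw [h0, f7]; exact hj) (by rw [hcur, h0, f6]; exact hup) rfl
    (by rw [hcur, h0, f8, t2])
  rw [hcur, h0, t4, f7, f9, f10] at e1
  rw [h0, t4, f9, f10] at e2
  refine ⟨_, .single (by rw [eval_sp, h0]; omega)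
    (runs_of_sem (loopFree_step d k) e1 ?_), ?_, ?_, ?_⟩
  · rw [e2]
    have b1 := size_le_self P
    have b2 := size_le_self D
    have b3 := size_le_self (P * D)
    have b4 := size_le_self (D + S)
    have b5 : P * D ≤ Λ * D := by gcongr
    omega
  · exact (((((AgreeBelow.upd (fun _ _ _ _ => rfl) (fun h => absurd rfl h)).upd
      (by omega)).upd (by omega)).upd (by omega)).upd (by omega))
  · exact (((hmk.upd (by omega)).upd (by omega)).upd (by omega)).upd (by omega)
  · simp [Frame, upd_apply, f5, f6]

/-- Induction on the number of hyperedges left at the vertex. The bound `hS` concerns the sum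
gathered so far plus everything still to come, so it survives each round and finally bounds the
divisor. -/
theorem vertex_path {ℓ : ℕ} (hinc : ∀ u i, i < DEG u → ∃ c ≤ d, VT (INC ((k + 1) * u + i) + c) = u)
    (hβ : Λ + D + (Λ * D + (D + (k + 1) * Λ)) ≤ β)
    (hcall : ∀ ℓ', ℓ = ℓ' + 1 →
      CallSpec lam B VT DEG INC Λ D d k ((step d k).wt + β) ℓ')
    {l f p j u : ℕ} {K : Finset ℕ} (hl : 1 ≤ l) (hj : j < d + 1)
    (hu : u = VT (f + j)) (hup : u ≠ p) (huK : u ∈ K) (n : ℕ) {s : ℕ → ℕ → ℕ} {i S P : ℕ}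
    (h0 : s 0 0 = l) (hlℓ : l + ℓ = s 0 1) (hst : Static VT DEG INC Λ D s)
    (hn : i + n = DEG u) (hfr : Frame s l f p j i S P)
    (hmk : Marked K (upd s 4 u 1)) (hP : P ≤ Λ)
    (hS : S + ∑ x ∈ Ico i (DEG u), childVal VT DEG INC Λ D d k ℓ K u x ≤ (k + 1) * Λ) :
    ∃ s', Path lam sp (step d k) ((step d k).wt + β)
      (∑ x ∈ Ico i (DEG u), childTime VT DEG INC d k ℓ K u x + 1) (mem B s) (mem B s') ∧
      AgreeBelow l s s' ∧ Marked K s' ∧ Frame s' l f p (j + 1) 0 0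
        (P * D / (D + (S + ∑ x ∈ Ico i (DEG u), childVal VT DEG INC Λ D d k ℓ K u x))) := by
  induction n generalizing s i S with
  | zero =>
    obtain rfl : i = DEG u := by omega
    rw [Ico_self, sum_empty, add_zero] at hS
    rw [Ico_self, sum_empty, zero_add, sum_empty, add_zero]
    exact finish_path hβ h0 hl hst hj hu hup hfr hmk hP hS
  | succ n ih =>
    have hi : i < DEG u := by omega
    have hsplit : ∀ F : ℕ → ℕ, ∑ x ∈ Ico i (DEG u), F x = F i + ∑ x ∈ Ico (i + 1) (DEG u), F x :=
      fun F => Finset.sum_eq_sum_Ico_succ_bot hi F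
    obtain ⟨s1, p1, a1, m1, f1⟩ :=
      child_path hinc hcall h0 hl hlℓ hst hj hu hup huK hi hfr hmk
    rw [hsplit, ← add_assoc] at hS
    obtain ⟨s2, p2, a2, m2, f2⟩ := ih (s := s1) (i := i + 1)
      (by rw [a1 0 0 (by norm_num) (by norm_num), h0])
      (by rw [a1 0 1 (by norm_num) (by norm_num), hlℓ]) (static_of_agreeBelow a1 hst) (by omega) f1
      (fun v => by
        rw [upd_apply]
        split_ifs with h h' h'
        · rfl
        · exact absurd (h.2 ▸ huK) h'
        · rw [m1 v, if_pos h']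
        · rw [m1 v, if_neg h'])
      hS
    refine ⟨s2, ?_, fun c x hc hx => (a2 c x hc hx).trans (a1 c x hc hx), m2, ?_⟩
    · rw [hsplit, add_assoc]; exact p1.trans p2
    · rw [hsplit, ← add_assoc S]; exact f2

/-- Outer induction on the remaining depth, inner induction on the number of processed vertices of
f. The parent vertex is skipped in one step; every other vertex runs its nested calls and one
multiplication with rounding. -/
theorem callSpec (hdeg : ∀ u, DEG u ≤ k + 1)
    (hinc : ∀ u i, i < DEG u → ∃ c ≤ d, VT (INC ((k + 1) * u + i) + c) = u)
    (hβ : Λ + D + (Λ * D + (D + (k + 1) * Λ)) ≤ β) (ℓ : ℕ) :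
    CallSpec lam B VT DEG INC Λ D d k ((step d k).wt + β) ℓ := by
  induction ℓ using Nat.strong_induction_on with
  | _ ℓ IH =>
  intro s l K p f h0 hl hlℓ hst hmk hp hfK hfr
  have key : ∀ j ≤ d + 1, ∃ s', Path lam sp (step d k) ((step d k).wt + β)
      (foldT VT (tsum VT DEG INC d k ℓ) K p f j) (mem B s) (mem B s') ∧
      AgreeBelow l s s' ∧ Marked (seen VT K f j) s' ∧ Frame s' l f p j 0 0
        (foldR VT Λ D (csum VT DEG INC Λ D d k ℓ) K p f j) := by
    intro j
    induction j with
    | zero =>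
      intro _
      exact ⟨s, by simpa [foldT] using .nil _, fun _ _ _ _ => rfl, by simpa [seen] using hmk, hfr⟩
    | succ j ih =>
      intro hj
      obtain ⟨s1, p1, hag, hm1, hf1⟩ := ih (by omega)
      obtain ⟨f5, f6, f7, f8, f9, f10⟩ := hf1
      have hs00 : s1 0 0 = l := by rw [hag 0 0 (by norm_num) (by norm_num), h0]
      obtain ⟨t1, t2, t3, t4, t5⟩ := static_of_agreeBelow hag hst
      have hcur : s1 1 (s1 5 (s1 0 0) + s1 7 (s1 0 0)) = VT (f + j) := by rw [hs00, f5, f7, t1]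
      by_cases hup : VT (f + j) = p
      · have e1 := step_skip (lam := lam) (B := B) (d := d) (k := k) (s := s1)
          (by rw [hs00, f7]; omega) (by rw [hcur, hs00, f6]; exact hup)
        rw [hs00, f7] at e1
        refine ⟨upd s1 7 l (j + 1), ?_, ?_, ?_, ?_⟩
        · rw [foldT, sum_range_succ, if_pos hup]
          exact p1.trans (path_step (by omega) e1)
        · intro c x hc hx
          rw [← hag c x hc hx]
          simp only [upd_apply]
          split_ifs <;> first | rfl | omega
        · intro v
          have : seen VT K f (j + 1) = seen VT K f j := by
            rw [seen_succ, hup]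
            exact Finset.insert_eq_self.2 (Finset.mem_union_left _ hp)
          rw [this, ← hm1 v]
          simp [upd_apply]
        · rw [foldR, if_pos hup]
          simp [Frame, upd_apply, f5, f6, f8, f9, f10]
      · have hcs := csum_le VT DEG INC Λ D d k (hdeg (VT (f + j))) ℓ (seen VT K f (j + 1))
        rw [csum_eq, ← Nat.Ico_zero_eq_range] at hcs
        obtain ⟨s2, p2, hag2, hm2, hf2⟩ := vertex_path (lam := lam) (B := B) (ℓ := ℓ)
          (K := seen VT K f (j + 1)) (i := 0) (S := 0) (s := s1)
          hinc hβ (fun ℓ' hℓ' => IH ℓ' (by omega)) hl (j := j) (by omega) rfl hup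
          (by rw [seen_succ]; exact Finset.mem_insert_self _ _) (DEG (VT (f + j)))
          (by rw [hag 0 0 (by norm_num) (by norm_num), h0])
          (by rw [hag 0 1 (by norm_num) (by norm_num), hlℓ]) (static_of_agreeBelow hag hst)
          (by omega) ⟨f5, f6, f7, f8, f9, f10⟩
          (by
            intro v
            have h1 := hm1 v
            rw [seen_succ, upd_apply, h1]
            simp only [Finset.mem_insert, true_and]
            by_cases h2 : v = VT (f + j) <;> simp [h2])
          (foldR_le ..) (by rw [zero_add]; exact hcs)
        rw [Nat.Ico_zero_eq_range] at p2 hf2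
        refine ⟨s2, ?_, fun c x hc hx => (hag2 c x hc hx).trans (hag c x hc hx), hm2, ?_⟩
        · rw [foldT, sum_range_succ, if_neg hup, tsum_eq, add_comm 1]
          exact p1.trans p2
        · rw [foldR, if_neg hup, csum_eq]
          rwa [zero_add] at hf2
  obtain ⟨s1, p1, hag, hm1, f5, f6, f7, f8, f9, f10⟩ := key (d + 1) le_rfl
  have hs00 : s1 0 0 = l := by rw [hag 0 0 (by norm_num) (by norm_num), h0]
  obtain ⟨t1, t2, t3, t4, t5⟩ := static_of_agreeBelow hag hst
  have e1 := step_pop (lam := lam) (B := B) (d := d) (k := k) (s := s1) (by rw [hs00, f7])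
  refine ⟨popState d s1, ?_, ?_⟩
  · rw [add_comm 1]
    exact p1.trans (path_step (by omega) e1)
  · intro c x hx
    -- Popping clears the marks of all vertices of f and sets that of p again. Since p is the only
    -- vertex of f that can lie in K, this restores exactly the marks of the caller.
    by_cases hc : c = 4
    · subst hc
      have hun : unmarkState s1 f (d + 1) 4 x = if ∃ j < d + 1, VT (f + j) = x then 0
          else if x ∈ K then 1 else 0 := by
        simp only [unmarkState, true_and, t1]
        by_cases h1 : ∃ j < d + 1, VT (f + j) = x
        · simp only [if_pos h1]
        · have h2 : x ∈ seen VT K f (d + 1) ↔ x ∈ K := by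
            simp only [seen, Finset.mem_union, Finset.mem_image, Finset.mem_range]
            exact or_iff_left h1
          simp only [if_neg h1, hm1 x, h2]
      have hgoal : popState d s1 4 x = s 4 x := by
        simp only [popState, upd_apply, hs00, f5, f6]
        simp only [show (4 : ℕ) ≠ 0 by norm_num, show (4 : ℕ) ≠ 8 by norm_num,
          show (4 : ℕ) ≠ 9 by norm_num, false_and, if_false, true_and]
        rw [hmk x, hun]
        by_cases hxp : x = p
        · rw [if_pos hxp, if_pos (hxp ▸ hp)]
        · rw [if_neg hxp]
          split_ifs with h1 h2 h2
          · obtain ⟨j, hj, rfl⟩ := h1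
            exact absurd (hfK j (by omega) h2) hxp
          all_goals rfl
      rw [hgoal]
      simp [upd_apply]
    · have h1 : ∀ y, (5 ≤ c → y < l) → s1 c y = s c y := fun y hy => hag c y hc hy
      have h8 := hag 8 (l - 1) (by omega) (by omega)
      have h9 := hag 9 (l - 1) (by omega) (by omega)
      have h1x := h1 x hx
      simp only [popState, upd_apply, hs00, f5, f6, f10, h8, h9, unmarkState_of_ne hc, h1x]
      split_ifs <;> first | rfl | omega

end RAM

end

/-! ### The evaluation on incidence lists and its running time -/

section

open Real Finset

namespace RAM

section Lists

variable {H : HGraph ℕ ℕ} {d k : ℕ} {vert : ℕ → Fin (d + 1) → ℕ} {A : Finset ℕ}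
  {VT DEG INC : ℕ → ℕ} {Λ D : ℕ}

/-- The lists `INC`, of lengths `DEG`, contain the hyperedges in `A` at each vertex; a hyperedge `e`
is referred to by `(d + 1) * e`. -/
def IncidenceLists (H : HGraph ℕ ℕ) (d k : ℕ) (A : Finset ℕ) (DEG INC : ℕ → ℕ) : Prop :=
  ∀ (u : ℕ) (F : ℕ → ℕ), ∑ i ∈ range (DEG u), F (INC ((k + 1) * u + i)) =
    ∑ e ∈ A.filter (fun e => u ∈ H.edge e), F ((d + 1) * e)

/-- The array `VT` lists the vertices of the hyperedges in `A`. -/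
def VertexTable (vert : ℕ → Fin (d + 1) → ℕ) (A : Finset ℕ) (VT : ℕ → ℕ) : Prop :=
  ∀ e ∈ A, ∀ j : Fin (d + 1), VT ((d + 1) * e + j) = vert e j

theorem VertexTable.subset {A A' : Finset ℕ} (h : VertexTable vert A VT) (hA : A' ⊆ A) :
    VertexTable vert A' VT := fun e he => h e (hA he)

theorem IncidenceLists.card_eq (h : IncidenceLists H d k A DEG INC) (u : ℕ) :
    DEG u = (A.filter fun e => u ∈ H.edge e).card := by
  simpa using h u fun _ => 1

/-- The lists are specified only through sums of arbitrary functions, which ignores their order.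
Testing with the indicator of a single entry recovers membership. -/
theorem IncidenceLists.exists_mem (h : IncidenceLists H d k A DEG INC) {u i : ℕ}
    (hi : i < DEG u) : ∃ e ∈ A, u ∈ H.edge e ∧ INC ((k + 1) * u + i) = (d + 1) * e := by
  by_contra! hcon
  have h1 := h u fun g => if g = INC ((k + 1) * u + i) then 1 else 0
  have h2 : 1 ≤ ∑ i' ∈ range (DEG u),
      if INC ((k + 1) * u + i') = INC ((k + 1) * u + i) then 1 else 0 := by
    have := Finset.single_le_sum (f := fun i' =>
      if INC ((k + 1) * u + i') = INC ((k + 1) * u + i) then 1 else 0)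
      (fun _ _ => Nat.zero_le _) (Finset.mem_range.2 hi)
    simpa using this
  rw [h1, Finset.sum_eq_zero] at h2
  · omega
  · intro e he
    obtain ⟨h3, h4⟩ := Finset.mem_filter.1 he
    exact if_neg fun h5 => hcon e h3 h4 h5.symm

theorem IncidenceLists.le_of_degreeLE (h : IncidenceLists H d k A DEG INC)
    (hdeg : H.DegreeLE (k + 1)) (u : ℕ) : DEG u ≤ k + 1 := by
  rw [h.card_eq]
  have h1 : ((A.filter fun e => u ∈ H.edge e : Finset ℕ) : Set ℕ) ⊆ {e | u ∈ H.edge e} := by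
    intro e he
    simpa using (Finset.mem_filter.1 (Finset.mem_coe.1 he)).2
  have := (Set.encard_le_encard h1).trans (hdeg u)
  rw [Set.encard_coe_eq_coe_finsetCard] at this
  exact_mod_cast this

theorem IncidenceLists.exists_vertex (h : IncidenceLists H d k A DEG INC)
    (hvert : ∀ f, H.edge f = univ.image (vert f)) (hVT : VertexTable vert A VT) {u i : ℕ}
    (hi : i < DEG u) : ∃ c ≤ d, VT (INC ((k + 1) * u + i) + c) = u := by
  obtain ⟨e, he, hu, hi'⟩ := h.exists_mem hi
  rw [hvert] at hu
  obtain ⟨j, -, rfl⟩ := Finset.mem_image.1 hu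
  exact ⟨j, by omega, by rw [hi', hVT e he]⟩

theorem seen_eq_visited (hVT : VertexTable vert A VT) {f j : ℕ} (hf : f ∈ A) (hj : j ≤ d + 1)
    (K : Finset ℕ) : seen VT K ((d + 1) * f) j = HGraph.visited vert K f j := by
  ext v
  simp only [seen, HGraph.visited, Finset.mem_union, Finset.mem_image, Finset.mem_range,
    Finset.mem_filter, Finset.mem_univ, true_and]
  refine or_congr_right ⟨?_, ?_⟩
  · rintro ⟨i, hi, rfl⟩
    exact ⟨⟨i, by omega⟩, hi, (hVT f hf ⟨i, by omega⟩).symm⟩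
  · rintro ⟨i, hi, rfl⟩
    exact ⟨i, hi, hVT f hf i⟩

theorem markCount_eq (hvert : ∀ f, H.edge f = univ.image (vert f))
    (hinj : ∀ f, Function.Injective (vert f)) (hVT : VertexTable vert A VT) {g : ℕ} (hg : g ∈ A)
    (K : Finset ℕ) : markCount VT d K ((d + 1) * g) = (H.edge g ∩ K).card := by
  rw [markCount, ← Fin.sum_univ_eq_sum_range (fun c => if VT ((d + 1) * g + c) ∈ K then 1 else 0),
    Finset.sum_congr rfl fun c _ => by rw [hVT g hg c], ← Finset.card_filter,
    ← Finset.card_image_of_injective _ (hinj g), hvert]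
  congr 1
  ext v
  simp only [Finset.mem_image, Finset.mem_filter, Finset.mem_univ, true_and, Finset.mem_inter]
  constructor
  · rintro ⟨c, hc, rfl⟩; exact ⟨⟨c, rfl⟩, hc⟩
  · rintro ⟨⟨c, rfl⟩, hc⟩; exact ⟨c, hc, rfl⟩

/-- `p` is the only vertex of `f` that may be in `K`, and it lies in `K`. -/
def Parent (vert : ℕ → Fin (d + 1) → ℕ) (K : Finset ℕ) (p f : ℕ) : Prop :=
  p ∈ K ∧ ∀ j, vert f j ∈ K → vert f j = p

theorem notMem_visited (hinj : ∀ f, Function.Injective (vert f)) {K : Finset ℕ} {f : ℕ}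
    {j : Fin (d + 1)} (hj : vert f j ∉ K) : vert f j ∉ HGraph.visited vert K f j := by
  simp only [HGraph.visited, Finset.mem_union, Finset.mem_image, Finset.mem_filter,
    Finset.mem_univ, true_and, not_or, not_exists, not_and]
  refine ⟨hj, fun i hi h => ?_⟩
  rw [hinj f h] at hi
  exact lt_irrefl _ hi

/-- The current vertex has just been added to the deleted set and contributes one mark. Hence a
count below two says that the hyperedge avoids everything deleted before. -/
theorem mem_children_iff (hvert : ∀ f, H.edge f = univ.image (vert f))
    (hinj : ∀ f, Function.Injective (vert f)) (hVT : VertexTable vert A VT) {K : Finset ℕ} {f : ℕ}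
    {j : Fin (d + 1)} (hj : vert f j ∉ K) {g : ℕ} (hg : g ∈ A) (hu : vert f j ∈ H.edge g) :
    g ∈ H.children vert A K f j ↔
      markCount VT d (HGraph.visited vert K f (j + 1)) ((d + 1) * g) < 2 := by
  rw [markCount_eq hvert hinj hVT hg, HGraph.children, Finset.mem_filter, HGraph.visited_succ,
    Finset.inter_union_distrib_left, Finset.card_union_of_disjoint, 
    Finset.inter_singleton_of_mem hu, Finset.card_singleton, Finset.disjoint_iff_inter_eq_empty,
    ← Finset.card_eq_zero]
  · simp only [hg, hu, true_and]; omega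
  · rw [Finset.disjoint_left]
    intro v hv hv'
    have := Finset.mem_singleton.1 (Finset.mem_inter.1 hv').2
    rw [this] at hv
    exact notMem_visited hinj hj (Finset.mem_inter.1 hv).2

theorem sum_markCount_eq (hvert : ∀ f, H.edge f = univ.image (vert f))
    (hinj : ∀ f, Function.Injective (vert f)) (hVT : VertexTable vert A VT)
    (hI : IncidenceLists H d k A DEG INC) {K : Finset ℕ} {f : ℕ} {j : Fin (d + 1)}
    (hj : vert f j ∉ K) (G : ℕ → ℕ) :
    ∑ i ∈ range (DEG (vert f j)),
      (if markCount VT d (HGraph.visited vert K f (j + 1)) (INC ((k + 1) * vert f j + i)) < 2 then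
        G (INC ((k + 1) * vert f j + i)) else 0) =
      ∑ g ∈ H.children vert A K f j, G ((d + 1) * g) := by
  rw [hI (vert f j) fun x => if markCount VT d (HGraph.visited vert K f (j + 1)) x < 2 then
    G x else 0, ← Finset.sum_filter]
  refine Finset.sum_congr ?_ fun _ _ => rfl
  ext g
  rw [Finset.mem_filter, Finset.mem_filter]
  constructor
  · rintro ⟨⟨h1, h2⟩, h3⟩
    exact (mem_children_iff hvert hinj hVT hj h1 h2).2 h3
  · intro h
    obtain ⟨h1, h2, -⟩ := Finset.mem_filter.1 h
    exact ⟨⟨h1, h2⟩, (mem_children_iff hvert hinj hVT hj h1 h2).1 h⟩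

theorem parent_child (hvert : ∀ f, H.edge f = univ.image (vert f)) {K : Finset ℕ} {f g : ℕ}
    {j : Fin (d + 1)} (hg : g ∈ H.children vert A K f j) :
    Parent vert (HGraph.visited vert K f (j + 1)) (vert f j) g := by
  rw [HGraph.visited_succ]
  refine ⟨by simp, fun i hi => ?_⟩
  rcases Finset.mem_union.1 hi with h | h
  · exact absurd h (Finset.disjoint_left.1 (Finset.mem_filter.1 hg).2.2 (by simp [hvert]))
  · exact Finset.mem_singleton.1 h

theorem Parent.notMem {K : Finset ℕ} {p f : ℕ} (h : Parent vert K p f) {j : Fin (d + 1)}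
    (hj : vert f j ≠ p) : vert f j ∉ K := fun h' => hj (h.2 j h')

theorem csum_visited (hvert : ∀ f, H.edge f = univ.image (vert f))
    (hinj : ∀ f, Function.Injective (vert f)) (hVT : VertexTable vert A VT)
    (hI : IncidenceLists H d k A DEG INC) {K : Finset ℕ} {f : ℕ} {j : Fin (d + 1)}
    (hj : vert f j ∉ K) (ℓ : ℕ) :
    csum VT DEG INC Λ D d k (ℓ + 1) (HGraph.visited vert K f (j + 1)) (vert f j) =
      ∑ g ∈ H.children vert A K f j, foldR VT Λ D (csum VT DEG INC Λ D d k ℓ)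
        (HGraph.visited vert K f (j + 1)) (vert f j) ((d + 1) * g) (d + 1) :=
  sum_markCount_eq hvert hinj hVT hI hj fun x => foldR VT Λ D (csum VT DEG INC Λ D d k ℓ)
        (HGraph.visited vert K f (j + 1)) (vert f j) x (d + 1)

theorem tsum_visited (hvert : ∀ f, H.edge f = univ.image (vert f))
    (hinj : ∀ f, Function.Injective (vert f)) (hVT : VertexTable vert A VT)
    (hI : IncidenceLists H d k A DEG INC) {K : Finset ℕ} {f : ℕ} {j : Fin (d + 1)}
    (hj : vert f j ∉ K) (ℓ : ℕ) :
    tsum VT DEG INC d k (ℓ + 1) (HGraph.visited vert K f (j + 1)) (vert f j) =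
      DEG (vert f j) + ∑ g ∈ H.children vert A K f j, (1 + foldT VT (tsum VT DEG INC d k ℓ)
        (HGraph.visited vert K f (j + 1)) (vert f j) ((d + 1) * g) (d + 1)) := by
  rw [← sum_markCount_eq hvert hinj hVT hI hj fun x => 1 + foldT VT (tsum VT DEG INC d k ℓ)
        (HGraph.visited vert K f (j + 1)) (vert f j) x (d + 1)]
  simp only [tsum, Finset.sum_add_distrib]
  simp

/-! ### Running time of the recursion -/

/-- A bound for the number of steps at a vertex. -/
def stepBound (d k : ℕ) : ℕ → ℕ
  | 0 => k + 1
  | ℓ + 1 => k + 1 + k * (d + 2) + k * d * stepBound d k ℓ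

theorem stepBound_le (d k ℓ : ℕ) (hdk : 1 ≤ k * d) :
    stepBound d k ℓ ≤ (k + 1 + k * (d + 2)) * ((ℓ + 1) * (k * d) ^ ℓ) := by
  induction ℓ with
  | zero => simp [stepBound]
  | succ ℓ ih =>
    have h1 : 1 ≤ (k * d) ^ (ℓ + 1) := Nat.one_le_pow _ _ hdk
    calc stepBound d k (ℓ + 1)
        ≤ (k + 1 + k * (d + 2)) * (k * d) ^ (ℓ + 1) +
          k * d * ((k + 1 + k * (d + 2)) * ((ℓ + 1) * (k * d) ^ ℓ)) := by
          rw [stepBound]; gcongr; exact Nat.le_mul_of_pos_right _ h1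
      _ = _ := by ring

theorem foldT_eq (hVT : VertexTable vert A VT) {f : ℕ} (hf : f ∈ A)
    (ts : Finset ℕ → ℕ → ℕ) (K : Finset ℕ) (p : ℕ) :
    foldT VT ts K p ((d + 1) * f) (d + 1) = ∑ j : Fin (d + 1), if vert f j = p then 1 else
      1 + ts (HGraph.visited vert K f (j + 1)) (vert f j) := by
  rw [foldT, ← Fin.sum_univ_eq_sum_range (fun j => if VT ((d + 1) * f + j) = p then 1 else
    1 + ts (seen VT K ((d + 1) * f) (j + 1)) (VT ((d + 1) * f + j)))]
  refine Finset.sum_congr rfl fun j _ => ?_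
  rw [hVT f hf, seen_eq_visited hVT hf (by omega)]

/-- Each of at most k + 1 listed hyperedges costs one step to inspect. Each of at most k children
costs in addition a pop, one step for its parent vertex, and one finishing step plus the recursive
cost for each of its d other vertices. -/
theorem tsum_le (hvert : ∀ f, H.edge f = univ.image (vert f))
    (hinj : ∀ f, Function.Injective (vert f)) (hVT : VertexTable vert A VT)
    (hI : IncidenceLists H d k A DEG INC) (hdeg : H.DegreeLE (k + 1)) (ℓ : ℕ) {K : Finset ℕ}
    {f : ℕ} {j : Fin (d + 1)} (hj : vert f j ∉ K) (hf : f ∉ A ∨ ¬ Disjoint (H.edge f) K) :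
    tsum VT DEG INC d k ℓ (HGraph.visited vert K f (j + 1)) (vert f j) ≤ stepBound d k ℓ := by
  induction ℓ generalizing K f j with
  | zero => exact hI.le_of_degreeLE hdeg _
  | succ ℓ ih =>
    rw [tsum_visited hvert hinj hVT hI hj]
    have hchild : ∀ g ∈ H.children vert A K f j, 1 + foldT VT (tsum VT DEG INC d k ℓ)
        (HGraph.visited vert K f (j + 1)) (vert f j) ((d + 1) * g) (d + 1) ≤
          d + 2 + d * stepBound d k ℓ := by
      intro g hg
      have hgA := (Finset.mem_filter.1 hg).1
      have hug := (Finset.mem_filter.1 hg).2.1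
      have hpar := parent_child hvert hg
      rw [hvert] at hug
      obtain ⟨i, -, hi⟩ := Finset.mem_image.1 hug
      rw [foldT_eq hVT hgA, ← Finset.add_sum_erase univ _ (Finset.mem_univ i), if_pos hi]
      have : ∀ i' ∈ univ.erase i, (if vert g i' = vert f j then 1 else 1 +
          tsum VT DEG INC d k ℓ (HGraph.visited vert (HGraph.visited vert K f (j + 1)) g (i' + 1))
            (vert g i')) ≤ 1 + stepBound d k ℓ := by
        intro i' _
        split_ifs with h
        · omega
        · exact Nat.add_le_add_left
            (ih (hpar.notMem h) (Or.inr (HGraph.not_disjoint_visited hg))) 1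
      have := Finset.sum_le_card_nsmul _ _ _ this
      rw [Finset.card_erase_of_mem (Finset.mem_univ i), Finset.card_univ, Fintype.card_fin,
        smul_eq_mul, Nat.add_sub_cancel, mul_add] at this
      omega
    have h1 := Finset.sum_le_card_nsmul _ _ _ hchild
    have h2 := HGraph.card_children_le hdeg hvert hf j
    have h3 := hI.le_of_degreeLE hdeg (vert f j)
    rw [stepBound]
    calc _ ≤ k + 1 + (H.children vert A K f j).card • (d + 2 + d * stepBound d k ℓ) := by gcongr
      _ ≤ k + 1 + k * (d + 2 + d * stepBound d k ℓ) := by rw [smul_eq_mul]; gcongr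
      _ = _ := by ring

theorem foldT_root_le (hvert : ∀ f, H.edge f = univ.image (vert f))
    (hinj : ∀ f, Function.Injective (vert f)) {f : ℕ} (hf : f ∉ A)
    (hVT : VertexTable vert (insert f A) VT) (hI : IncidenceLists H d k A DEG INC)
    (hdeg : H.DegreeLE (k + 1)) (ℓ : ℕ) {K : Finset ℕ} {p : ℕ} (hp : Parent vert K p f) :
    foldT VT (tsum VT DEG INC d k ℓ) K p ((d + 1) * f) (d + 1) ≤
      (d + 1) * (1 + stepBound d k ℓ) := by
  rw [foldT_eq hVT (Finset.mem_insert_self _ _)]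
  refine (Finset.sum_le_card_nsmul univ _ (1 + stepBound d k ℓ) fun j _ => ?_).trans
    (by rw [Finset.card_univ, Fintype.card_fin, smul_eq_mul])
  split_ifs with h
  · omega
  · exact Nat.add_le_add_left (tsum_le hvert hinj (hVT.subset (Finset.subset_insert _ _)) hI hdeg ℓ
      (hp.notMem h) (Or.inl hf)) 1

end Lists

end RAM

end

/-! ### Rounding errors and accuracy of the computed ratios -/

section

open Real Finset

theorem arsinh_sub_le {a b : ℝ} (h : a ≤ b) : arsinh b - arsinh a ≤ b - a := by
  have h1 : arsinh a ≤ arsinh b := arsinh_le_arsinh.2 h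
  have h2 : sinh (arsinh a) ≤ sinh (arsinh b) := sinh_le_sinh.2 h1
  have h3 := sinh_sub_id_strictMono.monotone h1
  simp only [sinh_arsinh] at h3
  linarith

/-- The square root is not Lipschitz at 0, so a lower bound ρ is needed, but only for the larger
argument: √(ky) - √(kx) is k(y - x) divided by the sum of the roots. -/
theorem abs_potential_sub_le_div {k : ℕ} (hk : 1 ≤ k) {x y δ ρ : ℝ} (hρ : 0 < ρ) (hρy : ρ ≤ y)
    (hx : 0 ≤ x) (hxy : x ≤ y) (hδ : y - δ ≤ x) :
    |potential k x - potential k y| ≤ k * δ / √(k * ρ) := by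
  have hk0 : (0 : ℝ) < k := by exact_mod_cast hk
  have h0 : √(k * x) ≤ √(k * y) := sqrt_le_sqrt (by gcongr)
  have h1 : potential k x ≤ potential k y := arsinh_le_arsinh.2 h0
  rw [abs_sub_comm, abs_of_nonneg (by linarith)]
  refine (arsinh_sub_le h0).trans ?_
  have h2 : √(k * ρ) ≤ √(k * y) := sqrt_le_sqrt (by gcongr)
  have h3 : 0 < √(k * ρ) := by positivity
  rw [le_div_iff₀ h3]
  calc (√(k * y) - √(k * x)) * √(k * ρ) ≤ (√(k * y) - √(k * x)) * (√(k * y) + √(k * x)) :=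
        mul_le_mul_of_nonneg_left (by linarith [sqrt_nonneg (k * x)]) (by linarith)
    _ = √(k * y) ^ 2 - √(k * x) ^ 2 := by ring
    _ = k * (y - x) := by
        rw [sq_sqrt (by nlinarith), sq_sqrt (by positivity)]; ring
    _ ≤ _ := by gcongr; linarith

namespace RAM

section Rounding

variable {VT : ℕ → ℕ} {Λ D d k : ℕ} {lam : ℝ}

/-- The exact factor at a vertex. -/
noncomputable def factor (VT : ℕ → ℕ) (D : ℕ) (cs : Finset ℕ → ℕ → ℕ) (K : Finset ℕ)
    (p f j : ℕ) : ℝ :=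
  if VT (f + j) = p then 1 else (1 + (cs (seen VT K f (j + 1)) (VT (f + j)) : ℝ) / D)⁻¹

/-- Every floor loses at most one unit 1/D, including the floor in Λ. Later factors are at most 1
and cannot amplify earlier losses, so these add up to n + 1 units. All errors go downwards. -/
theorem foldR_div_bounds (hlam : 0 < lam) (hD : 0 < D) (hΛ : Λ = ⌊lam * D⌋₊)
    (cs : Finset ℕ → ℕ → ℕ) (K : Finset ℕ) (p f n : ℕ) :
    lam * ∏ j ∈ range n, factor VT D cs K p f j - (n + 1) / D ≤ foldR VT Λ D cs K p f n / D ∧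
      (foldR VT Λ D cs K p f n / D : ℝ) ≤ lam * ∏ j ∈ range n, factor VT D cs K p f j := by
  have hD0 : (0 : ℝ) < D := by exact_mod_cast hD
  induction n with
  | zero =>
    have h1 := Nat.floor_le (show 0 ≤ lam * D by positivity)
    have h2 := Nat.lt_floor_add_one (lam * D)
    rw [← hΛ] at h1 h2
    simp only [foldR, range_zero, prod_empty, mul_one]
    constructor
    · rw [sub_le_iff_le_add, ← add_div, le_div_iff₀ hD0]; push_cast; linarith
    · rwa [div_le_iff₀ hD0]
  | succ n ih =>
    rw [Finset.prod_range_succ, foldR, factor]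
    have hpos : (0 : ℝ) < 1 / D := by positivity
    have hsp : ((n + 1 : ℕ) + 1 : ℝ) / D = (n + 1) / D + 1 / D := by push_cast; ring
    rw [hsp]
    split_ifs with h
    · exact ⟨by linarith [ih.1], by linarith [ih.2]⟩
    · set S := cs (seen VT K f (n + 1)) (VT (f + n))
      set R := foldR VT Λ D cs K p f n
      set P := lam * ∏ j ∈ range n, factor VT D cs K p f j with hP
      have e1 : ((R * D : ℕ) : ℝ) / (D + S : ℕ) = R * (1 + (S : ℝ) / D)⁻¹ := by
        push_cast; field_simp
      have h1 : ((R * D / (D + S) : ℕ) : ℝ) ≤ R * (1 + (S : ℝ) / D)⁻¹ :=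
        e1 ▸ Nat.cast_div_le
      have h2 : R * (1 + (S : ℝ) / D)⁻¹ ≤ ((R * D / (D + S) : ℕ) : ℝ) + 1 := by
        rw [← e1]
        rw [div_le_iff₀ (by positivity)]
        have := Nat.lt_div_mul_add (a := R * D) (b := D + S) (by omega)
        have h5 : R * D ≤ (R * D / (D + S) + 1) * (D + S) := by rw [Nat.add_mul]; omega
        exact_mod_cast h5
      have hq0 : 0 ≤ (1 + (S : ℝ) / D)⁻¹ := by positivity
      have hq1 : (1 + (S : ℝ) / D)⁻¹ ≤ 1 :=
        inv_le_one_of_one_le₀ (by simp only [le_add_iff_nonneg_right]; positivity)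
      generalize (1 + (S : ℝ) / D)⁻¹ = q at *
      rw [← mul_assoc, ← hP]
      have h3 : (R : ℝ) / D * q = R * q / D := by ring
      constructor
      · have h4 : (R * q - 1) / D ≤ ((R * D / (D + S) : ℕ) : ℝ) / D := by gcongr; linarith
        have h5 : (P - (n + 1) / D) * q ≤ R / D * q := by gcongr; exact ih.1
        have h6 : ((n : ℝ) + 1) / D * q ≤ (n + 1) / D := mul_le_of_le_one_right (by positivity) hq1
        rw [sub_div] at h4
        nlinarith
      · calc ((R * D / (D + S) : ℕ) : ℝ) / D ≤ R * q / D := by gcongr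
          _ = R / D * q := h3.symm
          _ ≤ _ := by gcongr; exact ih.2

end Rounding

section Accuracy

variable {H : HGraph ℕ ℕ} {d k : ℕ} {vert : ℕ → Fin (d + 1) → ℕ} {A : Finset ℕ}
  {VT DEG INC : ℕ → ℕ} {Λ D : ℕ} {lam : ℝ}

variable (H vert A VT DEG INC Λ D k lam) in
open Classical in
/-- The computed ratio where it is meaningful, and otherwise the exact value of the truncated
recursion. -/
noncomputable def approxRatio (ℓ : ℕ) (K : Finset ℕ) (f : ℕ) : ℝ :=
  if h : f ∈ A ∧ ∃ p ∈ H.edge f, Parent vert K p f then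
    foldR VT Λ D (csum VT DEG INC Λ D d k ℓ) K h.2.choose ((d + 1) * f) (d + 1) / D
  else H.treeRatio vert lam A ℓ K f

theorem Parent.eq (hvert : ∀ f, H.edge f = univ.image (vert f)) {K : Finset ℕ} {p p' f : ℕ}
    (h : Parent vert K p f) (h' : Parent vert K p' f) (hp : p ∈ H.edge f) : p = p' := by
  rw [hvert] at hp
  obtain ⟨j, -, rfl⟩ := Finset.mem_image.1 hp
  exact h'.2 j h.1

theorem approxRatio_eq (hvert : ∀ f, H.edge f = univ.image (vert f)) (ℓ : ℕ) {K : Finset ℕ}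
    {f p : ℕ} (hf : f ∈ A) (hp : p ∈ H.edge f) (h : Parent vert K p f) :
    approxRatio H k vert A VT DEG INC Λ D lam ℓ K f =
      foldR VT Λ D (csum VT DEG INC Λ D d k ℓ) K p ((d + 1) * f) (d + 1) / D := by
  have hex : f ∈ A ∧ ∃ p ∈ H.edge f, Parent vert K p f := ⟨hf, p, hp, h⟩
  rw [approxRatio, dif_pos hex, hex.2.choose_spec.2.eq hvert h hex.2.choose_spec.1]

theorem approxRatio_nonneg (hlam : 0 < lam) (ℓ : ℕ) (K : Finset ℕ) (f : ℕ) :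
    0 ≤ approxRatio H k vert A VT DEG INC Λ D lam ℓ K f := by
  rw [approxRatio]
  split_ifs
  · positivity
  · exact HGraph.treeRatio_nonneg hlam ℓ K f

/-- At depth 0 all sums vanish and ΛD/D is exact, so the machine value is the rounded λ, matching
the start of `treeRatio`. -/
theorem foldR_zero (hD : 0 < D) (K : Finset ℕ) (p f n : ℕ) :
    foldR VT Λ D (csum VT DEG INC Λ D d k 0) K p f n = Λ := by
  induction n with
  | zero => rfl
  | succ n ih =>
    rw [foldR, ih]
    split_ifs
    · rfl
    · simp [csum, Nat.mul_div_cancel _ hD]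

/-- Before the last roundings, the machine performs one exact level of the recursion on its own
rounded child values. `approxRatio` extends these values to all arguments so that the contraction
lemmas, which quantify over all K and f, apply. -/
theorem prod_factor_eq (hvert : ∀ f, H.edge f = univ.image (vert f))
    (hinj : ∀ f, Function.Injective (vert f)) {f : ℕ}
    (hVT : VertexTable vert (insert f A) VT) (hI : IncidenceLists H d k A DEG INC)
    (ℓ : ℕ) {K : Finset ℕ} {p : ℕ} (hp : Parent vert K p f) :
    lam * ∏ j ∈ range (d + 1), factor VT D (csum VT DEG INC Λ D d k (ℓ + 1)) K p ((d + 1) * f) j =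
      H.treeStep vert lam A (approxRatio H k vert A VT DEG INC Λ D lam ℓ) K f := by
  have hVT' := hVT.subset (Finset.subset_insert f A)
  rw [HGraph.treeStep, branchRatio, ← Fin.prod_univ_eq_prod_range]
  congr 1
  refine Finset.prod_congr rfl fun j _ => ?_
  rw [factor, seen_eq_visited hVT (Finset.mem_insert_self _ _) (by omega),
    hVT f (Finset.mem_insert_self _ _)]
  split_ifs with h
  · have : H.children vert A K f j = ∅ := by
      refine Finset.eq_empty_of_forall_notMem fun g hg => ?_
      obtain ⟨-, h2, h3⟩ := Finset.mem_filter.1 hg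
      rw [h] at h2
      exact Finset.disjoint_left.1 h3 h2 (HGraph.subset_visited vert K f j hp.1)
    simp [this]
  · rw [csum_visited hvert hinj hVT' hI (hp.notMem h), Nat.cast_sum, Finset.sum_div]
    congr 2
    refine Finset.sum_congr rfl fun g hg => ?_
    obtain ⟨h1, h2, -⟩ := Finset.mem_filter.1 hg
    rw [approxRatio_eq hvert ℓ h1 h2 (parent_child hvert hg)]

/-- A lower bound for the ratios. -/
noncomputable def ratioBound (d k : ℕ) (lam : ℝ) : ℝ := lam * ((1 + (k + 1) * lam)⁻¹) ^ (d + 1)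

theorem ratioBound_pos (hlam : 0 < lam) : 0 < ratioBound d k lam := by
  rw [ratioBound]; positivity

theorem ratioBound_le_prod (hlam : 0 < lam) (hD : 0 < D) (hΛ : Λ = ⌊lam * D⌋₊)
    (hI : IncidenceLists H d k A DEG INC) (hdeg : H.DegreeLE (k + 1)) (ℓ : ℕ) (K : Finset ℕ)
    (p f : ℕ) : ratioBound d k lam ≤
      lam * ∏ j ∈ range (d + 1), factor VT D (csum VT DEG INC Λ D d k ℓ) K p f j := by
  have hD0 : (0 : ℝ) < D := by exact_mod_cast hD
  have hΛ' : (Λ : ℝ) ≤ lam * D := by rw [hΛ]; exact Nat.floor_le (by positivity)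
  have h : ∀ j ∈ range (d + 1), (1 + (k + 1) * lam)⁻¹ ≤
      factor VT D (csum VT DEG INC Λ D d k ℓ) K p f j := by
    intro j _
    rw [factor]
    split_ifs
    · exact inv_le_one_of_one_le₀ (by nlinarith [show (0 : ℝ) ≤ k by positivity])
    · gcongr
      rw [div_le_iff₀ hD0]
      have := csum_le VT DEG INC Λ D d k (hI.le_of_degreeLE hdeg (VT (f + j))) ℓ
        (seen VT K f (j + 1))
      have h2 : (csum VT DEG INC Λ D d k ℓ (seen VT K f (j + 1)) (VT (f + j)) : ℝ) ≤
        (k + 1) * Λ := by exact_mod_cast this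
      calc _ ≤ (k + 1) * (Λ : ℝ) := h2
        _ ≤ (k + 1) * (lam * D) := by gcongr
        _ = _ := by ring
  rw [ratioBound]
  have := Finset.prod_le_prod (fun j _ => by positivity) h
  rw [Finset.prod_const, card_range] at this
  gcongr

/-- A bound for the effect of rounding in one level of the recursion. -/
noncomputable def roundErr (d k : ℕ) (lam : ℝ) (D : ℕ) : ℝ :=
  k * ((d + 2) / D) / √(k * ratioBound d k lam)

theorem roundErr_nonneg : 0 ≤ roundErr d k lam D := by rw [roundErr]; positivity

theorem foldR_le_mul (hlam : 0 < lam) (hD : 0 < D) (hΛ : Λ = ⌊lam * D⌋₊)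
    (cs : Finset ℕ → ℕ → ℕ) (K : Finset ℕ) (p f n : ℕ) :
    (foldR VT Λ D cs K p f n / D : ℝ) ≤ lam := by
  have hD0 : (0 : ℝ) < D := by exact_mod_cast hD
  have hΛ' : (Λ : ℝ) ≤ lam * D := by rw [hΛ]; exact Nat.floor_le (by positivity)
  rw [div_le_iff₀ hD0]
  have : (foldR VT Λ D cs K p f n : ℝ) ≤ Λ := by exact_mod_cast foldR_le VT Λ D cs K p f n
  linarith

theorem abs_potential_foldR_sub_treeStep_le (hk : 1 ≤ k) (hlam : 0 < lam) (hD : 0 < D)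
    (hΛ : Λ = ⌊lam * D⌋₊) (hvert : ∀ f, H.edge f = univ.image (vert f))
    (hinj : ∀ f, Function.Injective (vert f)) {f : ℕ}
    (hVT : VertexTable vert (insert f A) VT) (hI : IncidenceLists H d k A DEG INC)
    (hdeg : H.DegreeLE (k + 1)) (ℓ : ℕ) {K : Finset ℕ} {p : ℕ} (hp : Parent vert K p f) :
    |potential k (foldR VT Λ D (csum VT DEG INC Λ D d k (ℓ + 1)) K p ((d + 1) * f) (d + 1) / D) -
      potential k (H.treeStep vert lam A (approxRatio H k vert A VT DEG INC Λ D lam ℓ) K f)| ≤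
        roundErr d k lam D := by
  rw [← prod_factor_eq hvert hinj hVT hI ℓ hp]
  obtain ⟨h1, h2⟩ := foldR_div_bounds (VT := VT) hlam hD hΛ (csum VT DEG INC Λ D d k (ℓ + 1)) K p
    ((d + 1) * f) (d + 1)
  refine abs_potential_sub_le_div hk (ratioBound_pos hlam)
    (ratioBound_le_prod hlam hD hΛ hI hdeg _ _ _ _) (by positivity) h2 ?_
  have : ((d + 1 : ℕ) + 1 : ℝ) = d + 2 := by push_cast; ring
  rwa [this] at h1

/-- Each level adds one rounding error and passes on the errors from below without expansion, so
they grow linearly in the depth. -/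
theorem abs_potential_approxRatio_sub_le (hk : 1 ≤ k) (hlam : 0 < lam) (hD : 0 < D)
    (hΛ : Λ = ⌊lam * D⌋₊) (hvert : ∀ f, H.edge f = univ.image (vert f))
    (hinj : ∀ f, Function.Injective (vert f))
    (hVT : VertexTable vert A VT) (hI : IncidenceLists H d k A DEG INC)
    (hdeg : H.DegreeLE (k + 1))
    (hc : ∀ a, 0 ≤ a → Contracts (Fin (d + 1)) ℕ d k lam a a) (ℓ : ℕ) {K : Finset ℕ} {f : ℕ}
    (hf : ¬ Disjoint (H.edge f) K) :
    |potential k (approxRatio H k vert A VT DEG INC Λ D lam ℓ K f) -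
      potential k (H.treeRatio vert lam A ℓ K f)| ≤ (ℓ + 1) * roundErr d k lam D := by
  have hη := roundErr_nonneg (d := d) (k := k) (lam := lam) (D := D)
  have hD0 : (0 : ℝ) < D := by exact_mod_cast hD
  induction ℓ generalizing K f with
  | zero =>
    by_cases h : f ∈ A ∧ ∃ p ∈ H.edge f, Parent vert K p f
    · obtain ⟨h1, p, h2, h3⟩ := h
      rw [approxRatio_eq hvert 0 h1 h2 h3, foldR_zero hD, HGraph.treeRatio]
      obtain ⟨h4, h5⟩ := foldR_div_bounds (VT := VT) hlam hD hΛ (fun _ _ => 0) ∅ 0 0 0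
      rw [foldR, range_zero, prod_empty, mul_one] at h4 h5
      simp only [Nat.cast_zero, zero_add, one_mul]
      refine abs_potential_sub_le_div hk (ratioBound_pos hlam) ?_ (by positivity) h5 ?_
      · rw [ratioBound]
        exact mul_le_of_le_one_right hlam.le (pow_le_one₀ (by positivity)
          (inv_le_one_of_one_le₀ (by nlinarith [show (0 : ℝ) ≤ k by positivity])))
      · have : ((0 : ℕ) + 1 : ℝ) / D ≤ (d + 2) / D := by
          gcongr
          · simp
          · norm_num
        linarith
    · rw [approxRatio, dif_neg h]; simp [hη]
  | succ ℓ ih =>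
    by_cases h : f ∈ A ∧ ∃ p ∈ H.edge f, Parent vert K p f
    · obtain ⟨h1, p, h2, h3⟩ := h
      rw [approxRatio_eq hvert _ h1 h2 h3]
      have e1 := abs_potential_foldR_sub_treeStep_le hk hlam hD hΛ hvert hinj
        (by rwa [Finset.insert_eq_self.2 h1]) hI hdeg ℓ h3
      have e2 := HGraph.abs_potential_treeStep_sub_le (A := A) hdeg hvert
        (hc ((ℓ + 1) * roundErr d k lam D) (by positivity))
        (approxRatio_nonneg (H := H) (k := k) (vert := vert) (A := A) (VT := VT) (DEG := DEG)
          (INC := INC) (Λ := Λ) (D := D) hlam ℓ)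
        (HGraph.treeRatio_nonneg hlam ℓ) (fun K f => ih) hf
      rw [HGraph.treeRatio]
      refine (abs_sub_le _ _ _).trans ((add_le_add e1 e2).trans (le_of_eq ?_))
      push_cast; ring
    · rw [approxRatio, dif_neg h]; simp only [sub_self, abs_zero]; positivity

/-- Three contributions: rounding at the root, rounding below, and truncation below, the last two
multiplied by d + 1 at the root. The vertex 0 belongs to no hyperedge and acts as an artificial
parent, so that the root is evaluated by the same code. -/
theorem abs_foldR_sub_ratio_le (hd : 1 ≤ d) (hk : 1 ≤ k) (hlam : 0 < lam) (hD : 0 < D)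
    (hΛ : Λ = ⌊lam * D⌋₊) (hvert : ∀ f, H.edge f = univ.image (vert f))
    (hinj : ∀ f, Function.Injective (vert f)) {f : ℕ} (hf : f ∉ A)
    (hVT : VertexTable vert (insert f A) VT) (hI : IncidenceLists H d k A DEG INC)
    (hdeg : H.DegreeLE (k + 1)) {C : ℝ} (hC : ∀ x y : ℝ, 0 ≤ x → x ≤ lam → 0 ≤ y → y ≤ lam →
      |x - y| ≤ C * |potential k x - potential k y|) (hC0 : 0 < C)
    (hc : ∀ a, 0 ≤ a → Contracts (Fin (d + 1)) ℕ d k lam a a)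
    {err : ℕ → ℝ} (h0 : potential k lam ≤ err 0) (herr0 : ∀ ℓ, 0 ≤ err ℓ)
    (herr : ∀ ℓ, Contracts (Fin (d + 1)) ℕ d k lam (err ℓ) (err (ℓ + 1))) (ℓ : ℕ)
    (hpos : ∀ e j, vert e j ≠ 0) :
    |(foldR VT Λ D (csum VT DEG INC Λ D d k (ℓ + 1)) {0} 0 ((d + 1) * f) (d + 1) / D : ℝ) -
      H.ratio lam A f| ≤ C * ((d + 1) * (err ℓ + (ℓ + 2) * roundErr d k lam D)) := by
  have hη := roundErr_nonneg (d := d) (k := k) (lam := lam) (D := D)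
  have hVT' := hVT.subset (Finset.subset_insert f A)
  have hp : Parent vert {0} 0 f :=
    ⟨by simp, fun j hj => absurd (Finset.mem_singleton.1 hj) (hpos f j)⟩
  have haway : H.away A {0} = A := by
    ext e
    rw [HGraph.mem_away, and_iff_left_iff_imp, Finset.disjoint_singleton_right, hvert]
    intro _ h
    obtain ⟨j, -, hj⟩ := Finset.mem_image.1 h
    exact hpos e j hj
  have e1 := abs_potential_foldR_sub_treeStep_le hk hlam hD hΛ hvert hinj hVT hI hdeg ℓ hp
  have hcm := contracts_mul (Fin (d + 1)) ℕ (d + 1) hk hlam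
    (show 0 ≤ ((ℓ : ℝ) + 1) * roundErr d k lam D by positivity)
  have e2 := HGraph.abs_potential_treeStep_sub_le_root (A := A) (K := {0}) hdeg hvert hcm
    (approxRatio_nonneg (H := H) (k := k) (vert := vert) (A := A) (VT := VT) (DEG := DEG)
      (INC := INC) (Λ := Λ) (D := D) hlam ℓ)
    (HGraph.treeRatio_nonneg hlam ℓ)
    (fun K f => abs_potential_approxRatio_sub_le hk hlam hD hΛ hvert hinj hVT' hI hdeg hc ℓ) hf
  have e3 := HGraph.abs_potential_ratio_sub_treeRatio_le_root (A := A) (K := {0}) hk hlam hdeg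
    hvert h0 herr0 herr ℓ hf
  rw [haway, HGraph.treeRatio] at e3
  have hr : H.ratio lam A f ≤ lam := by
    have := HGraph.ratio_away_le (A := A) hlam hvert {0} f
    rwa [haway] at this
  refine (hC _ _ (by positivity) (foldR_le_mul hlam hD hΛ _ _ _ _ _)
    (H.ratio_pos hlam _ _).le hr).trans ?_
  rw [abs_sub_comm] at e3
  push_cast at e2
  refine mul_le_mul_of_nonneg_left ?_ hC0.le
  refine ((abs_sub_le _ _ _).trans (add_le_add e1 ((abs_sub_le _ _ _).trans
    (add_le_add e2 e3)))).trans ?_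
  nlinarith [mul_nonneg (show (0 : ℝ) ≤ d by positivity) hη]

end Accuracy

end RAM

end

/-! ### Subprograms for one hyperedge: copying, starting the stack, inserting, advancing -/

section

open Finset

namespace RAM

theorem upd_of_ne {s : ℕ → ℕ → ℕ} {c i x c' i' : ℕ} (h : c' ≠ c) :
    upd s c i x c' i' = s c' i' := if_neg fun h' => h h'.1

theorem Path.of_invariant {lam : ℝ} {g : Expr} {p : Prog} {β : ℕ} {I : ℕ → (ℕ → ℕ) → Prop} (n : ℕ)
    (h : ∀ e < n, ∀ m, I e m → g.eval lam m ≠ 0 ∧ ∃ m', Runs lam p m m' β ∧ I (e + 1) m')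
    {m : ℕ → ℕ} (hm : I 0 m) : ∃ m', Path lam g p β n m m' ∧ I n m' := by
  induction n with
  | zero => exact ⟨m, .nil m, hm⟩
  | succ n ih =>
    obtain ⟨m₁, h1, h2⟩ := ih fun e he => h e (by omega)
    obtain ⟨h3, m₂, h4, h5⟩ := h n n.lt_succ_self m₁ h2
    exact ⟨m₂, h1.trans (.single h3 h4), h5⟩

/-! ### Processing one hyperedge -/

/-- The list of hyperedges starts in cell `4`. -/
def offset (sz : ℕ → ℕ) (e : ℕ) : ℕ := 4 + ∑ i ∈ range e, (sz i + 1)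

/-- The low part of the memory lists `n` hyperedges with sizes `sz` and vertices `vt`. -/
def Lists (low : ℕ → ℕ) (n : ℕ) (sz : ℕ → ℕ) (vt : ℕ → ℕ → ℕ) : Prop :=
  low 0 = offset sz n ∧ ∀ e < n, low (offset sz e) = sz e ∧
    ∀ j < sz e, low (offset sz e + (j + 1)) = vt e j

/-- The vertices of the hyperedges, with new vertices added to obtain `d + 1` vertices each. -/
def padVert (d : ℕ) (sz : ℕ → ℕ) (vt : ℕ → ℕ → ℕ) (e j : ℕ) : ℕ :=
  if j < sz e then 2 * vt e j + 2 else 2 * ((d + 1) * e + j) + 1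

/-- Copy the vertices of the current hyperedge into the array `1`. -/
def copyP (d : ℕ) : Prog := forN (d + 1) fun j =>
  .branch (.sub (.load (rd 0 (.lit 5))) (.lit j))
    (wr 1 (.add (rd 0 (.lit 4)) (.lit j))
      (.add (scale 2 (.load (.add (rd 0 (.lit 5)) (.lit (j + 1))))) (.lit 2)))
    (wr 1 (.add (rd 0 (.lit 4)) (.lit j))
      (.add (scale 2 (.add (rd 0 (.lit 4)) (.lit j))) (.lit 1)))

/-- Start the stack with the current hyperedge. -/
def rootP : Prog :=
  .seq (wr 5 (.lit 1) (rd 0 (.lit 4))) (.seq (wr 6 (.lit 1) (.lit 0))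
    (.seq (wr 7 (.lit 1) (.lit 0)) (.seq (wr 8 (.lit 1) (.lit 0)) (.seq (wr 9 (.lit 1) (.lit 0))
      (.seq (wr 10 (.lit 1) (rd 0 (.lit 3))) (.seq (wr 9 (.lit 0) (.lit 0))
        (wr 0 (.lit 0) (.lit 1))))))))

/-- The vertex `j` of the current hyperedge. -/
def vertE (j : ℕ) : Expr := rd 1 (.add (rd 0 (.lit 4)) (.lit j))

/-- Insert the current hyperedge into the incidence lists. -/
def insertP (d k : ℕ) : Prog := forN (d + 1) fun j =>
  .seq (wr 3 (.add (scale (k + 1) (vertE j)) (rd 2 (vertE j))) (rd 0 (.lit 4)))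
    (wr 2 (vertE j) (.add (rd 2 (vertE j)) (.lit 1)))

/-- Go on to the next hyperedge. -/
def advanceP (d : ℕ) : Prog :=
  .seq (wr 0 (.lit 5) (.add (.add (rd 0 (.lit 5)) (.load (rd 0 (.lit 5)))) (.lit 1)))
    (.seq (wr 0 (.lit 4) (.add (rd 0 (.lit 4)) (.lit (d + 1))))
      (wr 0 (.lit 6) (.sub (rd 0 (.lit 6)) (.lit 1))))

/-- Process one hyperedge: `post` uses the computed ratio, which is found in the array `9`. -/
def edgeP (d k : ℕ) (post : Prog) : Prog :=
  .seq (copyP d) (.seq rootP (.seq (.loop sp (step d k)) (.seq post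
    (.seq (insertP d k) (advanceP d)))))

variable {lam : ℝ} {B : Base} {s : ℕ → ℕ → ℕ} {n d k : ℕ} {sz : ℕ → ℕ} {vt : ℕ → ℕ → ℕ}

/-- The arrays after `i` vertices of the hyperedge `e` have been copied. -/
def copyState (v : ℕ → ℕ) (s : ℕ → ℕ → ℕ) (f i : ℕ) : ℕ → ℕ → ℕ := fun c x =>
  if c = 1 ∧ f ≤ x ∧ x < f + i then v (x - f) else s c x

theorem upd_copyState (v : ℕ → ℕ) (s : ℕ → ℕ → ℕ) (f i : ℕ) :
    upd (copyState v s f i) 1 (f + i) (v i) = copyState v s f (i + 1) := by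
  funext c x
  simp only [upd_apply, copyState]
  by_cases h1 : c = 1 ∧ x = f + i
  · rw [if_pos h1, if_pos ⟨h1.1, by omega, by omega⟩, h1.2, Nat.add_sub_cancel_left]
  · rw [if_neg h1]
    refine if_congr ?_ rfl rfl
    constructor
    · rintro ⟨h2, h3, h4⟩; exact ⟨h2, h3, by omega⟩
    · rintro ⟨h2, h3, h4⟩; exact ⟨h2, h3, by omega⟩

theorem mem_offset (hL : Lists B.low n sz vt) {e : ℕ} (he : e < n) :
    mem B s (offset sz e) = sz e ∧ ∀ j < sz e, mem B s (offset sz e + (j + 1)) = vt e j := by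
  have h1 : offset sz (e + 1) ≤ offset sz n := by
    unfold offset
    gcongr
    omega
  have h2 : offset sz (e + 1) = offset sz e + (sz e + 1) := by
    simp only [offset, Finset.sum_range_succ]; omega
  refine ⟨by rw [mem_low (by rw [hL.1]; omega), (hL.2 e he).1], fun j hj => ?_⟩
  rw [mem_low (by rw [hL.1]; omega), (hL.2 e he).2 j hj]

theorem copy_sem (hL : Lists B.low n sz vt) {e : ℕ} (he : e < n)
    (h4 : s 0 4 = (d + 1) * e) (h5 : s 0 5 = offset sz e) :
    (copyP d).sem lam (mem B s) =
      mem B (copyState (padVert d sz vt e) s ((d + 1) * e) (d + 1)) ∧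
      (copyP d).bits lam (mem B s) = 0 := by
  have h0 : copyState (padVert d sz vt e) s ((d + 1) * e) 0 = s := by
    funext c x
    rw [copyState, if_neg (by omega)]
  have := sem_forN (lam := lam) (n := d + 1)
    (m := fun i => mem B (copyState (padVert d sz vt e) s ((d + 1) * e) i))
    (p := fun j => .branch (.sub (.load (rd 0 (.lit 5))) (.lit j))
    (wr 1 (.add (rd 0 (.lit 4)) (.lit j))
      (.add (scale 2 (.load (.add (rd 0 (.lit 5)) (.lit (j + 1))))) (.lit 2)))
    (wr 1 (.add (rd 0 (.lit 4)) (.lit j))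
      (.add (scale 2 (.add (rd 0 (.lit 4)) (.lit j))) (.lit 1)))) fun i _ => by
      set s' := copyState (padVert d sz vt e) s ((d + 1) * e) i with hs'
      have e4 : s' 0 4 = (d + 1) * e := by rw [hs', copyState, if_neg (by omega), h4]
      have e5 : s' 0 5 = offset sz e := by rw [hs', copyState, if_neg (by omega), h5]
      obtain ⟨m1, m2⟩ := mem_offset (s := s') hL he
      have eg : (Expr.sub (.load (rd 0 (.lit 5))) (.lit i)).eval lam (mem B s') = sz e - i := by
        simp only [Expr.eval, eval_rd (show 0 < 11 by norm_num), e5, m1]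
      constructor
      · rw [Prog.sem, eg, ← upd_copyState, ← hs', sem_wr (by norm_num), sem_wr (by norm_num)]
        simp only [Expr.eval, eval_rd (show 0 < 11 by norm_num), e4, e5, eval_scale]
        rw [padVert]
        by_cases h : i < sz e
        · rw [if_neg (by omega), if_pos h, m2 i h]
        · rw [if_pos (by omega), if_neg h]
      · rw [Prog.bits]
        simp [bits_wr, Expr.bits]
  rwa [h0] at this

theorem root_sem : rootP.sem lam (mem B s) =
    mem B (upd (upd (upd (upd (upd (upd (upd (upd s 5 1 (s 0 4)) 6 1 0) 7 1 0) 8 1 0) 9 1 0) 10 1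
      (s 0 3)) 9 0 0) 0 0 1) ∧ rootP.bits lam (mem B s) = 0 := by
  constructor
  · simp [rootP, Prog.sem, sem_wr, eval_rd, Expr.eval, upd_apply]
  · simp [rootP, Prog.bits, bits_wr, Expr.bits]

/-- The arrays after the hyperedge `f` has been inserted into the lists of its first `i`
vertices. -/
def insertState (k : ℕ) (v : ℕ → ℕ) (s : ℕ → ℕ → ℕ) (f i : ℕ) : ℕ → ℕ → ℕ := fun c x =>
  if c = 2 ∧ ∃ j < i, v j = x then s 2 x + 1 else
    if c = 3 ∧ ∃ j < i, (k + 1) * v j + s 2 (v j) = x then f else s c x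

theorem insertState_of_ne {c : ℕ} (h2 : c ≠ 2) (h3 : c ≠ 3) (k : ℕ) (v : ℕ → ℕ) (s : ℕ → ℕ → ℕ)
    (f i x : ℕ) : insertState k v s f i c x = s c x := by
  rw [insertState, if_neg fun h => h2 h.1, if_neg fun h => h3 h.1]

theorem exists_lt_succ_or {p : ℕ → Prop} {i : ℕ} : (∃ j < i + 1, p j) ↔ (∃ j < i, p j) ∨ p i := by
  constructor
  · rintro ⟨j, hj, h⟩
    rcases Nat.lt_succ_iff_lt_or_eq.1 hj with h1 | rfl
    · exact Or.inl ⟨j, h1, h⟩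
    · exact Or.inr h
  · rintro (⟨j, hj, h⟩ | h)
    · exact ⟨j, by omega, h⟩
    · exact ⟨i, by omega, h⟩

/-- The vertices must be distinct so that no list counter has changed before it is read; each slot
is then addressed by the old length of its list. -/
theorem insert_sem {v : ℕ → ℕ} (hv : ∀ j ≤ d, s 1 (s 0 4 + j) = v j)
    (hinj : ∀ i ≤ d, ∀ j ≤ d, v i = v j → i = j) :
    (insertP d k).sem lam (mem B s) = mem B (insertState k v s (s 0 4) (d + 1)) ∧
      (insertP d k).bits lam (mem B s) = 0 := by
  have h0 : insertState k v s (s 0 4) 0 = s := by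
    funext c x
    simp [insertState]
  have := sem_forN (lam := lam) (n := d + 1)
    (m := fun i => mem B (insertState k v s (s 0 4) i))
    (p := fun j => .seq (wr 3 (.add (scale (k + 1) (vertE j)) (rd 2 (vertE j))) (rd 0 (.lit 4)))
      (wr 2 (vertE j) (.add (rd 2 (vertE j)) (.lit 1)))) fun i hi => by
      have hb : ∀ m, (vertE i).bits lam m = 0 := fun m => bits_rd (by simp [Expr.bits])
      have e4 : insertState k v s (s 0 4) i 0 4 = s 0 4 :=
        insertState_of_ne (by norm_num) (by norm_num) ..
      have e1 : insertState k v s (s 0 4) i 1 (s 0 4 + i) = v i := by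
        rw [insertState_of_ne (by norm_num) (by norm_num), hv i (by omega)]
      have e2 : insertState k v s (s 0 4) i 2 (v i) = s 2 (v i) := by
        rw [insertState, if_neg, if_neg (by norm_num)]
        rintro ⟨-, j, hj, h⟩
        have := hinj j (by omega) i (by omega) h
        omega
      constructor
      · simp only [Prog.sem, vertE, sem_wr (show 3 < 11 by norm_num),
          sem_wr (show 2 < 11 by norm_num), Expr.eval, eval_rd (show 0 < 11 by norm_num),
          eval_rd (show 1 < 11 by norm_num), eval_rd (show 2 < 11 by norm_num), eval_scale,
          upd_of_ne (show (0 : ℕ) ≠ 3 by norm_num),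
          upd_of_ne (show (1 : ℕ) ≠ 3 by norm_num),
          upd_of_ne (show (2 : ℕ) ≠ 3 by norm_num), e4, e1, e2]
        congr 1
        funext c x
        simp only [upd_apply, insertState, exists_lt_succ_or]
        by_cases c2 : c = 2
        · subst c2
          by_cases hx : x = v i
          · subst hx; simp
          · have hx' : v i ≠ x := Ne.symm hx
            simp [hx, hx']
        · by_cases c3 : c = 3
          · subst c3
            by_cases hx : x = (k + 1) * v i + s 2 (v i)
            · subst hx; simp
            · have hx' : (k + 1) * v i + s 2 (v i) ≠ x := Ne.symm hx
              simp [hx, hx']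
          · simp [c2, c3]
      · simp [Prog.bits, bits_wr, Expr.bits, hb, bits_rd]
  rwa [h0] at this

theorem advance_sem : (advanceP d).sem lam (mem B s) =
    mem B (upd (upd (upd s 0 5 (s 0 5 + mem B s (s 0 5) + 1)) 0 4 (s 0 4 + (d + 1))) 0 6
      (s 0 6 - 1)) ∧ (advanceP d).bits lam (mem B s) = 0 := by
  constructor
  · simp [advanceP, Prog.sem, sem_wr, eval_rd, Expr.eval, upd_apply]
  · simp [advanceP, Prog.bits, bits_wr, Expr.bits]

theorem loopFree_copyP : (copyP d).LoopFree := loopFree_forN fun _ _ => ⟨trivial, trivial⟩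

theorem loopFree_insertP : (insertP d k).LoopFree := loopFree_forN fun _ _ => ⟨trivial, trivial⟩

theorem loopFree_rootP : rootP.LoopFree := by simp [rootP, Prog.LoopFree]

theorem loopFree_advanceP : (advanceP d).LoopFree := by simp [advanceP, Prog.LoopFree]

end RAM

end

/-! ### The invariant of the main loop -/

section

open Finset

namespace RAM

/-- The hypergraph with padded hyperedges. -/
def padGraph (d : ℕ) (sz : ℕ → ℕ) (vt : ℕ → ℕ → ℕ) : HGraph ℕ ℕ :=
  ⟨fun e => univ.image fun j : Fin (d + 1) => padVert d sz vt e j⟩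

variable {lam : ℝ} {B : Base} {n d k ℓ D Λ : ℕ} {sz : ℕ → ℕ} {vt : ℕ → ℕ → ℕ}

/-- Vertex u owns the k + 1 cells starting at (k + 1)u. The degree bound, applied with the new
hyperedge included, shows that an old list has length at most k there, so the new entry stays in its
own block and overwrites nothing. -/
theorem IncidenceLists.insert {H : HGraph ℕ ℕ} {v : ℕ → ℕ} {A : Finset ℕ} {e : ℕ}
    {s : ℕ → ℕ → ℕ} (hI : IncidenceLists H d k A (s 2) (s 3)) (he : e ∉ A)
    (hdeg : H.DegreeLE (k + 1)) (hv : H.edge e = (range (d + 1)).image v) :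
    IncidenceLists H d k (insert e A) (insertState k v s ((d + 1) * e) (d + 1) 2)
      (insertState k v s ((d + 1) * e) (d + 1) 3) := by
  have hmem : ∀ u, (∃ j < d + 1, v j = u) ↔ u ∈ H.edge e := by
    intro u; rw [hv]; simp
  have hlt : ∀ u ∈ H.edge e, s 2 u ≤ k := by
    intro u hu
    rw [hI.card_eq]
    have hsub : ((Insert.insert e (A.filter fun e => u ∈ H.edge e) : Finset ℕ) : Set ℕ) ⊆
        {e | u ∈ H.edge e} := by
      intro g hg
      rcases Finset.mem_insert.1 (Finset.mem_coe.1 hg) with rfl | h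
      · exact hu
      · exact (Finset.mem_filter.1 h).2
    have := (Set.encard_le_encard hsub).trans (hdeg u)
    rw [Set.encard_coe_eq_coe_finsetCard, Finset.card_insert_of_notMem (by simp [he])] at this
    have : (A.filter fun e => u ∈ H.edge e).card + 1 ≤ k + 1 := by exact_mod_cast this
    omega
  have hold : ∀ u i, i < s 2 u →
      insertState k v s ((d + 1) * e) (d + 1) 3 ((k + 1) * u + i) = s 3 ((k + 1) * u + i) := by
    intro u i hi
    have hu := hI.le_of_degreeLE hdeg u
    rw [insertState, if_neg (by norm_num), if_neg]
    rintro ⟨-, j, hj, h⟩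
    have h1 := hlt (v j) ((hmem _).1 ⟨j, hj, rfl⟩)
    have h2 : v j = u := by
      have h3 := congrArg (· / (k + 1)) h
      simpa [Nat.mul_add_div, Nat.div_eq_of_lt (show s 2 (v j) < k + 1 by omega),
        Nat.div_eq_of_lt (show i < k + 1 by omega)] using h3
    rw [h2] at h
    omega
  intro u F
  rw [Finset.filter_insert]
  by_cases hu : u ∈ H.edge e
  · have e2 : insertState k v s ((d + 1) * e) (d + 1) 2 u = s 2 u + 1 := by
      rw [insertState, if_pos ⟨rfl, (hmem u).2 hu⟩]
    have e3 : insertState k v s ((d + 1) * e) (d + 1) 3 ((k + 1) * u + s 2 u) = (d + 1) * e := by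
      obtain ⟨j, hj, hju⟩ := (hmem u).2 hu
      rw [insertState, if_neg (by norm_num), if_pos ⟨rfl, j, hj, by rw [hju]⟩]
    rw [e2, Finset.sum_range_succ, e3, if_pos hu, Finset.sum_insert (by simp [he]), add_comm,
      ← hI u F]
    congr 1
    exact Finset.sum_congr rfl fun i hi => by rw [hold u i (Finset.mem_range.1 hi)]
  · have e2 : insertState k v s ((d + 1) * e) (d + 1) 2 u = s 2 u := by
      rw [insertState, if_neg (fun h => hu ((hmem u).1 h.2)), if_neg (by norm_num)]
    rw [e2, if_neg hu, ← hI u F]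
    exact Finset.sum_congr rfl fun i hi => by rw [hold u i (Finset.mem_range.1 hi)]

/-- The state before the hyperedge `e` is processed; `Acc` relates the hyperedges processed so far
and the results in the registers `7` and `8`. -/
structure Inv (d k n : ℕ) (sz : ℕ → ℕ) (vt : ℕ → ℕ → ℕ) (Acc : ℕ → ℕ → ℕ → Prop) (ℓ D Λ e : ℕ)
    (s : ℕ → ℕ → ℕ) : Prop where
  depth : s 0 1 = ℓ + 2
  den : s 0 2 = D
  init : s 0 3 = Λ
  edge : s 0 4 = (d + 1) * e
  input : s 0 5 = offset sz e
  count : s 0 6 = n - e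
  marks : Marked {0} s
  table : VertexTable (fun e (j : Fin (d + 1)) => padVert d sz vt e j) (range e) (s 1)
  lists : IncidenceLists (padGraph d sz vt) d k (range e) (s 2) (s 3)
  acc : Acc e (s 0 7) (s 0 8)

/-- The bit lengths charged in one step of the recursion. -/
def bitBound (k Λ D : ℕ) : ℕ := Λ + D + (Λ * D + (D + (k + 1) * Λ))

/-- A bound for the time needed for one hyperedge, where `tp` is the time for using the ratio. -/
def edgeTime (d k Λ D ℓ tp : ℕ) : ℕ :=
  (copyP d).wt + rootP.wt + (insertP d k).wt + (advanceP d).wt + 5 +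
    (1 + (d + 1) * (1 + stepBound d k (ℓ + 1)) + 1) *
      (sp.wt + ((step d k).wt + bitBound k Λ D) + 1) + tp

/-- Original vertices receive positive even numbers and padding vertices odd ones, so the two kinds
never collide and 0 stays free for the artificial parent. -/
theorem padVert_injective (hvt : ∀ e, ∀ i < sz e, ∀ j < sz e, vt e i = vt e j → i = j) (e : ℕ) :
    ∀ i ≤ d, ∀ j ≤ d, padVert d sz vt e i = padVert d sz vt e j → i = j := by
  intro i _ j _ h
  unfold padVert at h
  split_ifs at h with h1 h2 h2
  · exact hvt e i h1 j h2 (by omega)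
  · omega
  · omega
  · omega

theorem padVert_ne_zero (e j : ℕ) : padVert d sz vt e j ≠ 0 := by
  unfold padVert; split_ifs <;> omega

/-- The use made of the ratio is left abstract in `post` and `Acc`, so that the product and the
logarithm share the main loop. The hyperedge is inserted only after its ratio relative to the
earlier ones has been computed. -/
theorem edge_runs {Acc : ℕ → ℕ → ℕ → Prop} {post : Prog} {tp : ℕ} {δ : ℝ}
    (hL : Lists B.low n sz vt)
    (hvt : ∀ e, ∀ i < sz e, ∀ j < sz e, vt e i = vt e j → i = j)
    (hdeg : (padGraph d sz vt).DegreeLE (k + 1))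
    (hratio : ∀ e < n, ∀ VT DEG INC,
      VertexTable (fun e (j : Fin (d + 1)) => padVert d sz vt e j) (insert e (range e)) VT →
      IncidenceLists (padGraph d sz vt) d k (range e) DEG INC →
      |(foldR VT Λ D (csum VT DEG INC Λ D d k (ℓ + 1)) {0} 0 ((d + 1) * e) (d + 1) / D : ℝ) -
        (padGraph d sz vt).ratio lam (range e) e| ≤ δ)
    (hpost : ∀ e < n, ∀ s, s 0 2 = D → Acc e (s 0 7) (s 0 8) → s 9 0 ≤ Λ →
      |(s 9 0 / D : ℝ) - (padGraph d sz vt).ratio lam (range e) e| ≤ δ →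
      ∃ s', Runs lam post (mem B s) (mem B s') tp ∧
        (∀ c x, ¬ (c = 0 ∧ 7 ≤ x) → s' c x = s c x) ∧ Acc (e + 1) (s' 0 7) (s' 0 8))
    {e : ℕ} (he : e < n) {s : ℕ → ℕ → ℕ} (hs : Inv d k n sz vt Acc ℓ D Λ e s) :
    ∃ s', Runs lam (edgeP d k post) (mem B s) (mem B s') (edgeTime d k Λ D ℓ tp) ∧
      Inv d k n sz vt Acc ℓ D Λ (e + 1) s' := by
  set v := padVert d sz vt e with hv
  set s1 := copyState v s ((d + 1) * e) (d + 1) with hs1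
  have r1 := runs_of_sem (lam := lam) (β := 0) loopFree_copyP
    (copy_sem (s := s) hL he hs.edge hs.input).1 (copy_sem (s := s) hL he hs.edge hs.input).2.le
  rw [← hv, ← hs1] at r1
  have a1 : ∀ c x, c ≠ 1 → s1 c x = s c x := fun c x hc => by
    rw [hs1, copyState, if_neg fun h => hc h.1]
  have ht1 : VertexTable (fun e (j : Fin (d + 1)) => padVert d sz vt e j) (insert e (range e))
      (s1 1) := by
    intro e' he' j
    rcases Finset.mem_insert.1 he' with rfl | h
    · rw [hs1, copyState, if_pos ⟨rfl, by omega, by omega⟩, Nat.add_sub_cancel_left]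
    · have h2 : (d + 1) * (e' + 1) ≤ (d + 1) * e := by
        gcongr; exact Finset.mem_range.1 h
      rw [hs1, copyState, if_neg (by rintro ⟨-, h3, -⟩; rw [mul_add] at h2; omega)]
      exact hs.table e' h j
  obtain ⟨b1, b2⟩ := root_sem (lam := lam) (B := B) (s := s1)
  have r2 := runs_of_sem (β := 0) loopFree_rootP b1 b2.le
  rw [a1 0 4 (by norm_num), a1 0 3 (by norm_num), hs.edge, hs.init] at r2
  set s2 := upd (upd (upd (upd (upd (upd (upd (upd s1 5 1 ((d + 1) * e)) 6 1 0) 7 1 0) 8 1 0) 9 1 0)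
    10 1 Λ) 9 0 0) 0 0 1 with hs2
  have a2 : ∀ c x, c < 5 → ¬ (c = 0 ∧ x = 0) → s2 c x = s1 c x := fun c x hc h0 => by
    rw [hs2, upd_of_not h0, upd_of_ne (by omega), upd_of_ne (by omega), upd_of_ne (by omega),
      upd_of_ne (by omega), upd_of_ne (by omega), upd_of_ne (by omega), upd_of_ne (by omega)]
  have hI : IncidenceLists (padGraph d sz vt) d k (range e) (s2 2) (s2 3) := by
    have h2 : s2 2 = s 2 := by funext x; rw [a2 2 x (by norm_num) (by omega), a1 2 x (by norm_num)]
    have h3 : s2 3 = s 3 := by funext x; rw [a2 3 x (by norm_num) (by omega), a1 3 x (by norm_num)]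
    rw [h2, h3]; exact hs.lists
  have h21 : s2 1 = s1 1 := by funext x; exact a2 1 x (by norm_num) (by omega)
  have ht2 : VertexTable (fun e (j : Fin (d + 1)) => padVert d sz vt e j) (insert e (range e))
      (s2 1) := h21 ▸ ht1
  -- The root occupies frame 1 with depth ℓ + 1 left, which explains the depth register ℓ + 2. Frame
  -- 0 is a dummy whose sum receives the result, and stack pointer 0 ends the loop.
  obtain ⟨s3, p3, h3⟩ := callSpec (lam := lam) (B := B) (VT := s2 1) (DEG := s2 2) (INC := s2 3)
    (hI.le_of_degreeLE hdeg)
    (fun u i hi => hI.exists_vertex (fun f => rfl) (ht2.subset (Finset.subset_insert _ _)) hi)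
    (show Λ + D + (Λ * D + (D + (k + 1) * Λ)) ≤ bitBound k Λ D from le_rfl) (ℓ + 1) s2 1 {0} 0
    ((d + 1) * e) (by simp [hs2, upd_apply]) le_rfl
    (by rw [a2 0 1 (by norm_num) (by norm_num), a1 0 1 (by norm_num), hs.depth]; ring)
    ⟨rfl, rfl, rfl, by rw [a2 0 2 (by norm_num) (by norm_num), a1 0 2 (by norm_num), hs.den],
      by rw [a2 0 3 (by norm_num) (by norm_num), a1 0 3 (by norm_num), hs.init]⟩
    (fun x => by rw [a2 4 x (by norm_num) (by norm_num), a1 4 x (by norm_num)]; exact hs.marks x)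
    (by simp) (fun j _ h => Finset.mem_singleton.1 h) (by simp [Frame, hs2, upd_apply])
  have hR := hratio e he (s2 1) (s2 2) (s2 3) ht2 hI
  set R := foldR (s2 1) Λ D (csum (s2 1) (s2 2) (s2 3) Λ D d k (ℓ + 1)) {0} 0 ((d + 1) * e) (d + 1)
    with hRdef
  have a3 : ∀ c x, c < 5 → ¬ (c = 0 ∧ x = 0) → s3 c x = s2 c x := fun c x hc h0 => by
    rw [h3 c x (by omega), upd_of_ne (by omega), upd_of_ne (by omega), upd_of_not h0]
  have a4 : ∀ c x, c < 5 → c ≠ 1 → ¬ (c = 0 ∧ x = 0) → s3 c x = s c x := fun c x hc h1 h0 => by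
    rw [a3 c x hc h0, a2 c x hc h0, a1 c x h1]
  have h39 : s3 9 0 = R := by
    rw [h3 9 0 (by omega)]
    simp [upd_apply, hs2]
  have r3 := p3.runs (fun _ => bits_sp) (by rw [eval_sp, h3 0 0 (by omega)]; simp [upd_apply])
  have hvert : ∀ f, (padGraph d sz vt).edge f =
    univ.image (fun j : Fin (d + 1) => padVert d sz vt f j) := fun f => rfl
  have hinj : ∀ f, Function.Injective fun j : Fin (d + 1) => padVert d sz vt f j :=
    fun f i j h => Fin.ext (padVert_injective hvt f i (by omega) j (by omega) h)
  have hsteps := foldT_root_le hvert hinj (by simp) ht2 hI hdeg (ℓ + 1) (K := {0}) (p := 0)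
    ⟨by simp, fun j hj => absurd (Finset.mem_singleton.1 hj) (padVert_ne_zero e j)⟩
  obtain ⟨s4, r4, h4, hacc⟩ := hpost e he s3
    (by rw [a4 0 2 (by norm_num) (by norm_num) (by norm_num), hs.den])
    (by
      rw [a4 0 7 (by norm_num) (by norm_num) (by norm_num),
        a4 0 8 (by norm_num) (by norm_num) (by norm_num)]
      exact hs.acc)
    (by rw [h39]; exact foldR_le ..) (by rw [h39]; exact hR)
  have h41 : s4 1 = s1 1 := by
    funext x
    rw [h4 1 x (by omega), a3 1 x (by norm_num) (by omega), h21]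
  have h42 : s4 2 = s2 2 := by
    funext x; rw [h4 2 x (by omega), a3 2 x (by norm_num) (by omega)]
  have h43 : s4 3 = s2 3 := by
    funext x; rw [h4 3 x (by omega), a3 3 x (by norm_num) (by omega)]
  have h44 : s4 0 4 = (d + 1) * e := by
    rw [h4 0 4 (by omega), a4 0 4 (by norm_num) (by norm_num) (by norm_num), hs.edge]
  obtain ⟨c1, c2⟩ := insert_sem (lam := lam) (B := B) (k := k) (v := v) (s := s4) (d := d)
    (fun j hj => by
      rw [h41, h44]
      exact ht1 e (Finset.mem_insert_self _ _) ⟨j, by omega⟩) (padVert_injective hvt e)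
  have r5 := runs_of_sem (β := 0) loopFree_insertP c1 c2.le
  rw [h44] at r5
  set s5 := insertState k v s4 ((d + 1) * e) (d + 1) with hs5
  have a5 : ∀ c x, c ≠ 2 → c ≠ 3 → s5 c x = s4 c x := fun c x h2 h3 =>
    insertState_of_ne h2 h3 ..
  obtain ⟨f1, f2⟩ := advance_sem (lam := lam) (B := B) (d := d) (s := s5)
  have r6 := runs_of_sem (β := 0) loopFree_advanceP f1 f2.le
  have e5 : s5 0 5 = offset sz e := by
    rw [a5 0 5 (by norm_num) (by norm_num), h4 0 5 (by omega),
      a4 0 5 (by norm_num) (by norm_num) (by norm_num), hs.input]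
  have e4 : s5 0 4 = (d + 1) * e := by rw [a5 0 4 (by norm_num) (by norm_num), h44]
  have e6 : s5 0 6 = n - e := by
    rw [a5 0 6 (by norm_num) (by norm_num), h4 0 6 (by omega),
      a4 0 6 (by norm_num) (by norm_num) (by norm_num), hs.count]
  rw [e5, (mem_offset hL he).1, e4, e6] at r6
  have a6 : ∀ c x, c ≠ 2 → c ≠ 3 → ¬ (c = 0 ∧ 4 ≤ x ∧ x ≤ 6) →
      upd (upd (upd s5 0 5 (offset sz e + sz e + 1)) 0 4 ((d + 1) * e + (d + 1))) 0 6
        (n - e - 1) c x = s4 c x := fun c x h2 h3 h0 => by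
    rw [upd_of_not (by omega), upd_of_not (by omega), upd_of_not (by omega), a5 c x h2 h3]
  refine ⟨_, ((r1.seq (r2.seq (r3.seq (r4.seq (r5.seq r6))))).mono ?_), ?_⟩
  · have : (1 + foldT (s2 1) (tsum (s2 1) (s2 2) (s2 3) d k (ℓ + 1)) {0} 0 ((d + 1) * e) (d + 1)
        + 1) * (sp.wt + ((step d k).wt + bitBound k Λ D) + 1) ≤
        (1 + (d + 1) * (1 + stepBound d k (ℓ + 1)) + 1) *
          (sp.wt + ((step d k).wt + bitBound k Λ D) + 1) := by gcongr
    rw [edgeTime]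
    omega
  · have g : ∀ x, x ≠ 0 → ¬ (4 ≤ x ∧ x ≤ 6) → x < 7 →
      upd (upd (upd s5 0 5 (offset sz e + sz e + 1)) 0 4 ((d + 1) * e + (d + 1))) 0 6
        (n - e - 1) 0 x = s 0 x := fun x h0 h1 h2 => by
      rw [a6 0 x (by norm_num) (by norm_num) (by omega), h4 0 x (by omega),
        a4 0 x (by norm_num) (by norm_num) (by omega)]
    refine ⟨?_, ?_, ?_, ?_, ?_, ?_, ?_, ?_, ?_, ?_⟩
    · rw [g 1 (by norm_num) (by norm_num) (by norm_num), hs.depth]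
    · rw [g 2 (by norm_num) (by norm_num) (by norm_num), hs.den]
    · rw [g 3 (by norm_num) (by norm_num) (by norm_num), hs.init]
    · simp [upd_apply, mul_add]
    · simp [upd_apply, offset, Finset.sum_range_succ]; ring
    · simp only [upd_self]; omega
    · intro x
      rw [a6 4 x (by norm_num) (by norm_num) (by omega), h4 4 x (by omega),
        a4 4 x (by norm_num) (by norm_num) (by omega)]
      exact hs.marks x
    · rw [Finset.range_add_one]
      have : upd (upd (upd s5 0 5 (offset sz e + sz e + 1)) 0 4 ((d + 1) * e + (d + 1))) 0 6
          (n - e - 1) 1 = s1 1 := by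
        rw [← h41]; funext x; exact a6 1 x (by norm_num) (by norm_num) (by omega)
      rw [this]; exact ht1
    · rw [Finset.range_add_one]
      have w2 : upd (upd (upd s5 0 5 (offset sz e + sz e + 1)) 0 4 ((d + 1) * e + (d + 1))) 0 6
          (n - e - 1) 2 = s5 2 := by
        funext x
        rw [upd_of_ne (by norm_num), upd_of_ne (by norm_num), upd_of_ne (by norm_num)]
      have w3 : upd (upd (upd s5 0 5 (offset sz e + sz e + 1)) 0 4 ((d + 1) * e + (d + 1))) 0 6
          (n - e - 1) 3 = s5 3 := by
        funext x
        rw [upd_of_ne (by norm_num), upd_of_ne (by norm_num), upd_of_ne (by norm_num)]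
      rw [w2, w3, hs5]
      refine IncidenceLists.insert ?_ (by simp) hdeg ?_
      · rw [h42, h43]; exact hI
      · ext u
        simp only [padGraph, Finset.mem_image, Finset.mem_univ, true_and, Finset.mem_range]
        exact ⟨fun ⟨j, hj⟩ => ⟨j, j.isLt, hj⟩, fun ⟨j, hj, hju⟩ => ⟨⟨j, hj⟩, hju⟩⟩
    · rw [a6 0 7 (by norm_num) (by norm_num) (by omega),
        a6 0 8 (by norm_num) (by norm_num) (by omega)]
      exact hacc

end RAM

end

/-! ### The complete program -/

section

open Finset

namespace RAM

/-- Compute the rounded inverse `r` of the accuracy in cell `2`. -/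
def inverseP : Prog :=
  .seq (.store (.lit 2) (.lit 0)) (.loop (.load (.lit 1))
    (.seq (.store (.lit 1) (.sub (.load (.lit 1)) (.load (.lit 0))))
      (.store (.lit 2) (.add (.load (.lit 2)) (.lit 1)))))

/-- Compute the length of the input in cell `0`. -/
def lengthP : Prog :=
  .seq (.seq (.store (.lit 0) (.lit 4)) (.store (.lit 1) (.load (.lit 3)))) (.loop (.load (.lit 1))
    (.seq (.store (.lit 0) (.add (.add (.load (.lit 0)) (.load (.load (.lit 0)))) (.lit 1)))
      (.store (.lit 1) (.sub (.load (.lit 1)) (.lit 1)))))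

/-- Initialize the registers, after `setup` has found the depth, the denominator and the initial
values of the results. -/
def initP : Prog :=
  .seq (wr 0 (.lit 3) (.query (rd 0 (.lit 2)))) (.seq (wr 0 (.lit 4) (.lit 0))
    (.seq (wr 0 (.lit 5) (.lit 4)) (.seq (wr 0 (.lit 6) (.load (.lit 3)))
      (wr 4 (.lit 0) (.lit 1)))))

/-- Move the results to the cells `0` and `1`. -/
def outputP : Prog :=
  .seq (.store (.lit 1) (rd 0 (.lit 8))) (.store (.lit 0) (rd 0 (.lit 7)))

/-- The algorithm. -/
def mainP (d k : ℕ) (setup post : Prog) : Prog :=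
  .seq inverseP (.seq lengthP (.seq setup (.seq initP (.seq (.loop (rd 0 (.lit 6)) (edgeP d k post))
    outputP))))

variable {lam : ℝ} {n d k ℓ D Λ : ℕ} {sz : ℕ → ℕ} {vt : ℕ → ℕ → ℕ}

/-- Together the two hypotheses say that r is the ceiling of `M 1 / M 0`. Truncated subtraction
brings the counter to 0 after exactly r rounds. -/
theorem inverseP_runs {M : ℕ → ℕ} {r : ℕ} (h1 : M 1 ≤ r * M 0) (h2 : ∀ i < r, i * M 0 < M 1) :
    Runs lam inverseP M (fun x => if x = 1 then 0 else if x = 2 then r else M x)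
      (30 * (r + 1)) := by
  set m : ℕ → ℕ → ℕ := fun i x => if x = 1 then M 1 - i * M 0 else if x = 2 then i else M x with hm
  have e0 : Runs lam (.store (.lit 2) (.lit 0)) M (m 0) (3 + 0) := by
    refine runs_of_sem (by simp [Prog.LoopFree]) ?_ le_rfl
    funext x
    simp only [Prog.sem, Expr.eval, Function.update_apply, hm]
    split_ifs <;> simp_all
  have e1 := Path.of_forall (lam := lam) (g := .load (.lit 1)) (β := 14 + 0) (m := m) (p :=
    .seq (.store (.lit 1) (.sub (.load (.lit 1)) (.load (.lit 0))))
      (.store (.lit 2) (.add (.load (.lit 2)) (.lit 1)))) r fun i hi => by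
    refine ⟨?_, runs_of_sem
      (show Prog.LoopFree (.seq (.store _ _) (.store _ _)) from ⟨trivial, trivial⟩) ?_ le_rfl⟩
    · have := h2 i hi
      simp [Expr.eval, hm]; omega
    · funext x
      simp only [Prog.sem, Expr.eval, Function.update_apply, hm]
      by_cases hx2 : x = 2
      · subst hx2; simp
      · by_cases hx1 : x = 1
        · subst hx1
          simp [Nat.add_mul, Nat.sub_sub]
        · simp [hx1, hx2]
  have e2 := e1.runs (fun _ => rfl) (by simp [Expr.eval, hm]; omega)
  have e3 : m r = fun x => if x = 1 then 0 else if x = 2 then r else M x := by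
    funext x
    simp only [hm]
    split_ifs <;> omega
  rw [e3] at e2
  exact (e0.seq e2).mono (by simp only [Expr.wt]; omega)

theorem lengthP_runs {M : ℕ → ℕ} (h3 : M 3 = n) (hM : ∀ e < n, M (offset sz e) = sz e) :
    Runs lam lengthP M (fun x => if x = 0 then offset sz n else if x = 1 then 0 else M x)
      (30 * (n + 1)) := by
  set m : ℕ → ℕ → ℕ := fun i x => if x = 0 then offset sz i else if x = 1 then n - i else M x
    with hm
  have e0 : Runs lam (.seq (.store (.lit 0) (.lit 4)) (.store (.lit 1) (.load (.lit 3)))) M (m 0)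
      (8 + 0) := by
    refine runs_of_sem (by simp [Prog.LoopFree]) ?_ le_rfl
    funext x
    simp only [Prog.sem, Expr.eval, Function.update_apply, hm, offset]
    split_ifs <;> simp_all
  have e1 := Path.of_forall (lam := lam) (g := .load (.lit 1)) (β := 17 + 0) (m := m) (p :=
    .seq (.store (.lit 0) (.add (.add (.load (.lit 0)) (.load (.load (.lit 0)))) (.lit 1)))
      (.store (.lit 1) (.sub (.load (.lit 1)) (.lit 1)))) n fun i hi => by
    refine ⟨?_, runs_of_sem
      (show Prog.LoopFree (.seq (.store _ _) (.store _ _)) from ⟨trivial, trivial⟩) ?_ le_rfl⟩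
    · simp [Expr.eval, hm]; omega
    · have h4 : ¬ offset sz i = 0 ∧ ¬ offset sz i = 1 := by unfold offset; omega
      funext x
      simp only [Prog.sem, Expr.eval, Function.update_apply, hm]
      by_cases hx0 : x = 0
      · subst hx0
        have h5 : offset sz (i + 1) = offset sz i + (sz i + 1) := by
          simp only [offset, Finset.sum_range_succ]; omega
        simp [h4, hM i hi, h5, add_assoc]
      · by_cases hx1 : x = 1
        · subst hx1; simp [Nat.sub_sub]
        · simp [hx0, hx1]
  have e2 := e1.runs (fun _ => rfl) (by simp [Expr.eval, hm])
  have e3 : m n = fun x => if x = 0 then offset sz n else if x = 1 then 0 else M x := by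
    funext x
    simp only [hm]
    split_ifs <;> omega
  rw [e3] at e2
  exact (e0.seq e2).mono (by simp only [Expr.wt]; omega)

theorem four_le_offset (sz : ℕ → ℕ) (e : ℕ) : 4 ≤ offset sz e := by unfold offset; omega

theorem main_runs {Acc : ℕ → ℕ → ℕ → Prop} {setup post : Prog} {tc tp r : ℕ} {δ : ℝ} {M : ℕ → ℕ}
    (h1 : M 1 ≤ r * M 0) (h2 : ∀ i < r, i * M 0 < M 1) (h3 : M 3 = n)
    (hM : ∀ e < n, M (offset sz e) = sz e ∧ ∀ j < sz e, M (offset sz e + (j + 1)) = vt e j)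
    (hM0 : ∀ x, offset sz n ≤ x → M x = 0)
    (hvt : ∀ e, ∀ i < sz e, ∀ j < sz e, vt e i = vt e j → i = j)
    (hdeg : (padGraph d sz vt).DegreeLE (k + 1)) (hΛ : Λ = ⌊lam * D⌋₊)
    (hratio : ∀ e < n, ∀ VT DEG INC,
      VertexTable (fun e (j : Fin (d + 1)) => padVert d sz vt e j) (insert e (range e)) VT →
      IncidenceLists (padGraph d sz vt) d k (range e) DEG INC →
      |(foldR VT Λ D (csum VT DEG INC Λ D d k (ℓ + 1)) {0} 0 ((d + 1) * e) (d + 1) / D : ℝ) -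
        (padGraph d sz vt).ratio lam (range e) e| ≤ δ)
    (hsetup : ∀ B : Base, B.low 2 = r → B.low 3 = n → 4 ≤ B.low 0 → ∃ s,
      Runs lam setup (mem B fun _ _ => 0) (mem B s) tc ∧ s 0 1 = ℓ + 2 ∧ s 0 2 = D ∧
      (∀ c x, c ≠ 0 → s c x = 0) ∧ Acc 0 (s 0 7) (s 0 8))
    (hpost : ∀ B : Base, ∀ e < n, ∀ s, s 0 2 = D → Acc e (s 0 7) (s 0 8) → s 9 0 ≤ Λ →
      |(s 9 0 / D : ℝ) - (padGraph d sz vt).ratio lam (range e) e| ≤ δ →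
      ∃ s', Runs lam post (mem B s) (mem B s') tp ∧
        (∀ c x, ¬ (c = 0 ∧ 7 ≤ x) → s' c x = s c x) ∧ Acc (e + 1) (s' 0 7) (s' 0 8)) :
    ∃ m t, t ≤ 30 * (r + 1) + 30 * (n + 1) + tc + (initP.wt + D) +
        (n + 1) * ((rd 0 (.lit 6)).wt + edgeTime d k Λ D ℓ tp + 1) + outputP.wt + 5 ∧
      Exec lam (mainP d k setup post) M m t ∧ Acc n (m 0) (m 1) := by
  have r1 := inverseP_runs (lam := lam) h1 h2
  set M1 : ℕ → ℕ := fun x => if x = 1 then 0 else if x = 2 then r else M x with hM1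
  have a1 : ∀ x, 3 ≤ x → M1 x = M x := fun x hx => by
    simp only [hM1]; rw [if_neg (by omega), if_neg (by omega)]
  have ho := four_le_offset sz
  have r2 := lengthP_runs (lam := lam) (M := M1) (n := n) (sz := sz) (by rw [a1 3 le_rfl, h3])
    fun e he => by rw [a1 _ (by linarith [ho e]), (hM e he).1]
  set M2 : ℕ → ℕ := fun x => if x = 0 then offset sz n else if x = 1 then 0 else M1 x with hM2
  have a2 : ∀ x, 3 ≤ x → M2 x = M x := fun x hx => by
    simp only [hM2]; rw [if_neg (by omega), if_neg (by omega), a1 x hx]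
  have b0 : M2 0 = offset sz n := by simp [hM2]
  let B : Base := ⟨M2, by rw [b0]; linarith [ho n]⟩
  -- The arrays begin right behind the input, where the memory still holds zeros; the input length
  -- found in cell 0 is their base address.
  have hB : M2 = mem B fun _ _ => 0 := by
    funext x
    simp only [mem]
    split_ifs with hx
    · rfl
    · have hx' : offset sz n ≤ x := by
        have : ¬ x < M2 0 := hx
        omega
      rw [a2 x (by linarith [ho n]), hM0 x hx']
  have hL : Lists B.low n sz vt := by
    refine ⟨b0, fun e he => ⟨?_, fun j hj => ?_⟩⟩
    · exact (a2 _ (by linarith [ho e])).trans (hM e he).1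
    · exact (a2 _ (by linarith [ho e])).trans ((hM e he).2 j hj)
  have hB3 : B.low 3 = n := (a2 3 le_rfl).trans h3
  have hB0 : 4 ≤ B.low 0 := by rw [hL.1]; exact ho n
  obtain ⟨s, r3, s1, s2, s3, s4⟩ := hsetup B (by simp [B, hM2, hM1]) hB3 hB0
  rw [← hB] at r3
  have i1 : initP.sem lam (mem B s) = mem B (upd (upd (upd (upd (upd s 0 3 Λ) 0 4 0) 0 5 4) 0 6 n)
      4 0 1) := by
    have hlow : ∀ s', mem B s' 3 = n := fun s' => by rw [mem_low (by omega), hB3]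
    simp [initP, Prog.sem, sem_wr, eval_rd, Expr.eval, hlow, s2, hΛ]
  have i2 : initP.bits lam (mem B s) ≤ D := by
    simp only [initP, Prog.bits, bits_wr, Expr.bits, eval_rd (show 0 < 11 by norm_num), Expr.eval,
      s2, bits_rd_lit]
    have := size_le_self D
    omega
  have r4 := runs_of_sem (by simp [initP, Prog.LoopFree]) i1 i2
  have hinv : Inv d k n sz vt Acc ℓ D Λ 0
      (upd (upd (upd (upd (upd s 0 3 Λ) 0 4 0) 0 5 4) 0 6 n) 4 0 1) := by
    refine ⟨?_, ?_, ?_, ?_, ?_, ?_, ?_, ?_, ?_, ?_⟩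
    · simp [upd_apply, s1]
    · simp [upd_apply, s2]
    · simp [upd_apply]
    · simp [upd_apply]
    · simp [upd_apply, offset]
    · simp [upd_apply]
    · intro x
      simp [upd_apply, s3 4 x (by norm_num)]
    · intro e he; simp at he
    · intro u F
      simp [upd_apply, s3 2 u (by norm_num)]
    · simpa [upd_apply] using s4
  obtain ⟨m', p5, s', rfl, hs'⟩ := Path.of_invariant (lam := lam) (g := rd 0 (.lit 6))
    (p := edgeP d k post) (β := edgeTime d k Λ D ℓ tp)
    (I := fun e m => ∃ s, m = mem B s ∧ Inv d k n sz vt Acc ℓ D Λ e s) n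
    (by
      rintro e he m ⟨s, rfl, hs⟩
      refine ⟨?_, ?_⟩
      · rw [eval_rd (by norm_num), Expr.eval, hs.count]; omega
      · obtain ⟨s', h1, h2⟩ := edge_runs hL hvt hdeg hratio (hpost B) he hs
        exact ⟨_, h1, s', rfl, h2⟩)
    ⟨_, rfl, hinv⟩
  have r5 := p5.runs (fun _ => bits_rd_lit)
    (by rw [eval_rd (by norm_num), Expr.eval, hs'.count]; omega)
  have r6 := runs_of_sem (lam := lam) (p := outputP) (m := mem B s') (β := 0)
    ⟨trivial, trivial⟩ rfl (by simp [outputP, Prog.bits, Expr.bits])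
  obtain ⟨t, ht, hexec⟩ := r1.seq (r2.seq (r3.seq (r4.seq (r5.seq r6))))
  refine ⟨_, t, ht.trans (by omega), hexec, ?_⟩
  have o1 : outputP.sem lam (mem B s') 1 = s' 0 8 := by
    simp only [outputP, Prog.sem, Expr.eval, eval_rd (show 0 < 11 by norm_num)]
    simp
  -- Cell 0 holds the base address of the arrays and must be overwritten last; the earlier write to
  -- cell 1 does not disturb the addressing.
  have o0 : outputP.sem lam (mem B s') 0 = s' 0 7 := by
    have h7 : mem B s' (B.low 0 + 0 + 11 * 7) = s' 0 7 := by
      rw [mem, if_neg (by omega)]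
      congr 1 <;> omega
    simp only [outputP, Prog.sem, Expr.eval, Function.update_self, rd, addr, eval_scale]
    rw [Function.update_of_ne (show (0 : ℕ) ≠ 1 by norm_num), mem_zero,
      Function.update_of_ne (by omega), h7]
  rw [o0, o1]
  exact hs'.acc

end RAM

end

/-! ### Input encoding and the padded hypergraph -/

section

open Finset

theorem List.length_flatMap_range (L : ℕ → List ℕ) (n : ℕ) :
    ((List.range n).flatMap L).length = ∑ i ∈ Finset.range n, (L i).length := by
  induction n with
  | zero => simp
  | succ n ih =>
    rw [List.range_succ, List.flatMap_append, List.length_append, ih, Finset.sum_range_succ]; simp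

theorem List.getD_flatMap_range (L : ℕ → List ℕ) {n e j : ℕ} (he : e < n) (hj : j < (L e).length) :
    ((List.range n).flatMap L).getD (∑ i ∈ Finset.range e, (L i).length + j) 0 =
      (L e).getD j 0 := by
  have hlen := List.length_flatMap_range L
  induction n with
  | zero => omega
  | succ n ih =>
    rw [List.range_succ, List.flatMap_append]
    by_cases hen : e < n
    · rw [List.getD_append, ih hen]
      rw [hlen]
      have h1 : ∑ i ∈ Finset.range (e + 1), (L i).length ≤ ∑ i ∈ Finset.range n, (L i).length :=
        Finset.sum_le_sum_of_subset (Finset.range_mono hen)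
      rw [Finset.sum_range_succ] at h1
      omega
    · obtain rfl : e = n := by omega
      rw [List.getD_append_right, hlen, Nat.add_sub_cancel_left]
      · simp
      · rw [hlen]; omega

namespace HGraph

variable {N n : ℕ} (H : HGraph (Fin N) (Fin n)) {d k : ℕ}

/-- The size of the hyperedge `e`. -/
def sizeAt (e : ℕ) : ℕ := if h : e < n then (H.edge ⟨e, h⟩).card else 0

/-- The vertices of the hyperedge `e` in increasing order. -/
noncomputable def listAt (e : ℕ) : List ℕ :=
  if h : e < n then ((H.edge ⟨e, h⟩).sort (· ≤ ·)).map Fin.val else []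

/-- The vertex `j` of the hyperedge `e`. -/
noncomputable def vertexAt (e j : ℕ) : ℕ := (H.listAt e).getD j 0

theorem length_listAt (e : ℕ) : (H.listAt e).length = H.sizeAt e := by
  unfold listAt sizeAt
  split_ifs <;> simp

theorem nodup_listAt (e : ℕ) : (H.listAt e).Nodup := by
  unfold listAt
  split_ifs
  · exact (Finset.sort_nodup _ _).map Fin.val_injective
  · exact List.nodup_nil

theorem vertexAt_eq {e j : ℕ} (hj : j < H.sizeAt e) :
    H.vertexAt e j = (H.listAt e)[j]'(by rwa [H.length_listAt]) :=
  List.getD_eq_getElem _ _ _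

theorem vertexAt_inj (e i : ℕ) (hi : i < H.sizeAt e) (j : ℕ) (hj : j < H.sizeAt e)
    (h : H.vertexAt e i = H.vertexAt e j) : i = j := by
  rw [vertexAt_eq H hi, vertexAt_eq H hj] at h
  exact (H.nodup_listAt e).getElem_inj_iff.1 h

theorem mem_listAt (e : Fin n) (x : ℕ) : x ∈ H.listAt e ↔ ∃ v ∈ H.edge e, v.val = x := by
  simp [listAt]

theorem exists_vertexAt_iff (e : Fin n) (x : ℕ) :
    (∃ j < H.sizeAt e, H.vertexAt e j = x) ↔ ∃ v ∈ H.edge e, v.val = x := by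
  rw [← mem_listAt, List.mem_iff_getElem]
  constructor
  · rintro ⟨j, hj, h⟩
    exact ⟨j, by rwa [H.length_listAt], by rw [← h, vertexAt_eq H hj]⟩
  · rintro ⟨j, hj, h⟩
    rw [H.length_listAt] at hj
    exact ⟨j, hj, by rw [← h, vertexAt_eq H hj]⟩

theorem encodeInput_eq (a b : ℕ) : encodeInput H a b =
    [a, b, N, n] ++ (List.range n).flatMap fun e => H.sizeAt e :: H.listAt e := by
  rw [encodeInput, ← List.map_coe_finRange_eq_range, List.flatMap_map]
  congr 2
  funext e
  simp [sizeAt, listAt]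

theorem sizeAt_of_le {e : ℕ} (he : n ≤ e) : H.sizeAt e = 0 := dif_neg (by omega)

theorem inputMemory_offset (a b : ℕ) {e : ℕ} (he : e < n) :
    inputMemory H a b (RAM.offset H.sizeAt e) = H.sizeAt e ∧ ∀ j < H.sizeAt e,
      inputMemory H a b (RAM.offset H.sizeAt e + (j + 1)) = H.vertexAt e j := by
  have key : ∀ j < H.sizeAt e + 1, inputMemory H a b (RAM.offset H.sizeAt e + j) =
      (H.sizeAt e :: H.listAt e).getD j 0 := by
    intro j hj
    have h1 := List.getD_flatMap_range (fun e => H.sizeAt e :: H.listAt e) (j := j) he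
      (by simpa [H.length_listAt] using hj)
    simp only [List.length_cons, H.length_listAt] at h1
    rw [inputMemory, encodeInput_eq, List.getD_append_right _ _ _ _ (by simp [RAM.offset]; omega),
      ← h1]
    congr 1
    simp [RAM.offset]; omega
  refine ⟨key 0 (by omega), fun j hj => ?_⟩
  rw [key (j + 1) (by omega), List.getD_cons_succ]
  rfl

theorem inputMemory_of_le (a b : ℕ) {x : ℕ} (hx : RAM.offset H.sizeAt n ≤ x) :
    inputMemory H a b x = 0 := by
  refine List.getD_eq_default _ _ (le_trans (le_of_eq ?_) hx)
  rw [encodeInput_eq, RAM.offset, List.length_append, List.length_flatMap_range]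
  simp [H.length_listAt]

theorem mem_padGraph_even {e v : ℕ} (hs : H.sizeAt e ≤ d + 1) :
    2 * v + 2 ∈ (RAM.padGraph d H.sizeAt H.vertexAt).edge e ↔
      ∃ j < H.sizeAt e, H.vertexAt e j = v := by
  simp only [RAM.padGraph, Finset.mem_image, Finset.mem_univ, true_and, RAM.padVert]
  constructor
  · rintro ⟨j, hj⟩
    split_ifs at hj with h
    · exact ⟨j, h, by omega⟩
    · omega
  · rintro ⟨j, hj, h⟩
    exact ⟨⟨j, by omega⟩, by rw [if_pos hj, h]⟩

/-- The number of a padding vertex encodes its hyperedge as a quotient by d + 1, so it belongs to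
that hyperedge alone. -/
theorem eq_of_mem_padGraph_odd {e x : ℕ}
    (h : 2 * x + 1 ∈ (RAM.padGraph d H.sizeAt H.vertexAt).edge e) : e = x / (d + 1) := by
  simp only [RAM.padGraph, Finset.mem_image, Finset.mem_univ, true_and, RAM.padVert] at h
  obtain ⟨j, hj⟩ := h
  split_ifs at hj
  · omega
  · have : x = (d + 1) * e + j := by omega
    rw [this, Nat.mul_add_div (by omega), Nat.div_eq_of_lt j.isLt, add_zero]

theorem zero_notMem_padGraph (e : ℕ) :
    0 ∉ (RAM.padGraph d H.sizeAt H.vertexAt).edge e := by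
  simp [RAM.padGraph, RAM.padVert_ne_zero]

theorem sizeAt_le (hs : H.EdgeSizeLE (d + 1)) (e : ℕ) : H.sizeAt e ≤ d + 1 := by
  unfold sizeAt
  split_ifs
  · exact hs _
  · omega

theorem degreeLE_padGraph (hs : H.EdgeSizeLE (d + 1)) (hdeg : H.DegreeLE (k + 1)) :
    (RAM.padGraph d H.sizeAt H.vertexAt).DegreeLE (k + 1) := by
  intro u
  rcases Nat.even_or_odd' u with ⟨v, rfl | rfl⟩
  · rcases v with _ | v
    · simp [zero_notMem_padGraph]
    · by_cases hv : v < N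
      · have hsub : {e | 2 * (v + 1) ∈ (RAM.padGraph d H.sizeAt H.vertexAt).edge e} ⊆
            Fin.val '' {e | (⟨v, hv⟩ : Fin N) ∈ H.edge e} := by
          intro e he
          obtain ⟨j, hj, h⟩ := (H.mem_padGraph_even (H.sizeAt_le hs e)).1 he
          have hen : e < n := by
            by_contra h'
            rw [H.sizeAt_of_le (not_lt.1 h')] at hj
            omega
          obtain ⟨w, hw, h2⟩ := (H.exists_vertexAt_iff ⟨e, hen⟩ v).1 ⟨j, hj, h⟩
          refine ⟨⟨e, hen⟩, ?_, rfl⟩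
          have : w = ⟨v, hv⟩ := Fin.ext h2
          exact this ▸ hw
        exact (Set.encard_le_encard hsub).trans ((Set.encard_image_le _ _).trans (hdeg _))
      · have hsub : {e | 2 * (v + 1) ∈ (RAM.padGraph d H.sizeAt H.vertexAt).edge e} = ∅ := by
          refine Set.eq_empty_of_forall_notMem fun e he => ?_
          obtain ⟨j, hj, h⟩ := (H.mem_padGraph_even (H.sizeAt_le hs e)).1 he
          have hen : e < n := by
            by_contra h'
            rw [H.sizeAt_of_le (not_lt.1 h')] at hj
            omega
          obtain ⟨w, hw, h2⟩ := (H.exists_vertexAt_iff ⟨e, hen⟩ v).1 ⟨j, hj, h⟩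
          exact hv (h2 ▸ w.isLt)
        rw [hsub]; simp
  · have hsub : {e | 2 * v + 1 ∈ (RAM.padGraph d H.sizeAt H.vertexAt).edge e} ⊆ {v / (d + 1)} :=
      fun e he => H.eq_of_mem_padGraph_odd he
    refine (Set.encard_le_encard hsub).trans ?_
    rw [Set.encard_singleton]
    exact_mod_cast Nat.le_add_left 1 k

theorem disjoint_padGraph_iff (hs : H.EdgeSizeLE (d + 1)) {e f : Fin n} (hef : e ≠ f) :
    Disjoint ((RAM.padGraph d H.sizeAt H.vertexAt).edge e)
      ((RAM.padGraph d H.sizeAt H.vertexAt).edge f) ↔ Disjoint (H.edge e) (H.edge f) := by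
  simp only [Finset.disjoint_left]
  constructor
  · intro h v he hf
    refine h (a := 2 * v.val + 2) ?_ ?_
    · exact (H.mem_padGraph_even (H.sizeAt_le hs e)).2 ((H.exists_vertexAt_iff e v).2 ⟨v, he, rfl⟩)
    · exact (H.mem_padGraph_even (H.sizeAt_le hs f)).2 ((H.exists_vertexAt_iff f v).2 ⟨v, hf, rfl⟩)
  · intro h u he hf
    rcases Nat.even_or_odd' u with ⟨v, rfl | rfl⟩
    · rcases v with _ | v
      · exact H.zero_notMem_padGraph e he
      · obtain ⟨w, hw, h1⟩ := (H.exists_vertexAt_iff e v).1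
          ((H.mem_padGraph_even (H.sizeAt_le hs e)).1 he)
        obtain ⟨w', hw', h2⟩ := (H.exists_vertexAt_iff f v).1
          ((H.mem_padGraph_even (H.sizeAt_le hs f)).1 hf)
        have : w = w' := Fin.ext (h1.trans h2.symm)
        exact h hw (this ▸ hw')
    · exact hef (Fin.ext ((H.eq_of_mem_padGraph_odd he).trans (H.eq_of_mem_padGraph_odd hf).symm))

/-- Padding preserves disjointness of distinct hyperedges, so `Fin.val` induces a bijection of
matchings that preserves cardinality. -/
theorem partitionFn_eq_weight (hs : H.EdgeSizeLE (d + 1)) (lam : ℝ) :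
    H.partitionFn lam = (RAM.padGraph d H.sizeAt H.vertexAt).weight lam (range n) := by
  have hmatch : ∀ M : Finset (Fin n), H.IsMatching M ↔
      (RAM.padGraph d H.sizeAt H.vertexAt).IsMatching (M.map Fin.valEmbedding) := by
    intro M
    constructor
    · intro h x hx y hy hxy
      obtain ⟨e, he, rfl⟩ := Finset.mem_map.1 (Finset.mem_coe.1 hx)
      obtain ⟨f, hf, rfl⟩ := Finset.mem_map.1 (Finset.mem_coe.1 hy)
      have hef : e ≠ f := fun h => hxy (by rw [h])
      exact (H.disjoint_padGraph_iff hs hef).2 (h he hf hef)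
    · intro h e he f hf hef
      exact (H.disjoint_padGraph_iff hs hef).1 (h (Finset.mem_coe.2 (Finset.mem_map_of_mem _ he))
        (Finset.mem_coe.2 (Finset.mem_map_of_mem _ hf)) fun h => hef (Fin.ext h))
  rw [partitionFn, weight]
  refine Finset.sum_nbij (fun M => M.map Fin.valEmbedding) ?_ ?_ ?_ ?_
  · intro M hM
    rw [mem_matchings] at hM ⊢
    refine ⟨fun x hx => ?_, (hmatch M).1 hM.2⟩
    obtain ⟨e, -, rfl⟩ := Finset.mem_map.1 hx
    simp
  · intro M _ M' _ h
    exact Finset.map_injective _ h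
  · intro M hM
    obtain ⟨h1, h2⟩ := (mem_matchings ..).1 (Finset.mem_coe.1 hM)
    obtain ⟨M', rfl⟩ : ∃ M' : Finset (Fin n), M'.map Fin.valEmbedding = M := by
      refine ⟨univ.filter fun e => e.val ∈ M, ?_⟩
      ext x
      simp only [Finset.mem_map, Finset.mem_filter, Finset.mem_univ, true_and,
        Fin.valEmbedding_apply]
      constructor
      · rintro ⟨e, he, rfl⟩; exact he
      · intro hx; exact ⟨⟨x, Finset.mem_range.1 (h1 hx)⟩, hx, rfl⟩
    exact ⟨M', (mem_matchings ..).2 ⟨Finset.subset_univ _, (hmatch M').2 h2⟩, rfl⟩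
  · intro M _
    rw [Finset.card_map]

end HGraph

end

/-! ### The total run, and the product for the partition function -/

section

open Finset

namespace RAM

/-- A bound for the total running time. -/
def totalTime (d k n r ℓ D Λ tc tp : ℕ) : ℕ :=
  30 * (r + 1) + 30 * (n + 1) + tc + (initP.wt + D) +
    (n + 1) * ((rd 0 (.lit 6)).wt + edgeTime d k Λ D ℓ tp + 1) + outputP.wt + 5

theorem exists_exec_of_acc {d k : ℕ} (hd : 1 ≤ d) (hk : 1 ≤ k) {lam : ℝ} (hlam : 0 < lam)
    {C : ℝ} (hC : ∀ x y : ℝ, 0 ≤ x → x ≤ lam → 0 ≤ y → y ≤ lam →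
      |x - y| ≤ C * |potential k x - potential k y|) (hC0 : 0 < C)
    (hc : ∀ a, 0 ≤ a → Contracts (Fin (d + 1)) ℕ d k lam a a)
    {err : ℕ → ℝ} (h0 : potential k lam ≤ err 0) (herr0 : ∀ ℓ, 0 ≤ err ℓ)
    (herr : ∀ ℓ, Contracts (Fin (d + 1)) ℕ d k lam (err ℓ) (err (ℓ + 1)))
    {N n : ℕ} (H : HGraph (Fin N) (Fin n)) (hs : H.EdgeSizeLE (d + 1)) (hdeg : H.DegreeLE (k + 1))
    {a b r : ℕ} (ha : 0 < a) (hr : r = ⌈(b : ℝ) / a⌉₊) {ℓ D Λ : ℕ} (hD : 0 < D)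
    (hΛ : Λ = ⌊lam * D⌋₊) {δ : ℝ}
    (hδ : C * ((d + 1) * (err ℓ + (ℓ + 2) * roundErr d k lam D)) ≤ δ)
    {Acc : ℕ → ℕ → ℕ → Prop} {setup post : Prog} {tc tp : ℕ}
    (hsetup : ∀ B : Base, B.low 2 = r → B.low 3 = n → 4 ≤ B.low 0 → ∃ s,
      Runs lam setup (mem B fun _ _ => 0) (mem B s) tc ∧ s 0 1 = ℓ + 2 ∧ s 0 2 = D ∧
      (∀ c x, c ≠ 0 → s c x = 0) ∧ Acc 0 (s 0 7) (s 0 8))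
    (hpost : ∀ B : Base, ∀ e < n, ∀ s, s 0 2 = D → Acc e (s 0 7) (s 0 8) → s 9 0 ≤ Λ →
      |(s 9 0 / D : ℝ) - (padGraph d H.sizeAt H.vertexAt).ratio lam (range e) e| ≤ δ →
      ∃ s', Runs lam post (mem B s) (mem B s') tp ∧
        (∀ c x, ¬ (c = 0 ∧ 7 ≤ x) → s' c x = s c x) ∧ Acc (e + 1) (s' 0 7) (s' 0 8)) :
    ∃ m t, t ≤ totalTime d k n r ℓ D Λ tc tp ∧
      Exec lam (mainP d k setup post) (inputMemory H a b) m t ∧ Acc n (m 0) (m 1) := by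
  have ha0 : (0 : ℝ) < a := by exact_mod_cast ha
  have hdeg' := H.degreeLE_padGraph hs hdeg
  refine main_runs (r := r) (M := inputMemory H a b) ?_ ?_ rfl
    (fun e he => H.inputMemory_offset a b he) (fun x hx => H.inputMemory_of_le a b hx)
    H.vertexAt_inj hdeg' hΛ ?_ hsetup hpost
  · have h1 : (b : ℝ) / a ≤ r := hr ▸ Nat.le_ceil _
    rw [div_le_iff₀ ha0] at h1
    exact_mod_cast h1
  · intro i hi
    rw [hr, Nat.lt_ceil, lt_div_iff₀ ha0] at hi
    exact_mod_cast hi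
  · intro e _ VT DEG INC hVT hI
    refine (abs_foldR_sub_ratio_le hd hk hlam hD hΛ (fun f => rfl) (fun f i j h => ?_)
      (by simp) hVT hI hdeg' hC hC0 hc h0 herr0 herr ℓ fun e j => padVert_ne_zero e j).trans hδ
    exact Fin.ext (padVert_injective H.vertexAt_inj f i (by omega) j (by omega) h)

/-! ### Multiplying up the partition function -/

/-- Set the depth and the denominator from the number `r * (n + 1)`, by repeated doubling. -/
def setupExp (c₁ c₂ c₃ c₄ : ℕ) : Prog :=
  .seq (.seq (wr 0 (.lit 9) (.mul (.load (.lit 2)) (.add (.load (.lit 3)) (.lit 1))))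
      (wr 0 (.lit 11) (.lit 1)))
    (.seq (.loop (.sub (rd 0 (.lit 9)) (rd 0 (.lit 11)))
      (.seq (wr 0 (.lit 11) (.add (rd 0 (.lit 11)) (rd 0 (.lit 11))))
        (wr 0 (.lit 10) (.add (rd 0 (.lit 10)) (.lit 1)))))
    (.seq (wr 0 (.lit 1) (.add (.div (.mul (.lit c₁) (rd 0 (.lit 10))) (.lit c₂)) (.lit (c₃ + 2))))
      (.seq (wr 0 (.lit 2) (.mul (.lit c₄) (.mul (rd 0 (.lit 9)) (rd 0 (.lit 9)))))
        (.seq (wr 0 (.lit 7) (.lit 1)) (wr 0 (.lit 8) (.lit 1))))))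

/-- Multiply by the factor of the current hyperedge. -/
def postExp : Prog :=
  .seq (wr 0 (.lit 7) (.mul (rd 0 (.lit 7)) (.add (rd 0 (.lit 2)) (rd 9 (.lit 0)))))
    (wr 0 (.lit 8) (.mul (rd 0 (.lit 8)) (rd 0 (.lit 2))))

variable {lam : ℝ} {B : Base}

/-- A bound for the time of `setupExp`. -/
def setupExpTime (r n c₁ c₂ c₃ c₄ N₀ : ℕ) : ℕ :=
  (setupExp c₁ c₂ c₃ c₄).wt + 1000 + (r + (n + 1)) + (N₀ + 1) * 1000 +
    (c₁ + N₀ + c₁ * N₀ + c₂ + N₀ + N₀ + c₄ + N₀ * N₀)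

/-- Doubling until N is reached counts ⌈log₂ N⌉, to which the depth is proportional up to a
constant; the denominator is proportional to N². -/
theorem setupExp_runs {r n c₁ c₂ c₃ c₄ N₀ : ℕ} (hN : N₀ = r * (n + 1)) (h2 : B.low 2 = r)
    (h3 : B.low 3 = n) (h0 : 4 ≤ B.low 0) :
    ∃ s, Runs lam (setupExp c₁ c₂ c₃ c₄) (mem B fun _ _ => 0) (mem B s)
        (setupExpTime r n c₁ c₂ c₃ c₄ N₀) ∧
      s 0 1 = c₁ * Nat.clog 2 N₀ / c₂ + (c₃ + 2) ∧ s 0 2 = c₄ * (N₀ * N₀) ∧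
      (∀ c x, c ≠ 0 → s c x = 0) ∧ s 0 7 = 1 ∧ s 0 8 = 1 := by
  have hl2 : ∀ s', mem B s' 2 = r := fun s' => by rw [mem_low (by omega), h2]
  have hl3 : ∀ s', mem B s' 3 = n := fun s' => by rw [mem_low (by omega), h3]
  set m : ℕ → ℕ → ℕ → ℕ := fun i c x => if c = 0 then if x = 9 then N₀ else if x = 10 then i else
    if x = 11 then 2 ^ i else 0 else 0 with hm
  have e0 := runs_of_sem (lam := lam) (p := .seq
      (wr 0 (.lit 9) (.mul (.load (.lit 2)) (.add (.load (.lit 3)) (.lit 1))))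
      (wr 0 (.lit 11) (.lit 1))) (m := mem B fun _ _ => 0) (m' := mem B (m 0)) (β := r + (n + 1))
      ⟨trivial, trivial⟩ (by
      simp only [Prog.sem, sem_wr (show 0 < 11 by norm_num), Expr.eval, hl2, hl3, ← hN]
      congr 1
      funext c x
      simp only [upd_apply, hm]
      by_cases hc : c = 0
      · subst hc
        by_cases h9 : x = 9
        · subst h9; simp
        · by_cases h11 : x = 11
          · subst h11; simp
          · simp [h9, h11]
      · simp [hc]) (by
      simp only [Prog.bits, bits_wr, Expr.bits, Expr.eval, hl2, hl3]
      have := size_le_self r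
      have := size_le_self (n + 1)
      omega)
  have e1 := Path.of_forall (lam := lam) (g := .sub (rd 0 (.lit 9)) (rd 0 (.lit 11))) (β := _)
    (m := fun i => mem B (m i)) (p := .seq (wr 0 (.lit 11) (.add (rd 0 (.lit 11)) (rd 0 (.lit 11))))
        (wr 0 (.lit 10) (.add (rd 0 (.lit 10)) (.lit 1)))) (Nat.clog 2 N₀) fun i hi => by
    refine ⟨?_, runs_of_sem (β := 0) ?_ ?_ ?_⟩
    · have := (Nat.lt_clog_iff_pow_lt (by norm_num)).1 hi
      simp only [Expr.eval, eval_rd (show 0 < 11 by norm_num), hm]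
      simp; omega
    · exact ⟨trivial, trivial⟩
    · simp only [Prog.sem, sem_wr (show 0 < 11 by norm_num), Expr.eval,
        eval_rd (show 0 < 11 by norm_num)]
      congr 1
      funext c x
      simp only [upd_apply, hm]
      by_cases hc : c = 0
      · subst hc
        by_cases h9 : x = 10
        · subst h9; simp
        · by_cases h11 : x = 11
          · subst h11; simp [pow_succ]; omega
          · simp [h9, h11]
      · simp [hc]
    · simp [Prog.bits, bits_wr, Expr.bits]
  have hclog : Nat.clog 2 N₀ ≤ N₀ := by
    rw [Nat.clog_le_iff_le_pow (by norm_num)]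
    exact Nat.lt_two_pow_self.le
  have e2 := e1.runs (fun _ => by simp [Expr.bits]) (by
    have := Nat.le_pow_clog (b := 2) (by norm_num) N₀
    simp only [Expr.eval, eval_rd (show 0 < 11 by norm_num), hm]
    simp; omega)
  set s := m (Nat.clog 2 N₀) with hs
  have s9 : s 0 9 = N₀ := by simp [hs, hm]
  have s10 : s 0 10 = Nat.clog 2 N₀ := by simp [hs, hm]
  have e3 := runs_of_sem (lam := lam) (p := .seq (wr 0 (.lit 1)
      (.add (.div (.mul (.lit c₁) (rd 0 (.lit 10))) (.lit c₂)) (.lit (c₃ + 2))))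
      (.seq (wr 0 (.lit 2) (.mul (.lit c₄) (.mul (rd 0 (.lit 9)) (rd 0 (.lit 9)))))
        (.seq (wr 0 (.lit 7) (.lit 1)) (wr 0 (.lit 8) (.lit 1))))) (m := mem B s)
      (m' := mem B (upd (upd (upd (upd s 0 1 (c₁ * Nat.clog 2 N₀ / c₂ + (c₃ + 2))) 0 2
        (c₄ * (N₀ * N₀))) 0 7 1) 0 8 1))
    (β := c₁ + N₀ + c₁ * N₀ + c₂ + N₀ + N₀ + c₄ + N₀ * N₀)
      ⟨trivial, trivial, trivial, trivial⟩
    (by simp [Prog.sem, sem_wr, Expr.eval, eval_rd, upd_apply, s9, s10]) (by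
      simp only [Prog.bits, bits_wr, Expr.bits, Expr.eval, eval_rd (show 0 < 11 by norm_num),
        sem_wr (show 0 < 11 by norm_num), bits_rd_lit, s10, upd_apply]
      simp [s9]
      have h1 := size_le_self c₁
      have h2 := size_le_self c₂
      have h4 := size_le_self c₄
      have h5 := size_le_self (Nat.clog 2 N₀)
      have h6 := size_le_self (c₁ * Nat.clog 2 N₀)
      have h7 := size_le_self N₀
      have h8 := size_le_self (N₀ * N₀)
      have h9 : c₁ * Nat.clog 2 N₀ ≤ c₁ * N₀ := by gcongr
      omega)
  refine ⟨_, (e0.seq (e2.seq e3)).mono ?_, ?_, ?_, ?_, ?_, ?_⟩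
  · have hw : ∀ w, w ≤ 1000 → (Nat.clog 2 N₀ + 1) * w ≤ (N₀ + 1) * 1000 := fun w hw => by
      gcongr
    have := hw ((Expr.sub (rd 0 (.lit 9)) (rd 0 (.lit 11))).wt +
      ((Prog.seq (wr 0 (.lit 11) (.add (rd 0 (.lit 11)) (rd 0 (.lit 11))))
        (wr 0 (.lit 10) (.add (rd 0 (.lit 10)) (.lit 1)))).wt + 0) + 1) (by decide)
    rw [setupExpTime]
    simp only [setupExp, Prog.wt] at this ⊢
    omega
  · simp [upd_apply]
  · simp [upd_apply]
  · intro c x hc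
    simp [upd_apply, hc, hs, hm]
  · simp [upd_apply]
  · simp [upd_apply]

/-- The accumulated product is within a factor `1 ± δ` per hyperedge. -/
def AccExp (Z : ℕ → ℝ) (δ : ℝ) (D Λ e num den : ℕ) : Prop :=
  den = D ^ e ∧ num ≤ (D + Λ) ^ e ∧ (1 - δ) ^ e * Z e ≤ (num : ℝ) / D ^ e ∧
    (num : ℝ) / D ^ e ≤ (1 + δ) ^ e * Z e

theorem size_pow_le (x e : ℕ) : Nat.size (x ^ e) ≤ x * e + 1 := by
  refine Nat.size_le.2 ?_
  calc x ^ e ≤ (2 ^ x) ^ e := by gcongr; exact Nat.lt_two_pow_self.le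
    _ = 2 ^ (x * e) := by rw [← pow_mul]
    _ < _ := Nat.pow_lt_pow_right (by norm_num) (Nat.lt_succ_self _)

/-- A bound for the time of `postExp`. -/
def postExpTime (n D Λ : ℕ) : ℕ :=
  postExp.wt + ((D + Λ) * n + 1 + (D + Λ) + ((D + Λ) * n + 1) + D)

/-- As ρ ≥ 0, an absolute error δ in ρ is a relative error at most δ in 1 + ρ. The numerator is at
most (D + Λ)^e and thus has O(n) bits for fixed D, which bounds the cost of the multiplication. -/
theorem postExp_runs {Z : ℕ → ℝ} {δ ρ : ℝ} {D Λ e n : ℕ} {s : ℕ → ℕ → ℕ} (he : e < n) (hD : 0 < D)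
    (h2 : s 0 2 = D) (hacc : AccExp Z δ D Λ e (s 0 7) (s 0 8)) (h9 : s 9 0 ≤ Λ) (hδ1 : δ ≤ 1)
    (hZ0 : 0 ≤ Z e) (hZ : Z (e + 1) = Z e * (1 + ρ)) (hρ : 0 ≤ ρ)
    (hR : |(s 9 0 / D : ℝ) - ρ| ≤ δ) :
    ∃ s', Runs lam postExp (mem B s) (mem B s') (postExpTime n D Λ) ∧
      (∀ c x, ¬ (c = 0 ∧ 7 ≤ x) → s' c x = s c x) ∧ AccExp Z δ D Λ (e + 1) (s' 0 7) (s' 0 8) := by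
  obtain ⟨a1, a2, a3, a4⟩ := hacc
  have hD0 : (0 : ℝ) < D := by exact_mod_cast hD
  have hδ0 : 0 ≤ δ := (abs_nonneg _).trans hR
  refine ⟨upd (upd s 0 7 (s 0 7 * (D + s 9 0))) 0 8 (s 0 8 * D),
    runs_of_sem (p := postExp) ⟨trivial, trivial⟩ ?_ ?_,
    ?_, ?_⟩
  · simp [postExp, Prog.sem, sem_wr, Expr.eval, eval_rd, upd_apply, h2]
  · simp only [postExp, Prog.bits, bits_wr, Expr.bits, Expr.eval, eval_rd (show 0 < 11 by norm_num),
      eval_rd (show 9 < 11 by norm_num), sem_wr (show 0 < 11 by norm_num), bits_rd_lit, upd_apply]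
    simp [h2]
    have b1 : Nat.size (s 0 7) ≤ (D + Λ) * n + 1 :=
      (Nat.size_le_size a2).trans ((size_pow_le _ _).trans (by gcongr))
    have b2 : Nat.size (s 0 8) ≤ (D + Λ) * n + 1 := by
      rw [a1]
      exact (size_pow_le _ _).trans (by gcongr; omega)
    have b3 := size_le_self (D + s 9 0)
    have b4 := size_le_self D
    omega
  · intro c x h
    rw [upd_of_not (by omega), upd_of_not (by omega)]
  · obtain ⟨r1, r2⟩ := abs_le.1 hR
    refine ⟨by simp [upd_apply, a1, pow_succ], ?_, ?_, ?_⟩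
    · simp only [upd_apply]
      simp only [pow_succ]
      simp
      gcongr
    all_goals
      have hnum : ((s 0 7 * (D + s 9 0) : ℕ) : ℝ) / D ^ (e + 1) =
          (s 0 7 : ℝ) / D ^ e * (1 + s 9 0 / D) := by
        push_cast; rw [pow_succ]; field_simp
      have h70 : upd (upd s 0 7 (s 0 7 * (D + s 9 0))) 0 8 (s 0 8 * D) 0 7 =
          s 0 7 * (D + s 9 0) := by
        simp [upd_apply]
      rw [h70, hnum, hZ, pow_succ]
    · calc (1 - δ) ^ e * (1 - δ) * (Z e * (1 + ρ)) = (1 - δ) ^ e * Z e * ((1 - δ) * (1 + ρ)) := by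
            ring
        _ ≤ (s 0 7 : ℝ) / D ^ e * (1 + s 9 0 / D) :=
            mul_le_mul a3 (by nlinarith) (mul_nonneg (by linarith) (by linarith)) (by positivity)
    · calc (s 0 7 : ℝ) / D ^ e * (1 + s 9 0 / D) ≤ (1 + δ) ^ e * Z e * ((1 + δ) * (1 + ρ)) := by
            gcongr
            nlinarith
        _ = _ := by ring

end RAM

end

/-! ### Harmonic sums for the logarithm -/

section

open Finset

namespace RAM

/-! ### Adding up the logarithm of the partition function -/

/-- Set the depth and the denominator from the accuracy. -/
def setupLog (c₁ c₂ : ℕ) : Prog :=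
  .seq (wr 0 (.lit 9) (.mul (.load (.lit 2)) (.load (.lit 2))))
    (.seq (wr 0 (.lit 1) (.add (.mul (.lit c₁) (rd 0 (.lit 9))) (.lit 2)))
      (.seq (wr 0 (.lit 2) (.mul (.lit c₂) (.mul (.load (.lit 2)) (rd 0 (.lit 9)))))
        (wr 0 (.lit 8) (.mul (rd 0 (.lit 2)) (rd 0 (.lit 2))))))

/-- Add the logarithm of the factor of the current hyperedge, as a partial sum of the harmonic
series. -/
def postLog : Prog :=
  .seq (.seq (wr 0 (.lit 10) (rd 0 (.lit 2)))
      (wr 0 (.lit 11) (.add (rd 0 (.lit 2)) (rd 9 (.lit 0)))))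
    (.loop (.sub (rd 0 (.lit 11)) (rd 0 (.lit 10)))
      (.seq (wr 0 (.lit 7) (.add (rd 0 (.lit 7)) (.div (rd 0 (.lit 8)) (rd 0 (.lit 10)))))
        (wr 0 (.lit 10) (.add (rd 0 (.lit 10)) (.lit 1)))))

variable {lam : ℝ} {B : Base}

/-- A bound for the time of `setupLog`. -/
def setupLogTime (r c₁ c₂ D : ℕ) : ℕ :=
  (setupLog c₁ c₂).wt + (r + r + c₁ + r * r + c₂ + r + r * r + r * (r * r) + D + D)

theorem setupLog_runs {r c₁ c₂ D : ℕ} (hD : D = c₂ * (r * (r * r))) (h2 : B.low 2 = r)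
    (h0 : 4 ≤ B.low 0) :
    ∃ s, Runs lam (setupLog c₁ c₂) (mem B fun _ _ => 0) (mem B s) (setupLogTime r c₁ c₂ D) ∧
      s 0 1 = c₁ * (r * r) + 2 ∧ s 0 2 = D ∧ (∀ c x, c ≠ 0 → s c x = 0) ∧ s 0 7 = 0 ∧
        s 0 8 = D * D := by
  have hl2 : ∀ s', mem B s' 2 = r := fun s' => by rw [mem_low (by omega), h2]
  refine ⟨upd (upd (upd (upd (fun _ _ => 0) 0 9 (r * r)) 0 1 (c₁ * (r * r) + 2)) 0 2 D) 0 8 (D * D),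
    runs_of_sem (p := setupLog c₁ c₂) ⟨trivial, trivial, trivial, trivial⟩ ?_ ?_,
    ?_, ?_, ?_, ?_, ?_⟩
  · simp [setupLog, Prog.sem, sem_wr, Expr.eval, eval_rd, upd_apply, hl2, hD]
  · simp only [setupLog, Prog.bits, bits_wr, Expr.bits, Expr.eval,
      eval_rd (show 0 < 11 by norm_num), sem_wr (show 0 < 11 by norm_num), bits_rd_lit, hl2,
      upd_apply]
    simp [← hD]
    have h1 := size_le_self r
    have h2 := size_le_self c₁
    have h3 := size_le_self (r * r)
    have h4 := size_le_self c₂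
    have h5 := size_le_self (r * (r * r))
    have h6 := size_le_self D
    omega
  · simp [upd_apply]
  · simp [upd_apply]
  · intro c x hc
    simp [upd_apply, hc]
  · simp [upd_apply]
  · simp [upd_apply]

/-- A bound for the time of `postLog`. -/
def postLogTime (D Λ : ℕ) : ℕ := postLog.wt + 1000 + (Λ + 1) * (1000 + (D * D + (D + Λ)))

theorem postLog_runs {D Λ : ℕ} {s : ℕ → ℕ → ℕ} (h2 : s 0 2 = D) (h8 : s 0 8 = D * D)
    (h9 : s 9 0 ≤ Λ) :
    ∃ s', Runs lam postLog (mem B s) (mem B s') (postLogTime D Λ) ∧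
      (∀ c x, ¬ (c = 0 ∧ 7 ≤ x) → s' c x = s c x) ∧ s' 0 8 = D * D ∧
      s' 0 7 = s 0 7 + ∑ i ∈ range (s 9 0), D * D / (D + i) := by
  set m : ℕ → ℕ → ℕ → ℕ := fun i => upd (upd (upd s 0 7 (s 0 7 +
    ∑ j ∈ range i, D * D / (D + j))) 0 10 (D + i)) 0 11 (D + s 9 0) with hm
  have e0 := runs_of_sem (lam := lam) (p := .seq (wr 0 (.lit 10) (rd 0 (.lit 2)))
      (wr 0 (.lit 11) (.add (rd 0 (.lit 2)) (rd 9 (.lit 0))))) (m := mem B s) (m' := mem B (m 0))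
    (β := 0) ⟨trivial, trivial⟩
    (by
      simp only [Prog.sem, sem_wr (show 0 < 11 by norm_num), Expr.eval,
        eval_rd (show 0 < 11 by norm_num), eval_rd (show 9 < 11 by norm_num), upd_apply]
      congr 1
      funext c x
      simp only [upd_apply, hm]
      by_cases hc : c = 0
      · subst hc
        by_cases h7 : x = 7
        · subst h7; simp
        · simp [h7, h2]
      · simp [hc])
    (by simp [Prog.bits, bits_wr, Expr.bits])
  have e1 := Path.of_forall (lam := lam) (g := .sub (rd 0 (.lit 11)) (rd 0 (.lit 10))) (β := _)
    (m := fun i => mem B (m i)) (p := .seq (wr 0 (.lit 7) (.add (rd 0 (.lit 7))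
        (.div (rd 0 (.lit 8)) (rd 0 (.lit 10)))))
        (wr 0 (.lit 10) (.add (rd 0 (.lit 10)) (.lit 1)))) (s 9 0) fun i hi => by
    refine ⟨?_, runs_of_sem (β := D * D + (D + Λ)) ?_ ?_ ?_⟩
    · simp only [Expr.eval, eval_rd (show 0 < 11 by norm_num), hm]
      simp [upd_apply]; omega
    · exact ⟨trivial, trivial⟩
    · simp only [Prog.sem, sem_wr (show 0 < 11 by norm_num), Expr.eval,
        eval_rd (show 0 < 11 by norm_num)]
      congr 1
      funext c x
      simp only [upd_apply, hm]
      by_cases hc : c = 0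
      · subst hc
        by_cases h7 : x = 7
        · subst h7; simp [Finset.sum_range_succ, h8, add_assoc]
        · by_cases h10 : x = 10
          · subst h10; simp [add_assoc]
          · simp [h7, h10]
      · simp [hc]
    · simp only [Prog.bits, bits_wr, Expr.bits, Expr.eval, eval_rd (show 0 < 11 by norm_num), hm,
        bits_rd_lit]
      simp [upd_apply, h8]
      have h3 := size_le_self (D * D)
      have h4 := size_le_self (D + i)
      omega
  have e2 := e1.runs (fun _ => by simp [Expr.bits]) (by
    simp only [Expr.eval, eval_rd (show 0 < 11 by norm_num), hm]
    simp [upd_apply])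
  refine ⟨m (s 9 0), (e0.seq e2).mono ?_, ?_, ?_, ?_⟩
  · have hw : ∀ w, w ≤ 1000 + (D * D + (D + Λ)) → (s 9 0 + 1) * w ≤
        (Λ + 1) * (1000 + (D * D + (D + Λ))) := fun w hw => by gcongr
    have hw0 : (Expr.sub (rd 0 (.lit 11)) (rd 0 (.lit 10))).wt + (Prog.seq (wr 0 (.lit 7)
        (.add (rd 0 (.lit 7)) (.div (rd 0 (.lit 8)) (rd 0 (.lit 10)))))
        (wr 0 (.lit 10) (.add (rd 0 (.lit 10)) (.lit 1)))).wt + 1 ≤ 1000 := by decide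
    have := hw ((Expr.sub (rd 0 (.lit 11)) (rd 0 (.lit 10))).wt + ((Prog.seq (wr 0 (.lit 7)
        (.add (rd 0 (.lit 7)) (.div (rd 0 (.lit 8)) (rd 0 (.lit 10)))))
        (wr 0 (.lit 10) (.add (rd 0 (.lit 10)) (.lit 1)))).wt + (D * D + (D + Λ))) + 1) (by omega)
    rw [postLogTime]
    simp only [postLog, Prog.wt] at this ⊢
    omega
  · intro c x h
    simp only [hm]
    rw [upd_of_not (by omega), upd_of_not (by omega), upd_of_not (by omega)]
  · simp [hm, upd_apply, h8]
  · simp [hm, upd_apply]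

/-- Partial sums of the harmonic series with rounded terms. -/
theorem abs_sum_div_sub_log_le {D R : ℕ} (hD : 0 < D) :
    |((∑ i ∈ range R, D * D / (D + i) : ℕ) : ℝ) / (D * D : ℕ) - Real.log (1 + R / D)| ≤
      (1 + (R : ℝ) / D) / D := by
  have hD0 : (0 : ℝ) < D := by exact_mod_cast hD
  -- An increment of the logarithm lies between 1/(D + i + 1) and 1/(D + i). The resulting excess
  -- telescopes to 1/D - 1/(D + R), while each floor loses at most 1/D². The two-sided form is what
  -- the induction carries.
  have key : ((∑ i ∈ range R, D * D / (D + i) : ℕ) : ℝ) / (D * D : ℕ) ≤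
      Real.log (1 + R / D) + (1 / D - 1 / (D + R)) ∧ Real.log (1 + R / D) - R / (D * D) ≤
        ((∑ i ∈ range R, D * D / (D + i) : ℕ) : ℝ) / (D * D : ℕ) := by
    induction R with
    | zero => simp
    | succ R ih =>
      set S := ∑ i ∈ range R, D * D / (D + i)
      have hy : (0 : ℝ) < D + R := by positivity
      have hlog : Real.log (1 + (R + 1 : ℕ) / D) =
          Real.log (1 + R / D) + Real.log ((D + R + 1) / (D + R)) := by
        rw [← Real.log_mul (by positivity) (by positivity)]
        congr 1
        push_cast; field_simp; ring
      have hl1 : Real.log (((D : ℝ) + R + 1) / (D + R)) ≤ 1 / (D + R) := by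
        refine (Real.log_le_sub_one_of_pos (by positivity)).trans (le_of_eq ?_)
        field_simp; ring
      have hl2 : 1 / ((D : ℝ) + R + 1) ≤ Real.log (((D : ℝ) + R + 1) / (D + R)) := by
        have := Real.one_sub_inv_le_log_of_pos
          (show (0 : ℝ) < ((D : ℝ) + R + 1) / (D + R) by positivity)
        refine le_trans (le_of_eq ?_) this
        field_simp; ring
      have hd1 : ((D * D / (D + R) : ℕ) : ℝ) / (D * D : ℕ) ≤ 1 / (D + R) := by
        rw [div_le_iff₀ (by positivity)]
        refine Nat.cast_div_le.trans (le_of_eq ?_)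
        push_cast; ring
      have hd2 : 1 / ((D : ℝ) + R) - 1 / (D * D) ≤ ((D * D / (D + R) : ℕ) : ℝ) / (D * D : ℕ) := by
        have h5 : D * D ≤ (D * D / (D + R) + 1) * (D + R) := by
          have := Nat.lt_div_mul_add (a := D * D) (b := D + R) (by omega)
          rw [Nat.add_mul]; omega
        have h6 : (D : ℝ) * D ≤ (((D * D / (D + R) : ℕ) : ℝ) + 1) * (D + R) := by exact_mod_cast h5
        generalize ((D * D / (D + R) : ℕ) : ℝ) = q at *
        push_cast
        rw [sub_le_iff_le_add, ← add_div, div_le_div_iff₀ hy (by positivity)]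
        linarith
      rw [Finset.sum_range_succ, Nat.cast_add, add_div, hlog]
      have hs : ((R + 1 : ℕ) : ℝ) / (D * D) = R / (D * D) + 1 / (D * D) := by push_cast; ring
      have hs' : (D : ℝ) + (R + 1 : ℕ) = D + R + 1 := by push_cast; ring
      rw [hs, hs']
      constructor <;> linarith [ih.1, ih.2]
  have h1 : (0 : ℝ) ≤ 1 / (D + R) := by positivity
  have h2 : (1 + (R : ℝ) / D) / D = 1 / D + R / (D * D) := by field_simp
  have h3 : (0 : ℝ) ≤ R / (D * D) := by positivity
  have h4 : (0 : ℝ) ≤ 1 / D := by positivity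
  rw [abs_le, h2]
  constructor <;> linarith [key.1, key.2]

/-- The accumulated sum is an approximation of the logarithm. -/
def AccLog (Z : ℕ → ℝ) (ε : ℝ) (D e num den : ℕ) : Prop :=
  den = D * D ∧ IsApprox ε (Real.log (Z e)) ((num : ℝ) / (D * D : ℕ))

/-- Each new summand is nonnegative, so it suffices that its absolute error is at most ε times its
size: relative accuracy is then preserved under addition, whatever the number of hyperedges. The
errors come from the ratio, through the 1-Lipschitz map log(1 + ·), and from the harmonic sum. -/
theorem AccLog.succ {Z : ℕ → ℝ} {ε δ ρ lam : ℝ} {D Λ e R num num' : ℕ} (hD : 0 < D) (hρ : 0 ≤ ρ)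
    (hacc : IsApprox ε (Real.log (Z e)) ((num : ℝ) / (D * D : ℕ)))
    (hZ0 : 0 < Z e) (hZ : Z (e + 1) = Z e * (1 + ρ)) (hR : |(R / D : ℝ) - ρ| ≤ δ)
    (hΛ : (Λ : ℝ) ≤ lam * D) (hRΛ : R ≤ Λ)
    (hδ : δ + (1 + lam) / D ≤ ε * Real.log (1 + ρ))
    (hnum : num' = num + ∑ i ∈ range R, D * D / (D + i)) :
    IsApprox ε (Real.log (Z (e + 1))) ((num' : ℝ) / (D * D : ℕ)) := by
  have hD0 : (0 : ℝ) < D := by exact_mod_cast hD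
  have h1 := abs_sum_div_sub_log_le (R := R) hD
  have h2 : |Real.log (1 + R / D) - Real.log (1 + ρ)| ≤ δ := by
    have hlip : ∀ x y : ℝ, 0 ≤ x → x ≤ y → Real.log (1 + y) - Real.log (1 + x) ≤ y - x := by
      intro x y hx hxy
      rw [← Real.log_div (by linarith) (by linarith)]
      refine (Real.log_le_sub_one_of_pos (div_pos (by linarith) (by linarith))).trans ?_
      rw [div_sub_one (by linarith), div_le_iff₀ (by linarith)]
      nlinarith
    have h0 : (0 : ℝ) ≤ R / D := by positivity
    refine le_trans ?_ hR
    rcases le_total (R / D : ℝ) ρ with h | h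
    · have h3 := hlip _ _ h0 h
      have h4 : Real.log (1 + R / D) ≤ Real.log (1 + ρ) :=
        Real.log_le_log (by linarith) (by linarith)
      rw [abs_sub_comm, abs_sub_comm (R / D : ℝ), abs_of_nonneg (by linarith),
        abs_of_nonneg (by linarith)]
      linarith
    · have h3 := hlip _ _ hρ h
      have h4 : Real.log (1 + ρ) ≤ Real.log (1 + R / D) :=
        Real.log_le_log (by linarith) (by linarith)
      rw [abs_of_nonneg (by linarith), abs_of_nonneg (by linarith)]
      linarith
  have h3 : (1 + (R : ℝ) / D) / D ≤ (1 + lam) / D := by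
    gcongr
    rw [div_le_iff₀ hD0]
    exact (Nat.cast_le.2 hRΛ).trans hΛ
  rw [hnum, hZ, Real.log_mul hZ0.ne' (by linarith), Nat.cast_add, add_div]
  obtain ⟨a1, a2⟩ := hacc
  obtain ⟨b1, b2⟩ := abs_le.1 h1
  obtain ⟨c1, c2⟩ := abs_le.1 h2
  constructor <;> nlinarith

end RAM

end

/-! ### Running-time bounds up to constants -/

section

open Real Finset

/-- `f` is at most a constant times `g`. -/
def Dom {α : Type*} (f g : α → ℕ) : Prop := ∃ A, ∀ x, f x ≤ A * g x

namespace Dom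

variable {α : Type*} {f f' g g' : α → ℕ}

theorem of_le (h : ∀ x, f x ≤ g x) : Dom f g := ⟨1, fun x => by rw [one_mul]; exact h x⟩

theorem mono (h : Dom f g) (hg : ∀ x, g x ≤ g' x) : Dom f g' := by
  obtain ⟨A, hA⟩ := h
  exact ⟨A, fun x => (hA x).trans (Nat.mul_le_mul_left A (hg x))⟩

theorem add (h : Dom f g) (h' : Dom f' g) : Dom (fun x => f x + f' x) g := by
  obtain ⟨A, hA⟩ := h
  obtain ⟨A', hA'⟩ := h'
  exact ⟨A + A', fun x => by rw [add_mul]; exact add_le_add (hA x) (hA' x)⟩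

theorem mul (h : Dom f g) (h' : Dom f' g') : Dom (fun x => f x * f' x) fun x => g x * g' x := by
  obtain ⟨A, hA⟩ := h
  obtain ⟨A', hA'⟩ := h'
  exact ⟨A * A', fun x => (Nat.mul_le_mul (hA x) (hA' x)).trans (le_of_eq (by ring))⟩

theorem const (c : ℕ) (hg : ∀ x, 1 ≤ g x) : Dom (fun _ => c) g :=
  ⟨c, fun x => Nat.le_mul_of_pos_right c (hg x)⟩

theorem const_mul (c : ℕ) (h : Dom f g) : Dom (fun x => c * f x) g := by
  obtain ⟨A, hA⟩ := h
  exact ⟨c * A, fun x => by rw [mul_assoc]; exact Nat.mul_le_mul_left c (hA x)⟩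

theorem trans (h : Dom f f') (h' : Dom f' g) : Dom f g := by
  obtain ⟨A, hA⟩ := h
  obtain ⟨A', hA'⟩ := h'
  exact ⟨A * A', fun x => (hA x).trans (by
    rw [mul_assoc]; exact Nat.mul_le_mul_left A (hA' x))⟩

end Dom

namespace RAM

variable {α : Type*}

theorem dom_bitBound {k : ℕ} {Λ D P : α → ℕ} (hP : ∀ x, 1 ≤ P x) (hD : Dom D P) (hΛ : Dom Λ P) :
    Dom (fun x => bitBound k (Λ x) (D x)) fun x => P x * P x := by
  have h1 : ∀ x, P x ≤ P x * P x := fun x => Nat.le_mul_of_pos_left _ (hP x)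
  exact ((hΛ.add hD).mono h1).add ((hΛ.mul hD).add ((hD.add (hΛ.const_mul (k + 1))).mono h1))

/-- One power of P bounds the depth factor in `stepBound_le`, and two come from the products of
operands in `bitBound`; hence P³ times the number of tree nodes. -/
theorem dom_edgeTime {d k : ℕ} (hdk : 1 ≤ k * d) {Λ D ℓ tp P : α → ℕ} (hP : ∀ x, 1 ≤ P x)
    (hD : Dom D P) (hΛ : Dom Λ P) (hℓ : Dom ℓ P) (htp : Dom tp fun x => P x ^ 3) :
    Dom (fun x => edgeTime d k (Λ x) (D x) (ℓ x) (tp x))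
      fun x => P x ^ 3 * (k * d) ^ (ℓ x + 1) := by
  have hY : ∀ x, 1 ≤ (k * d) ^ (ℓ x + 1) := fun x => Nat.one_le_pow _ _ hdk
  have hPY : ∀ x, 1 ≤ P x * (k * d) ^ (ℓ x + 1) := fun x => Nat.mul_pos (hP x) (hY x)
  have hPP : ∀ x, 1 ≤ P x * P x := fun x => Nat.mul_pos (hP x) (hP x)
  have h3 : ∀ x, 1 ≤ P x ^ 3 := fun x => Nat.one_le_pow _ _ (hP x)
  have h4 : ∀ x, P x ^ 3 ≤ P x ^ 3 * (k * d) ^ (ℓ x + 1) :=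
    fun x => Nat.le_mul_of_pos_right _ (hY x)
  have hstep : Dom (fun x => stepBound d k (ℓ x + 1)) fun x => P x * (k * d) ^ (ℓ x + 1) := by
    refine Dom.trans (f' := fun x => (ℓ x + 1 + 1) * (k * d) ^ (ℓ x + 1))
      ⟨_, fun x => stepBound_le d k (ℓ x + 1) hdk⟩ ?_
    exact ((hℓ.add (.const 1 hP)).add (.const 1 hP)).mul (.of_le fun x => le_rfl)
  have hmul := ((((Dom.const 1 hPY).add hstep).const_mul (d + 1)).add (Dom.const 1 hPY)).add
    (.const 1 hPY) |>.mul (((Dom.const ((step d k).wt) hPP).add (dom_bitBound (k := k) hP hD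
      hΛ)).add
      (.const (sp.wt + 1) hPP))
  have hconst := (Dom.const ((copyP d).wt + rootP.wt + (insertP d k).wt + (advanceP d).wt + 5)
    fun x => (h3 x).trans (h4 x))
  obtain ⟨A, hA⟩ := (hconst.add (hmul.mono fun x => le_of_eq (show _ = P x ^ 3 *
    (k * d) ^ (ℓ x + 1) by ring))).add (htp.mono h4)
  exact ⟨A, fun x => (le_of_eq (by simp only [edgeTime]; ring)).trans (hA x)⟩

theorem dom_totalTime {d k : ℕ} (hdk : 1 ≤ k * d) {n r Λ D ℓ tc tp P : α → ℕ}
    (hP : ∀ x, 1 ≤ P x) (hr : Dom r P) (hD : Dom D P) (hΛ : Dom Λ P) (hℓ : Dom ℓ P)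
    (htc : Dom tc fun x => P x ^ 3) (htp : Dom tp fun x => P x ^ 3) :
    Dom (fun x => totalTime d k (n x) (r x) (ℓ x) (D x) (Λ x) (tc x) (tp x))
      fun x => (n x + 1) * (P x ^ 3 * (k * d) ^ (ℓ x + 1)) := by
  have hY : ∀ x, 1 ≤ (k * d) ^ (ℓ x + 1) := fun x => Nat.one_le_pow _ _ hdk
  have h3 : ∀ x, 1 ≤ P x ^ 3 := fun x => Nat.one_le_pow _ _ (hP x)
  have h4 : ∀ x, P x ^ 3 ≤ P x ^ 3 * (k * d) ^ (ℓ x + 1) :=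
    fun x => Nat.le_mul_of_pos_right _ (hY x)
  have h5 : ∀ x, P x ≤ P x ^ 3 := fun x => Nat.le_self_pow (by norm_num) _
  have h6 : ∀ x, P x ^ 3 * (k * d) ^ (ℓ x + 1) ≤ (n x + 1) * (P x ^ 3 * (k * d) ^ (ℓ x + 1)) :=
    fun x => Nat.le_mul_of_pos_left _ (Nat.succ_pos _)
  have h7 : ∀ x, P x ^ 3 ≤ (n x + 1) * (P x ^ 3 * (k * d) ^ (ℓ x + 1)) :=
    fun x => (h4 x).trans (h6 x)
  have h8 : ∀ x, 1 ≤ P x ^ 3 * (k * d) ^ (ℓ x + 1) := fun x => (h3 x).trans (h4 x)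
  have h9 := fun x => (h3 x).trans (h7 x)
  have e1 := ((hr.add (.const 1 hP)).const_mul 30).mono fun x => (h5 x).trans (h7 x)
  have e2 : Dom (fun x => 30 * (n x + 1)) fun x => (n x + 1) * (P x ^ 3 * (k * d) ^ (ℓ x + 1)) :=
    ⟨30, fun x => Nat.mul_le_mul_left _ (Nat.le_mul_of_pos_right _ (h8 x))⟩
  have e3 := htc.mono h7
  have e4 := (Dom.const initP.wt h9).add (hD.mono fun x => (h5 x).trans (h7 x))
  have e5 := (Dom.of_le (f := fun x => n x + 1) fun x => le_rfl).mul
    (((Dom.const (rd 0 (.lit 6)).wt h8).add (dom_edgeTime hdk hP hD hΛ hℓ htp)).add (.const 1 h8))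
  exact ((((e1.add e2).add e3).add e4).add e5).add (.const outputP.wt h9) |>.add (.const 5 h9)

end RAM

end

/-! ### Choice of the depth; error of a product -/

section

open Real Finset

theorem two_pow_clog_le {N : ℕ} (hN : 0 < N) : 2 ^ Nat.clog 2 N ≤ 2 * N := by
  rcases Nat.lt_or_ge 1 N with h | h
  · have h1 := Nat.pow_pred_clog_lt_self (b := 2) (by norm_num) h
    have h2 : 0 < Nat.clog 2 N := Nat.clog_pos (by norm_num) h
    obtain ⟨j, hj⟩ := Nat.exists_eq_succ_of_ne_zero h2.ne'
    rw [hj] at h1 ⊢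
    rw [Nat.pred_succ] at h1
    rw [pow_succ]; omega
  · rw [Nat.clog_of_right_le_one h]; omega

/-- A depth logarithmic in `N` at which an exponentially decaying error is below `1 / (4 * N)`. -/
theorem exists_log_depth {κ : ℝ} (hκ : 0 < κ) (M : ℝ) : ∃ c₁ c₂ c₃ : ℕ,
    (∀ N : ℕ, 0 < N → M * exp (-(κ / 2)) ^ (c₁ * Nat.clog 2 N / c₂ + c₃) ≤ 1 / (4 * N)) ∧
    ∀ b : ℝ, 1 ≤ b → ∃ A : ℝ, 0 ≤ A ∧ ∀ N : ℕ, 0 < N →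
      b ^ (c₁ * Nat.clog 2 N / c₂ + c₃ + 1) ≤ A * (N : ℝ) ^ (4 * (log b / κ)) := by
  -- Depth t per binary digit of N is what is needed: exp(-κ/2)^t = 1/2.
  set t : ℝ := 2 * log 2 / κ with ht
  have hl2 : 0 < log 2 := log_pos (by norm_num)
  have ht0 : 0 < t := by positivity
  obtain ⟨c₂, hc₂⟩ := exists_nat_ge (1 / t)
  have hc₂' : 1 ≤ c₂ * t := by rwa [div_le_iff₀ ht0] at hc₂
  have hc₂0 : (0 : ℝ) < c₂ := lt_of_lt_of_le (by positivity) hc₂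
  -- The program contains only natural constants, so t is replaced by a fraction between t and 2t;
  -- this costs a factor 2 in the exponent of the running time.
  set c₁ := ⌈(c₂ : ℝ) * t⌉₊ with hc₁
  have h1 : (c₂ : ℝ) * t ≤ c₁ := Nat.le_ceil _
  have h2 : (c₁ : ℝ) ≤ 2 * (c₂ * t) := by
    have := Nat.ceil_lt_add_one (show 0 ≤ (c₂ : ℝ) * t by positivity)
    linarith
  have hq1 : exp (-(κ / 2)) < 1 := by rw [exp_lt_one_iff]; linarith
  -- The j extra levels absorb M and the factor 1/4; one further level makes up for the division
  -- rounded down.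
  obtain ⟨j, hj⟩ := exists_pow_lt_of_lt_one (show (0 : ℝ) < 1 / (4 * (|M| + 1)) by positivity) hq1
  have hj' : M * exp (-(κ / 2)) ^ j ≤ 1 / 4 := by
    have h3 : (|M| + 1) * exp (-(κ / 2)) ^ j ≤ 1 / 4 := by
      rw [lt_div_iff₀ (by positivity)] at hj
      linarith
    refine le_trans ?_ h3
    gcongr
    linarith [le_abs_self M]
  refine ⟨c₁, c₂, j + 1, fun N hN => ?_, fun b hb => ?_⟩
  · set L := Nat.clog 2 N with hL
    set e := c₁ * L / c₂ with he
    have hN0 : (0 : ℝ) < N := by exact_mod_cast hN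
    have h3 : t * L ≤ e + 1 := by
      have h4 : c₁ * L < (e + 1) * c₂ := by
        have := Nat.lt_div_mul_add (a := c₁ * L) (b := c₂) (by exact_mod_cast hc₂0)
        rw [he, Nat.add_mul]; omega
      have h5 : (c₁ : ℝ) * L ≤ (e + 1) * c₂ := by exact_mod_cast h4.le
      have h6 : (c₂ * t) * (L : ℝ) ≤ c₁ * L := by gcongr
      exact le_of_mul_le_mul_left (by linarith : (c₂ : ℝ) * (t * L) ≤ c₂ * (e + 1)) hc₂0
    have h4 : exp (-(κ / 2)) ^ (e + 1) ≤ 1 / N := by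
      have h5 : (N : ℝ) ≤ 2 ^ L := by exact_mod_cast Nat.le_pow_clog (by norm_num) N
      have h6 : exp (-(κ / 2)) ^ (e + 1) ≤ exp (-(log 2 * L)) := by
        rw [← exp_nat_mul, exp_le_exp]
        have : κ / 2 * (t * L) = log 2 * L := by rw [ht]; field_simp
        push_cast
        nlinarith
      refine h6.trans ?_
      rw [exp_neg, mul_comm, exp_nat_mul, exp_log (by norm_num), one_div]
      gcongr
    calc M * exp (-(κ / 2)) ^ (e + (j + 1)) =
        (M * exp (-(κ / 2)) ^ j) * exp (-(κ / 2)) ^ (e + 1) := by ring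
      _ ≤ 1 / 4 * (1 / N) := by gcongr
      _ = _ := by field_simp
  · have hlb : 0 ≤ log b := log_nonneg hb
    have hb0 : 0 < b := by linarith
    refine ⟨b ^ (j + 2) * 2 ^ (4 * (log b / κ)), by positivity, fun N hN => ?_⟩
    set L := Nat.clog 2 N with hL
    set e := c₁ * L / c₂ with he
    have h3 : (e : ℝ) ≤ 2 * t * L := by
      have h4 : e * c₂ ≤ c₁ * L := Nat.div_mul_le_self _ _
      have h5 : (e : ℝ) * c₂ ≤ c₁ * L := by exact_mod_cast h4
      have h6 : (c₁ : ℝ) * L ≤ 2 * (c₂ * t) * L := by gcongr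
      exact le_of_mul_le_mul_left (by linarith : (c₂ : ℝ) * e ≤ c₂ * (2 * t * L)) hc₂0
    have h4 : b ^ e ≤ (2 * N : ℝ) ^ (4 * (log b / κ)) := by
      calc b ^ e = exp (e * log b) := by rw [exp_nat_mul, exp_log hb0]
        _ ≤ exp (2 * t * L * log b) := by gcongr
        _ = ((2 : ℝ) ^ L) ^ (4 * (log b / κ)) := by
          rw [← rpow_natCast, ← rpow_mul (by norm_num), rpow_def_of_pos (by norm_num)]
          congr 1
          rw [ht]; field_simp; ring
        _ ≤ _ := by
          gcongr
          exact_mod_cast two_pow_clog_le hN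
    calc b ^ (e + (j + 1) + 1) = b ^ (j + 2) * b ^ e := by ring
      _ ≤ b ^ (j + 2) * (2 * N : ℝ) ^ (4 * (log b / κ)) := by gcongr
      _ = _ := by rw [mul_rpow (by norm_num) (by positivity)]; ring

/-- A relative error `ε / (2 * n)` in each of `n` factors. -/
theorem isApprox_of_one_sub_pow {ε δ Z z : ℝ} {n : ℕ} (hZ : 0 ≤ Z) (hδ : 0 ≤ δ) (hε : ε ≤ 1)
    (hnδ : n * δ ≤ ε / 2) (h1 : (1 - δ) ^ n * Z ≤ z) (h2 : z ≤ (1 + δ) ^ n * Z) :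
    IsApprox ε Z z := by
  have hnδ0 : 0 ≤ n * δ := by positivity
  rcases Nat.eq_zero_or_pos n with rfl | hn
  · simp at h1 h2 hnδ
    exact ⟨by nlinarith, by nlinarith⟩
  have hn1 : (1 : ℝ) ≤ n := by exact_mod_cast hn
  have hδ1 : δ ≤ 1 / 2 := by nlinarith
  have h3 : 1 - ε ≤ (1 - δ) ^ n := by
    have := one_add_mul_le_pow (show -2 ≤ -δ by linarith) n
    rw [← sub_eq_add_neg] at this
    linarith
  have h4 : (1 + δ) ^ n ≤ 1 + ε := by
    have h5 : (1 + δ) ^ n ≤ exp (n * δ) := by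
      rw [exp_nat_mul]
      gcongr
      linarith [add_one_le_exp δ]
    -- With nδ ≤ ε/2 and ε ≤ 1, exp(nδ) ≤ 1/(1 - nδ) ≤ 1 + ε.
    have h6 := exp_bound_div_one_sub_of_interval hnδ0 (by linarith : n * δ < 1)
    refine h5.trans (h6.trans ?_)
    rw [div_le_iff₀ (by linarith)]
    nlinarith
  exact ⟨le_trans (by gcongr) h1, h2.trans (by gcongr)⟩

end

/-! ### Approximating the partition function below the critical activity -/

section

open Real Finset

namespace HGraph

theorem weight_empty {V E : Type*} [DecidableEq V] [DecidableEq E] (H : HGraph V E)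
    (lam : ℝ) : H.weight lam ∅ = 1 := by
  have : H.matchings ∅ = {∅} := by
    ext M
    simp only [mem_matchings H, Finset.mem_singleton, Finset.subset_empty]
    exact ⟨fun h => h.1, fun h => ⟨h, by simp [h, IsMatching]⟩⟩
  simp [weight, this]

end HGraph

open RAM in
theorem roundErr_eq (d k : ℕ) (lam : ℝ) (D : ℕ) :
    roundErr d k lam D = k * (d + 2) / √(k * ratioBound d k lam) / D := by
  rw [roundErr]; ring

theorem Contracts.mono {ι κ : Type*} {m k : ℕ} {lam a b b' : ℝ} (h : Contracts ι κ m k lam a b)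
    (hb : b ≤ b') : Contracts ι κ m k lam a b' :=
  fun I J R R' hI hJ hR => (h I J R R' hI hJ hR).trans hb

theorem natCeil_div_le {a b : ℕ} (ha : 0 < a) (hab : a < b) :
    ((⌈(b : ℝ) / a⌉₊ : ℕ) : ℝ) ≤ 2 * (1 / ((a : ℝ) / b)) := by
  have ha0 : (0 : ℝ) < a := by exact_mod_cast ha
  have h1 : 1 ≤ (b : ℝ) / a := by
    rw [one_le_div ha0]; exact_mod_cast hab.le
  have := Nat.ceil_lt_add_one (show 0 ≤ (b : ℝ) / a by positivity)
  rw [one_div_div]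
  linarith

theorem natFloor_mul_le (lam : ℝ) (D : ℕ) : ⌊lam * D⌋₊ ≤ ⌈lam⌉₊ * D := by
  refine Nat.floor_le_of_le ?_
  push_cast
  gcongr
  exact Nat.le_ceil _

namespace RAM

/-- Here P = N² dominates all parameters; P³ gives N⁶, and the number n + 1 ≤ N of rounds gives the
seventh power. -/
theorem dom_totalTime_exp {d k : ℕ} (hdk : 1 ≤ k * d) (lam : ℝ) (c₁ c₂ c₃ c₄ : ℕ) :
    ∃ A : ℕ, ∀ r n N : ℕ, 0 < r → N = r * (n + 1) →
      totalTime d k n r (c₁ * Nat.clog 2 N / c₂ + c₃) (c₄ * (N * N)) ⌊lam * (c₄ * (N * N) : ℕ)⌋₊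
        (setupExpTime r n c₁ c₂ c₃ c₄ N)
        (postExpTime n (c₄ * (N * N)) ⌊lam * (c₄ * (N * N) : ℕ)⌋₊) ≤
      A * (N ^ 7 * (k * d) ^ (c₁ * Nat.clog 2 N / c₂ + c₃ + 1)) := by
  set α := {p : ℕ × ℕ // 0 < p.1}
  set N : α → ℕ := fun p => p.1.1 * (p.1.2 + 1) with hN
  set P : α → ℕ := fun p => N p * N p with hPdef
  have hN1 : ∀ p, 1 ≤ N p := fun p => Nat.mul_pos p.2 (Nat.succ_pos _)
  have hP : ∀ p, 1 ≤ P p := fun p => Nat.mul_pos (hN1 p) (hN1 p)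
  have hNP : ∀ p, N p ≤ P p := fun p => Nat.le_mul_of_pos_left _ (hN1 p)
  have hP2 : ∀ p, P p * P p ≤ P p ^ 3 := fun p => by
    rw [← sq]; exact Nat.pow_le_pow_right (hP p) (by norm_num)
  have hP3 : ∀ p, P p ≤ P p ^ 3 := fun p => Nat.le_self_pow (by norm_num) _
  have dN : Dom N P := .of_le hNP
  have dr : Dom (fun p : α => p.1.1) P :=
    .of_le fun p => (Nat.le_mul_of_pos_right _ (Nat.succ_pos _)).trans (hNP p)
  have dn : Dom (fun p : α => p.1.2 + 1) P :=
    .of_le fun p => (Nat.le_mul_of_pos_left _ p.2).trans (hNP p)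
  have dn' : Dom (fun p : α => p.1.2) P := Dom.trans (.of_le fun p => Nat.le_succ _) dn
  have dc : ∀ c, Dom (fun _ : α => c) P := fun c => .const c hP
  have dD : Dom (fun p => c₄ * (N p * N p)) P := ⟨c₄, fun p => le_rfl⟩
  have dΛ : Dom (fun p => ⌊lam * (c₄ * (N p * N p) : ℕ)⌋₊) P :=
    Dom.trans ⟨⌈lam⌉₊, fun p => natFloor_mul_le _ _⟩ dD
  have dℓ : Dom (fun p => c₁ * Nat.clog 2 (N p) / c₂ + c₃) P := by
    refine Dom.add (Dom.trans (f' := fun p => c₁ * N p) (.of_le fun p => ?_)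
      (dN.const_mul c₁)) (dc c₃)
    refine (Nat.div_le_self _ _).trans (Nat.mul_le_mul_left _ ?_)
    rw [Nat.clog_le_iff_le_pow (by norm_num)]
    exact Nat.lt_two_pow_self.le
  have dtc : Dom (fun p : α => setupExpTime p.1.1 p.1.2 c₁ c₂ c₃ c₄ (N p)) fun p => P p ^ 3 := by
    refine Dom.mono (g := P) ?_ hP3
    obtain ⟨A, hA⟩ := ((((dc ((setupExp c₁ c₂ c₃ c₄).wt + 1000)).add (dr.add dn)).add
      ((dN.add (dc 1)).const_mul 1000)).add (((dc (c₁ + c₂ + c₄)).add (dN.const_mul (3 + c₁))).add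
        (Dom.of_le fun p => le_refl (P p))))
    exact ⟨A, fun p => (le_of_eq (by simp only [setupExpTime, hPdef]; ring)).trans (hA p)⟩
  have dtp : Dom (fun p : α => postExpTime p.1.2 (c₄ * (N p * N p))
      ⌊lam * (c₄ * (N p * N p) : ℕ)⌋₊) fun p => P p ^ 3 := by
    have e1 := ((dD.add dΛ).mul dn').mono hP2
    have e2 := (dc 1).mono hP3
    exact ((dc postExp.wt).mono hP3).add ((((e1.add e2).add ((dD.add dΛ).mono hP3)).add
      (e1.add e2)).add (dD.mono hP3))
  obtain ⟨A, hA⟩ := dom_totalTime (n := fun p : α => p.1.2) hdk hP dr dD dΛ dℓ dtc dtp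
  refine ⟨A, fun r n N' hr hN' => ?_⟩
  subst hN'
  refine (hA ⟨(r, n), hr⟩).trans (Nat.mul_le_mul_left _ ?_)
  simp only [hPdef, hN]
  rw [← mul_assoc]
  refine Nat.mul_le_mul_right _ ?_
  calc (n + 1) * (r * (n + 1) * (r * (n + 1))) ^ 3 ≤
      (r * (n + 1)) * (r * (n + 1) * (r * (n + 1))) ^ 3 :=
        Nat.mul_le_mul_right _ (Nat.le_mul_of_pos_left _ hr)
    _ = _ := by ring

end RAM

open RAM in
-- With N = r(n + 1) and r = ⌈1/ε⌉, an error 1/(2N) per ratio keeps the product within 1 ± ε. Depth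
-- O(log N) and denominator O(N²) suffice for this, and the (kd)^depth nodes become a power of N.
theorem exists_approximates_partitionFn {d k : ℕ} (hd : 1 ≤ d) (hk : 1 ≤ k) {lam x : ℝ}
    (hlam : 0 < lam) (hx : 0 < x) (hμ : k * lam = x * (1 + x) ^ d) (hdx : d * x < 1 + x) :
    ∃ (A : ℝ) (P : Prog), Approximates d k lam P (fun H => H.partitionFn lam)
      fun n ε => A * (((n : ℝ) + 1) / ε) ^
        (7 * (1 + log ((k : ℝ) * d) / log ((1 + x) / (d * x)))) := by
  obtain ⟨C, hC0, hC⟩ := HGraph.exists_abs_sub_le_potential hk lam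
  have hd0 : (0 : ℝ) < d := by exact_mod_cast hd
  have hk0 : (0 : ℝ) < k := by exact_mod_cast hk
  have hdk : 1 ≤ k * d := Nat.mul_pos hk hd
  set κ := log ((1 + x) / (d * x)) with hκ
  have hκ0 : 0 < κ := log_pos ((one_lt_div (by positivity)).2 hdx)
  set q := exp (-(κ / 2)) with hq
  -- The contraction rate is the square root of dx/(1 + x) = exp(-κ), hence half of κ in the
  -- exponent.
  have hqs : √(d * x / (1 + x)) = q := by
    rw [hq, ← neg_div, ← log_inv, inv_div, exp_half, exp_log (by positivity)]
  have hq0 : 0 < q := exp_pos _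
  have hq1 : q ≤ 1 := by rw [hq, exp_le_one_iff]; linarith
  set m := potential k lam with hm
  have hm0 : 0 ≤ m := potential_nonneg k lam
  have hcon : ∀ a, 0 ≤ a → Contracts (Fin (d + 1)) ℕ d k lam a (q * a) := fun a ha =>
    hqs ▸ contracts_sqrt_mul (Fin (d + 1)) ℕ hd hk hlam hx hμ hdx.le ha
  obtain ⟨c₁, c₂, c₃, hdepth, hpow⟩ := exists_log_depth hκ0 (C * ((d + 1) * m))
  set η := k * (d + 2) / √(k * ratioBound d k lam) with hη
  have hη0 : 0 ≤ η := by positivity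
  -- Of the two factors N in the denominator, one cancels the number of levels, which is at most a
  -- multiple of N, and the other makes the total rounding error at most 1/(4N). The final summand 1
  -- keeps D positive.
  obtain ⟨c₄, hc₄⟩ := exists_nat_ge (4 * (C * ((d + 1) * ((c₁ + c₃ + 2) * η))) + 1)
  have hc₄0 : (0 : ℝ) < c₄ := lt_of_lt_of_le (by positivity) hc₄
  obtain ⟨A₁, hA₁⟩ := dom_totalTime_exp hdk lam c₁ c₂ c₃ c₄
  have hb : (1 : ℝ) ≤ k * d := by exact_mod_cast hdk
  obtain ⟨A₂, hA₂0, hA₂⟩ := hpow (k * d) hb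
  have hL0 : 0 ≤ log ((k : ℝ) * d) / κ := div_nonneg (log_nonneg hb) hκ0.le
  set s := 7 * (1 + log ((k : ℝ) * d) / κ) with hs
  refine ⟨A₁ * (A₂ * 2 ^ s), mainP d k (setupExp c₁ c₂ c₃ c₄) postExp, ?_⟩
  intro V n H hsize hdeg a b ha hab
  have ha0 : (0 : ℝ) < a := by exact_mod_cast ha
  have hb0 : (0 : ℝ) < b := by exact_mod_cast ha.trans hab
  set ε : ℝ := (a : ℝ) / b with hε
  have hε0 : 0 < ε := by positivity
  have hε1 : ε ≤ 1 := (div_le_one hb0).2 (by exact_mod_cast hab.le)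
  set r := ⌈(b : ℝ) / a⌉₊ with hr
  have hr0 : 0 < r := Nat.ceil_pos.2 (by positivity)
  have hr1 : 1 / ε ≤ r := by rw [hε, one_div_div]; exact Nat.le_ceil _
  set N := r * (n + 1) with hN
  have hNpos : 0 < N := Nat.mul_pos hr0 (Nat.succ_pos _)
  have hN1 : (1 : ℝ) ≤ N := by exact_mod_cast hNpos
  set ℓ := c₁ * Nat.clog 2 N / c₂ + c₃ with hℓ
  set D := c₄ * (N * N) with hD
  have hDpos : 0 < D := Nat.mul_pos (by exact_mod_cast hc₄0) (Nat.mul_pos hNpos hNpos)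
  set Λ := ⌊lam * D⌋₊ with hΛ
  set δ : ℝ := 1 / (2 * N) with hδ
  have hδ1 : δ ≤ 1 := by rw [hδ, div_le_one (by positivity)]; linarith
  have hδ0 : 0 ≤ δ := by positivity
  have hnδ : n * δ ≤ ε / 2 := by
    have h1 : 1 ≤ r * ε := by rwa [div_le_iff₀ hε0] at hr1
    have h2 : (N : ℝ) = r * (n + 1) := by rw [hN]; push_cast; ring
    have h3 : (n : ℝ) + 1 ≤ ε * N := by
      rw [h2]
      have := mul_le_mul_of_nonneg_right h1 (show (0 : ℝ) ≤ n + 1 by positivity)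
      linarith
    rw [hδ, mul_one_div, div_le_div_iff₀ (by positivity) (by norm_num)]
    linarith
  set G := padGraph d H.sizeAt H.vertexAt with hG
  have hacc : C * ((d + 1) * (q ^ ℓ * m + (ℓ + 2) * roundErr d k lam D)) ≤ δ := by
    have h1 := hdepth N hNpos
    have h2 : (ℓ : ℝ) + 2 ≤ (c₁ + c₃ + 2) * N := by
      have h3 : ℓ ≤ c₁ * N + c₃ := by
        refine Nat.add_le_add_right ((Nat.div_le_self _ _).trans (Nat.mul_le_mul_left _ ?_)) _
        rw [Nat.clog_le_iff_le_pow (by norm_num)]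
        exact Nat.lt_two_pow_self.le
      have h4 : (ℓ : ℝ) ≤ c₁ * N + c₃ := by exact_mod_cast h3
      have h5 := le_mul_of_one_le_right (show (0 : ℝ) ≤ c₃ by positivity) hN1
      linarith
    have h5 : C * ((d + 1) * ((ℓ + 2) * roundErr d k lam D)) ≤ 1 / (4 * N) := by
      rw [roundErr_eq, ← hη]
      calc C * ((d + 1) * ((ℓ + 2) * (η / D))) ≤
          C * ((d + 1) * (((c₁ + c₃ + 2) * N) * (η / D))) := by gcongr
        _ = (4 * (C * ((d + 1) * ((c₁ + c₃ + 2) * η)))) * (N / D) / 4 := by ring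
        _ ≤ c₄ * (N / D) / 4 := by gcongr; linarith
        _ = _ := by rw [hD]; push_cast; field_simp
    have h6 : δ = 1 / (4 * N) + 1 / (4 * N) := by rw [hδ]; field_simp; norm_num
    calc C * ((d + 1) * (q ^ ℓ * m + (ℓ + 2) * roundErr d k lam D)) =
        C * ((d + 1) * m) * q ^ ℓ + C * ((d + 1) * ((ℓ + 2) * roundErr d k lam D)) := by ring
      _ ≤ δ := by rw [h6]; exact add_le_add h1 h5
  obtain ⟨mm, t, ht, hexec, hden, -, hlo, hhi⟩ := exists_exec_of_acc hd hk hlam hC hC0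
    (err := fun ℓ => q ^ ℓ * m) (a := a) (b := b) (r := r) (δ := δ) (setup := setupExp c₁ c₂ c₃ c₄)
    (post := postExp) (tc := setupExpTime r n c₁ c₂ c₃ c₄ N) (tp := postExpTime n D Λ)
    (Acc := AccExp (fun e => G.weight lam (range e)) δ D Λ)
    (fun a ha => (hcon a ha).mono (mul_le_of_le_one_left ha hq1)) (by simp [hm])
    (fun ℓ => by positivity)
    (fun ℓ => (hcon _ (by positivity)).mono (le_of_eq (by ring))) H hsize hdeg ha hr hDpos hΛ hacc
    (fun B h2 h3 h0 => by
      obtain ⟨s, e1, e2, e3, e4, e5, e6⟩ := setupExp_runs (lam := lam) (c₁ := c₁) (c₂ := c₂)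
        (c₃ := c₃) (c₄ := c₄) hN h2 h3 h0
      refine ⟨s, e1, by rw [e2, hℓ]; ring, e3, e4, ?_⟩
      rw [e5, e6]
      simp [AccExp, HGraph.weight_empty])
    (fun B e he s h2 hA h9 hR => postExp_runs he hDpos h2 hA h9 hδ1 (G.weight_pos hlam _).le
      (by rw [Finset.range_add_one]; exact G.weight_insert_eq_mul hlam Finset.notMem_range_self)
      (G.ratio_pos hlam _ _).le hR)
  refine ⟨mm, t, hexec, ?_, by rw [hden]; exact Nat.pow_pos hDpos, ?_⟩
  · have h1 : (N : ℝ) ≤ 2 * ((n + 1) / ε) := by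
      have h2 := natCeil_div_le ha hab
      rw [← hr, ← hε] at h2
      rw [hN]; push_cast
      calc (r : ℝ) * (n + 1) ≤ 2 * (1 / ε) * (n + 1) := by gcongr
        _ = _ := by ring
    have h2 : (t : ℝ) ≤ A₁ * (N ^ 7 * (k * d) ^ (ℓ + 1)) := by
      exact_mod_cast ht.trans (hA₁ r n N hr0 hN)
    calc (t : ℝ) ≤ A₁ * (N ^ 7 * (k * d) ^ (ℓ + 1)) := h2
      _ ≤ A₁ * (N ^ 7 * (A₂ * (N : ℝ) ^ (4 * (log ((k : ℝ) * d) / κ)))) := by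
        gcongr
        exact hA₂ N hNpos
      _ = A₁ * (A₂ * (N : ℝ) ^ (7 + 4 * (log ((k : ℝ) * d) / κ))) := by
        rw [rpow_add (by positivity)]
        norm_cast
        ring
      -- The exponent 7 + 4 log(kd)/κ is raised to 7(1 + log(kd)/κ); this makes 7 an absolute
      -- constant for all d, k and λ.
      _ ≤ A₁ * (A₂ * (N : ℝ) ^ s) := by
        gcongr 2
        refine rpow_le_rpow_of_exponent_le hN1 ?_
        rw [hs]; linarith
      _ ≤ A₁ * (A₂ * (2 * ((n + 1) / ε)) ^ s) := by gcongr
      _ = _ := by rw [mul_rpow (by norm_num) (by positivity)]; ring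
  · change IsApprox ε (H.partitionFn lam) _
    rw [H.partitionFn_eq_weight hsize, hden]
    push_cast
    exact isApprox_of_one_sub_pow (G.weight_pos hlam _).le hδ0 hε1 hnδ hlo hhi

end

/-! ### Lower bound for ratios and running time at the critical activity -/

section

open Real Finset

namespace RAM

/-- Each of the d + 1 factors sums at most k ratios, none above λ. The bound does not depend on A,
so every summand of ln Z is bounded away from 0. -/
theorem ratioBound_le_ratio {V E : Type*} [DecidableEq V] [DecidableEq E] {H : HGraph V E}
    {d k : ℕ} {vert : E → Fin (d + 1) → V} {lam : ℝ} {A : Finset E} (hlam : 0 < lam)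
    (hvert : ∀ f, H.edge f = univ.image (vert f)) (hdeg : H.DegreeLE (k + 1)) {f : E}
    (hf : f ∉ A) : ratioBound d k lam ≤ H.ratio lam A f := by
  have hpos : 0 ≤ (1 + (k + 1) * lam)⁻¹ := by positivity
  have haway : H.away A ∅ = A := by ext; simp [HGraph.mem_away]
  have h := congrFun (congrFun (H.ratio_eq_treeStep vert A hlam hvert) ∅) f
  simp only [haway] at h
  rw [h, HGraph.treeStep, branchRatio, ratioBound]
  refine mul_le_mul_of_nonneg_left ?_ hlam.le
  have hconst : (1 + (k + 1) * lam)⁻¹ ^ (d + 1) = ∏ _j : Fin (d + 1), (1 + (k + 1) * lam)⁻¹ := by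
    simp
  rw [hconst]
  have hs : ∀ j, ∑ g ∈ H.children vert A ∅ f j,
      H.ratio lam (H.away A (HGraph.visited vert ∅ f (j + 1))) g ≤
      (k + 1) * lam := by
    intro j
    refine (Finset.sum_le_card_nsmul _ _ lam fun g _ => H.ratio_away_le hlam hvert _ g).trans ?_
    rw [nsmul_eq_mul]
    have : ((H.children vert A ∅ f j).card : ℝ) ≤ k := by
      exact_mod_cast H.card_children_le hdeg hvert (Or.inl hf) j
    gcongr
    linarith
  refine Finset.prod_le_prod (fun j _ => hpos) fun j _ => inv_anti₀ ?_ ?_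
  · exact add_pos_of_pos_of_nonneg one_pos (Finset.sum_nonneg fun g _ => (H.ratio_pos hlam _ _).le)
  · exact add_le_add_right (hs j) 1

theorem dom_totalTime_log {d k : ℕ} (hdk : 1 ≤ k * d) (lam : ℝ) (c₁ c₂ : ℕ) :
    ∃ A : ℕ, ∀ r n : ℕ, 0 < r →
      totalTime d k n r (c₁ * (r * r)) (c₂ * (r * (r * r))) ⌊lam * (c₂ * (r * (r * r)) : ℕ)⌋₊
        (setupLogTime r c₁ c₂ (c₂ * (r * (r * r))))
        (postLogTime (c₂ * (r * (r * r))) ⌊lam * (c₂ * (r * (r * r)) : ℕ)⌋₊) ≤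
      A * ((n + 1) * (r ^ 9 * (k * d) ^ (c₁ * (r * r) + 1))) := by
  set α := {p : ℕ × ℕ // 0 < p.1}
  set r : α → ℕ := fun p => p.1.1 with hr
  set P : α → ℕ := fun p => r p * (r p * r p) with hPdef
  have hr1 : ∀ p, 1 ≤ r p := fun p => p.2
  have hP : ∀ p, 1 ≤ P p := fun p => Nat.mul_pos p.2 (Nat.mul_pos p.2 p.2)
  have hrr : ∀ p, r p * r p ≤ P p := fun p => Nat.le_mul_of_pos_left _ p.2
  have hrP : ∀ p, r p ≤ P p := fun p => (Nat.le_mul_of_pos_left _ p.2).trans (hrr p)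
  have hP3 : ∀ p, P p ≤ P p ^ 3 := fun p => Nat.le_self_pow (by norm_num) _
  have hP1 : ∀ p, P p ≤ P p * P p := fun p => Nat.le_mul_of_pos_left _ (hP p)
  have dr : Dom r P := .of_le hrP
  have drr : Dom (fun p => r p * r p) P := .of_le hrr
  have dc : ∀ c, Dom (fun _ : α => c) P := fun c => .const c hP
  have dD : Dom (fun p => c₂ * (r p * (r p * r p))) P := ⟨c₂, fun p => le_rfl⟩
  have dΛ : Dom (fun p => ⌊lam * (c₂ * (r p * (r p * r p)) : ℕ)⌋₊) P :=
    Dom.trans ⟨⌈lam⌉₊, fun p => natFloor_mul_le _ _⟩ dD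
  have dℓ : Dom (fun p => c₁ * (r p * r p)) P := drr.const_mul c₁
  have dtc : Dom (fun p : α => setupLogTime (r p) c₁ c₂ (c₂ * (r p * (r p * r p))))
      fun p => P p ^ 3 := by
    refine Dom.mono (g := P) ?_ hP3
    obtain ⟨A, hA⟩ := ((((dc ((setupLog c₁ c₂).wt + c₁ + c₂)).add (dr.const_mul 3)).add
      (drr.const_mul 2)).add (dD.const_mul 2)).add (Dom.of_le fun p => le_refl (P p))
    exact ⟨A, fun p => (le_of_eq (by simp only [setupLogTime, hPdef]; ring)).trans (hA p)⟩
  have dtp : Dom (fun p : α => postLogTime (c₂ * (r p * (r p * r p)))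
      ⌊lam * (c₂ * (r p * (r p * r p)) : ℕ)⌋₊) fun p => P p ^ 3 :=
    ((dc (postLog.wt + 1000)).mono hP3).add (((dΛ.add (dc 1)).mul (((dc 1000).mono hP1).add
      ((dD.mul dD).add ((dD.add dΛ).mono hP1)))).mono fun p => le_of_eq (by ring))
  obtain ⟨A, hA⟩ := dom_totalTime (n := fun p : α => p.1.2) hdk hP dr dD dΛ dℓ dtc dtp
  refine ⟨A, fun r' n hr' => (hA ⟨(r', n), hr'⟩).trans (le_of_eq ?_)⟩
  simp only [hPdef, hr]
  ring

end RAM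

/-- The exponents in the running time for the logarithm, at accuracy at most one half. -/
theorem exists_pow_le_rpow_sq {b : ℝ} (hb : 2 ≤ b) (c : ℕ) : ∃ A B' : ℝ, 0 ≤ A ∧
    ∀ (r : ℕ) (ε : ℝ), 0 < ε → ε < 1 → 0 < r → (r : ℝ) < 1 / ε + 1 →
      (r : ℝ) ^ 9 * b ^ (c * (r * r) + 1) ≤ A * b ^ (B' * (1 / ε * log (1 / ε)) ^ 2) := by
  have hb1 : 1 ≤ b := by linarith
  have h9 : ∀ r : ℕ, (r : ℝ) ^ 9 ≤ b ^ (9 * (r * r)) := by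
    intro r
    have h1 : r ≤ 2 ^ (r * r) := by
      refine Nat.lt_two_pow_self.le.trans (Nat.pow_le_pow_right (by norm_num) ?_)
      rcases Nat.eq_zero_or_pos r with h | h
      · simp [h]
      · exact Nat.le_mul_of_pos_left _ h
    have h2 : (r : ℝ) ≤ 2 ^ (r * r) := by exact_mod_cast h1
    calc (r : ℝ) ^ 9 ≤ ((2 : ℝ) ^ (r * r)) ^ 9 := by gcongr
      _ ≤ (b ^ (r * r)) ^ 9 := by gcongr
      _ = _ := by rw [← pow_mul, mul_comm (r * r)]
  have hall : ∀ r : ℕ, (r : ℝ) ^ 9 * b ^ (c * (r * r) + 1) ≤ b * b ^ ((9 + c) * (r * r)) := by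
    intro r
    calc (r : ℝ) ^ 9 * b ^ (c * (r * r) + 1) ≤ b ^ (9 * (r * r)) * b ^ (c * (r * r) + 1) := by
          gcongr; exact h9 r
      _ = _ := by ring
  have hl2 : 0 < log 2 := log_pos (by norm_num)
  set B' : ℝ := (9 + c) * (3 / 2 / log 2) ^ 2 with hB'
  refine ⟨b * b ^ ((9 + c) * (3 * 3)), B', by positivity, fun r ε h0 h1 hr hrε => ?_⟩
  set L := 1 / ε * log (1 / ε) with hL
  refine (hall r).trans ?_
  have hε1 : 1 < 1 / ε := (one_lt_div h0).2 h1
  -- Near ε = 1 the factor log(1/ε) tends to 0 and the exponent on the right gives nothing, but then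
  -- r ≤ 3 and the constant A takes over. For 1/ε ≥ 2 the logarithm is at least log 2, so r is at
  -- most a multiple of (1/ε) log(1/ε).
  rcases le_total (1 / ε) 2 with h | h
  · have h2 : r ≤ 3 := by
      have : (r : ℝ) ≤ 3 := by linarith
      exact_mod_cast this
    have h3 : 1 ≤ b ^ (B' * L ^ 2) := one_le_rpow hb1 (by positivity)
    calc b * b ^ ((9 + c) * (r * r)) ≤ b * b ^ ((9 + c) * (3 * 3)) := by gcongr
      _ ≤ _ := le_mul_of_one_le_right (by positivity) h3
  · have h2 : (r : ℝ) ≤ 3 / 2 / log 2 * L := by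
      have h3 : log 2 ≤ log (1 / ε) := log_le_log (by norm_num) h
      have h4 : (r : ℝ) ≤ 3 / 2 * (1 / ε) := by linarith
      refine h4.trans ?_
      calc 3 / 2 * (1 / ε) = 3 / 2 / log 2 * (1 / ε * log 2) := by field_simp
        _ ≤ _ := by rw [hL]; gcongr
    have h5 : (((9 + c) * (r * r) : ℕ) : ℝ) ≤ B' * L ^ 2 := by
      rw [hB', mul_assoc, ← mul_pow]
      push_cast
      rw [← sq]
      gcongr
    calc b * b ^ ((9 + c) * (r * r)) = b * b ^ (((9 + c) * (r * r) : ℕ) : ℝ) := by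
          rw [rpow_natCast]
      _ ≤ b * b ^ (B' * L ^ 2) := by gcongr
      _ ≤ _ := by
        gcongr
        exact le_mul_of_one_le_right (by linarith) (one_le_pow₀ hb1)

end

/-! ### Approximating the log-partition function at the critical activity; conclusion -/

section

open Real Finset

open RAM in
-- Every ratio is at least `ratioBound`, so every summand of ln Z is at least γ and an absolute
-- error εγ per summand is enough. The budget γ/r ≤ εγ is split equally among truncation, rounding
-- and the harmonic sums, so depth and denominator depend on ε but not on n.
theorem exists_approximates_log_partitionFn {d k : ℕ} (hd : 1 ≤ d) (hk : 1 ≤ k)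
    (hdk : 2 ≤ k * d) {lam x : ℝ} (hlam : 0 < lam) (hx : 0 < x)
    (hμ : k * lam = x * (1 + x) ^ d) (hdx : d * x = 1 + x) :
    ∃ (A B' : ℝ) (P : Prog), Approximates d k lam P (fun H => log (H.partitionFn lam))
      fun n ε => A * ((n : ℝ) + 1) * ((k : ℝ) * d) ^ (B' * (1 / ε * log (1 / ε)) ^ 2) := by
  obtain ⟨C, hC0, hC⟩ := HGraph.exists_abs_sub_le_potential hk lam
  obtain ⟨c, hc, hcube⟩ := exists_contracts_cube hd hk hlam hx hμ hdx
  obtain ⟨K, hK0, hK, hdecay⟩ := exists_cubic_decay hc (potential_nonneg k lam)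
  have hcon : ∀ a, 0 ≤ a → Contracts (Fin (d + 1)) ℕ d k lam a a := fun a ha =>
    hcube _ _ _ _ ha ha fun D hD h => by linarith [mul_nonneg hc.le (pow_nonneg hD 3)]
  set γ := log (1 + ratioBound d k lam) with hγ
  have hγ0 : 0 < γ := log_pos (by linarith [ratioBound_pos (d := d) (k := k) hlam])
  set η := k * (d + 2) / √(k * ratioBound d k lam) with hη
  have hη0 : 0 ≤ η := by positivity
  set ξ := C * (d + 1) with hξ
  have hξ0 : 0 < ξ := by positivity
  -- The error decays like K/√ℓ, so depth c₁r² is needed to bring the truncation error below γ/(3r).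
  obtain ⟨c₁, hc₁⟩ := exists_nat_ge ((3 * (ξ * K) / γ) ^ 2)
  -- In D = c₂r³, a factor r² compensates the number of levels and the remaining r gives γ/(3r). The
  -- second summand serves the error (1 + λ)/D of the harmonic sums, and the third keeps D positive.
  obtain ⟨c₂, hc₂⟩ := exists_nat_ge (3 * (ξ * ((c₁ + 2) * η)) / γ + 3 * (1 + lam) / γ + 1)
  have hc₂1 : 3 * (ξ * ((c₁ + 2) * η)) ≤ c₂ * γ := by
    rw [← div_le_iff₀ hγ0]
    linarith [show 0 ≤ 3 * (1 + lam) / γ by positivity]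
  have hc₂2 : 3 * (1 + lam) ≤ c₂ * γ := by
    rw [← div_le_iff₀ hγ0]
    linarith [show 0 ≤ 3 * (ξ * ((c₁ + 2) * η)) / γ by positivity]
  have hc₂0 : (0 : ℝ) < c₂ := lt_of_lt_of_le (by positivity) hc₂
  have hdk1 : 1 ≤ k * d := by omega
  obtain ⟨A₁, hA₁⟩ := dom_totalTime_log hdk1 lam c₁ c₂
  obtain ⟨A₂, B', hA₂0, hA₂⟩ :=
    exists_pow_le_rpow_sq (show (2 : ℝ) ≤ k * d by exact_mod_cast hdk) c₁
  refine ⟨A₁ * A₂, B', mainP d k (setupLog c₁ c₂) postLog, ?_⟩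
  intro V n H hsize hdeg a b ha hab
  have ha0 : (0 : ℝ) < a := by exact_mod_cast ha
  have hb0 : (0 : ℝ) < b := by exact_mod_cast ha.trans hab
  set ε : ℝ := (a : ℝ) / b with hε
  have hε0 : 0 < ε := by positivity
  have hε1 : ε < 1 := (div_lt_one hb0).2 (by exact_mod_cast hab)
  set r := ⌈(b : ℝ) / a⌉₊ with hr
  have hr0 : 0 < r := Nat.ceil_pos.2 (by positivity)
  have hr0' : (0 : ℝ) < r := by exact_mod_cast hr0
  have hr1 : 1 / ε ≤ r := by rw [hε, one_div_div]; exact Nat.le_ceil _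
  have hr2 : r < 1 / ε + 1 := by
    rw [hε, one_div_div]; exact Nat.ceil_lt_add_one (by positivity)
  set ℓ := c₁ * (r * r) with hℓ
  set D := c₂ * (r * (r * r)) with hD
  have hDpos : 0 < D := Nat.mul_pos (by exact_mod_cast hc₂0) (by positivity)
  have hD0 : (0 : ℝ) < D := by exact_mod_cast hDpos
  have hDr : (D : ℝ) = c₂ * (r * (r * r)) := by rw [hD]; push_cast; ring
  have hr3 : (1 : ℝ) ≤ r * r := by exact_mod_cast Nat.mul_pos hr0 hr0
  set Λ := ⌊lam * D⌋₊ with hΛ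
  set δ : ℝ := 2 * γ / (3 * r) with hδ
  set G := padGraph d H.sizeAt H.vertexAt with hG
  have hacc : C * ((d + 1) * (K / √(ℓ + 1) + (ℓ + 2) * roundErr d k lam D)) ≤ δ := by
    have h1 : ξ * (K / √(ℓ + 1)) ≤ γ / (3 * r) := by
      have h2 : 3 * (ξ * K) / γ * r ≤ √(ℓ + 1) := by
        refine le_sqrt_of_sq_le ?_
        have h3 := mul_le_mul_of_nonneg_right hc₁ (show (0 : ℝ) ≤ r * r by positivity)
        have h4 : (ℓ : ℝ) = c₁ * (r * r) := by rw [hℓ]; push_cast; ring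
        rw [h4, mul_pow, sq (r : ℝ)]
        linarith
      rw [div_mul_eq_mul_div, div_le_iff₀ hγ0] at h2
      rw [← mul_div_assoc, div_le_div_iff₀ (by positivity) (by positivity)]
      linarith
    have h5 : ξ * ((ℓ + 2) * roundErr d k lam D) ≤ γ / (3 * r) := by
      have h6 : (ℓ : ℝ) + 2 ≤ (c₁ + 2) * (r * r) := by
        have h4 : (ℓ : ℝ) = c₁ * (r * r) := by rw [hℓ]; push_cast; ring
        rw [h4]; linarith
      rw [roundErr_eq, ← hη]
      calc ξ * ((ℓ + 2) * (η / D)) ≤ ξ * (((c₁ + 2) * (r * r)) * (η / D)) := by gcongr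
        _ = 3 * (ξ * ((c₁ + 2) * η)) * (r * r / D) / 3 := by ring
        _ ≤ c₂ * γ * (r * r / D) / 3 := by gcongr
        _ = _ := by rw [hDr]; field_simp
    calc C * ((d + 1) * (K / √(ℓ + 1) + (ℓ + 2) * roundErr d k lam D)) =
        ξ * (K / √(ℓ + 1)) + ξ * ((ℓ + 2) * roundErr d k lam D) := by rw [hξ]; ring
      _ ≤ γ / (3 * r) + γ / (3 * r) := add_le_add h1 h5
      _ = δ := by rw [hδ]; ring
  have hgap : δ + (1 + lam) / D ≤ ε * γ := by
    have h1 : (1 + lam) / D ≤ γ / (3 * r) := by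
      rw [div_le_div_iff₀ hD0 (by positivity), hDr]
      have h2 := mul_le_mul_of_nonneg_right hc₂2 hr0'.le
      have h3 := mul_le_mul_of_nonneg_left hr3 (show 0 ≤ c₂ * γ * r by positivity)
      linarith
    have h4 : δ + γ / (3 * r) = 1 / r * γ := by rw [hδ]; field_simp; norm_num
    have h5 : 1 / (r : ℝ) ≤ ε := by rwa [one_div_le hr0' hε0]
    calc δ + (1 + lam) / D ≤ δ + γ / (3 * r) := by linarith
      _ = 1 / r * γ := h4
      _ ≤ ε * γ := by gcongr
  have hdeg' := H.degreeLE_padGraph hsize hdeg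
  obtain ⟨m, t, ht, hexec, hden, happrox⟩ := exists_exec_of_acc hd hk hlam hC hC0
    (err := fun ℓ => K / √(ℓ + 1)) (a := a) (b := b) (r := r) (δ := δ) (setup := setupLog c₁ c₂)
    (post := postLog) (tc := setupLogTime r c₁ c₂ D) (tp := postLogTime D Λ)
    (Acc := AccLog (fun e => G.weight lam (range e)) ε D)
    hcon (by simpa using hK) (fun ℓ => by positivity)
    (fun ℓ => hcube _ _ _ _ (by positivity) (by positivity) (hdecay ℓ))
    H hsize hdeg ha hr hDpos hΛ hacc
    (fun B h2 h3 h0 => by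
      obtain ⟨s, e1, e2, e3, e4, e5, e6⟩ := setupLog_runs (lam := lam) (c₁ := c₁) hD h2 h0
      refine ⟨s, e1, e2, e3, e4, ?_⟩
      rw [e5, e6]
      simp [AccLog, HGraph.weight_empty, IsApprox])
    (fun B e he s h2 hA h9 hR => by
      obtain ⟨s', e1, e2, e3, e4⟩ := postLog_runs (lam := lam) (B := B) h2 hA.1 h9
      refine ⟨s', e1, e2, e3, AccLog.succ
        (Z := fun e => G.weight lam (range e)) (e := e) (ρ := G.ratio lam (range e) e)
        hDpos (G.ratio_pos hlam _ _).le hA.2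
        (G.weight_pos hlam _) ?_ hR (Nat.floor_le (by positivity)) h9 (hgap.trans ?_) e4⟩
      · rw [Finset.range_add_one]
        exact G.weight_insert_eq_mul hlam Finset.notMem_range_self
      · have h1 := ratioBound_le_ratio hlam (H := G) (A := range e) (f := e) (fun f => rfl) hdeg'
          Finset.notMem_range_self
        have h2 := ratioBound_pos (d := d) (k := k) hlam
        exact mul_le_mul_of_nonneg_left (log_le_log (by linarith) (by linarith)) hε0.le)
  refine ⟨m, t, hexec, ?_, by rw [hden]; exact Nat.mul_pos hDpos hDpos, ?_⟩
  · have h2 : (t : ℝ) ≤ A₁ * ((n + 1) * (r ^ 9 * (k * d) ^ (ℓ + 1))) := by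
      exact_mod_cast ht.trans (hA₁ r n hr0)
    calc (t : ℝ) ≤ A₁ * ((n + 1) * (r ^ 9 * (k * d) ^ (ℓ + 1))) := h2
      _ ≤ A₁ * ((n + 1) * (A₂ * ((k : ℝ) * d) ^ (B' * (1 / ε * log (1 / ε)) ^ 2))) := by
        gcongr _ * (_ * ?_)
        exact hA₂ r ε hε0 hε1 hr0 hr2
      _ = _ := by ring
  · change IsApprox ε (log (H.partitionFn lam)) _
    rw [H.partitionFn_eq_weight hsize, hden]
    exact happrox

end

theorem theorem1 :
    ∃ B : ℝ, ∀ d k : ℕ, 1 ≤ d → 1 ≤ k → ∀ lam : ℝ, 0 < lam →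
      (ENNReal.ofReal lam < lambdaC d k →
        (∃ C q : ℝ, 0 < C ∧ 0 < q ∧ q < 1 ∧
          ∀ (V : Type u) (E : Type v) (H : HGraph V E),
            H.EdgeSizeLE (d + 1) → H.DegreeLE (k + 1) →
              H.StrongSpatialMixing lam (fun ℓ => C * q ^ ℓ)) ∧
        (∃ x : ℝ, 0 < x ∧ x = k * lam / (1 + x) ^ d ∧ d * x / (1 + x) < 1 ∧
          ∃ (A : ℝ) (P : RAM.Prog),
            Approximates d k lam P (fun H => H.partitionFn lam)
              (fun n ε => A * (((n : ℝ) + 1) / ε) ^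
                (B * (1 + Real.log ((k : ℝ) * d) / Real.log ((1 + x) / (d * x))))))) ∧
      (ENNReal.ofReal lam = lambdaC d k →
        (∃ C α : ℝ, 0 < C ∧ 0 < α ∧
          ∀ (V : Type u) (E : Type v) (H : HGraph V E),
            H.EdgeSizeLE (d + 1) → H.DegreeLE (k + 1) →
              H.StrongSpatialMixing lam (fun ℓ => C * ((ℓ : ℝ) + 1) ^ (-α))) ∧
        (∃ (A B' : ℝ) (P : RAM.Prog),
          Approximates d k lam P (fun H => Real.log (H.partitionFn lam))
            (fun n ε => A * ((n : ℝ) + 1) *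
              ((k : ℝ) * d) ^ (B' * (1 / ε * Real.log (1 / ε)) ^ 2)))) := by
  refine ⟨7, fun d k hd hk lam hlam => ⟨fun hlt => ?_, fun heq => ?_⟩⟩
  · have hk0 : (0 : ℝ) < k := by exact_mod_cast hk
    obtain ⟨x, hx, hμ⟩ := exists_fixedPoint (d := d) (show 0 < (k : ℝ) * lam by positivity)
    have hdx := mul_lt_of_lt_lambdaC hd hk hlt hx hμ
    refine ⟨HGraph.exists_ssm_exp hd hk hlam hx hμ.symm hdx, x, hx, ?_, ?_,
      exists_approximates_partitionFn hd hk hlam hx hμ.symm hdx⟩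
    · rw [← hμ]; field_simp
    · rwa [div_lt_one (by positivity)]
  · obtain ⟨hd2, x, hx, hμ, hdx⟩ := fixedPoint_of_eq_lambdaC hd hk hlam heq
    exact ⟨HGraph.exists_ssm_poly hd hk hlam hx hμ hdx,
      exists_approximates_log_partitionFn hd hk (hd2.trans (Nat.le_mul_of_pos_left d hk)) hlam hx hμ
        hdx⟩
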